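/- **Setting.** A stable roommates instance $I$ consists of an even number $n$ of agents $a_1,\dots,a_n$, each of which has a strict preference ranking over all other agents; we extend each ranking by letting every agent rank itself last. A permutation $\Pi$ of the agents is a *stable partition* of $I$ if (T1) for every agent $x$, either $\Pi(x)=\Pi^{-1}(x)$ or $x$ prefers $\Pi(x)$ to $\Pi^{-1}(x)$, and (T2) there are no two distinct agents $x,y$ such that $x$ prefers $y$ to $\Pi^{-1}(x)$ and $y$ prefers $x$ to $\Pi^{-1}(y)$. A *stable even cycle* of $I$ is a cycle of even length greater than $2$ of some stable partition of $I$. **Theorem.** 1. (Uniqueness.) Let $a_{i_1}\neq a_{i_2}$ be agents of an instance $I$. If $(a_{i_1}\;a_{i_2}\;a_{i_3}\dots a_{i_{2k}})$ and $(a_{i_1}\;a_{i_2}\;a'_{i_3}\dots a'_{i_{2l}})$ are both stable even cycles of $I$, then $k=l$ and $a_{i_j}=a'_{i_j}$ for $3\le j\le 2k$. Hence the partial cycle $(a_{i_1}\;a_{i_2}\dots)$ has at most one completion to a stable even cycle of $I$. 2. (Linear time.) There is an algorithm that, given the $n$ preference lists of $I$ and two distinct agents $a_{i_1},a_{i_2}$,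 outputs a stable even cycle $(a_{i_1}\;a_{i_2}\;a_{i_3}\dots a_{i_{2k}})$ of $I$ if one exists, and otherwise reports that none exists, in time linear in the size of the preference lists, that is, in $O(n^2)$ steps of a random access machine with unit-cost operations on integers of size $O(n^2)$. -/

import Mathlib

namespace StableRoommates

/-! ### Instances, stable partitions and stable cycles -/

/-- A stable roommates instance with agents `Fin n` and complete strict preferences.
`pref i k` is the agent at position `k` (counted from `0`, best first) of the preference list
of agent `i`; every agent ranks itself last. -/
structure Instance (n : ℕ) where
  pref : Fin n → Equiv.Perm (Fin n)
  self_last : ∀ i j : Fin n, (pref i).symm j ≤ (pref i).symm i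

variable {n : ℕ}

/-- Agent `i` strictly prefers `j` to `k`. -/
def Instance.Prefers (I : Instance n) (i j k : Fin n) : Prop :=
  (I.pref i).symm j < (I.pref i).symm k

/-- `P` is a stable partition: `P i` is the successor and `P⁻¹ i` the predecessor of `i`. -/
structure Instance.IsStablePartition (I : Instance n) (P : Equiv.Perm (Fin n)) : Prop where
  succ_ge_pred : ∀ i, P i = P⁻¹ i ∨ I.Prefers i (P i) (P⁻¹ i)
  no_blocking_pair : ¬ ∃ i j, i ≠ j ∧ I.Prefers i j (P⁻¹ i) ∧ I.Prefers j i (P⁻¹ j)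

/-- The list `c = [c₀, …, c₍ₘ₋₁₎]` of distinct agents is a cycle `(c₀ … c₍ₘ₋₁₎)` of the
permutation `P`, that is, `[P c₀, …, P c₍ₘ₋₁₎] = [c₁, …, c₍ₘ₋₁₎, c₀]`. -/
def IsCycleOf (P : Equiv.Perm (Fin n)) (c : List (Fin n)) : Prop :=
  c ≠ [] ∧ c.Nodup ∧ c.map P = c.rotate 1

/-- `c` is a stable cycle of `I`: a cycle of some stable partition. -/
def Instance.IsStableCycle (I : Instance n) (c : List (Fin n)) : Prop :=
  ∃ P : Equiv.Perm (Fin n), I.IsStablePartition P ∧ IsCycleOf P c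

/-- `c` is a stable cycle of even length greater than two. -/
def Instance.IsEvenCycle (I : Instance n) (c : List (Fin n)) : Prop :=
  I.IsStableCycle c ∧ Even c.length ∧ 2 < c.length

/-- The sequence `r` completes the partial cycle `(a b …)` to a stable cycle of even length
greater than two. -/
def Instance.IsEvenCompletion (I : Instance n) (a b : Fin n) (r : List (Fin n)) : Prop :=
  I.IsEvenCycle (a :: b :: r)

end StableRoommates

/-! ### A random access machine with a step count

Programs are while programs over finitely many integer variables and arrays (both named by
numerals that are fixed in the program text), with indirect access to array cells. Every
operation has unit cost, and the word size is bounded: a run never produces a number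
above a prescribed bound `B`. -/

namespace RAM

/-- A memory state: variables and arrays. -/
structure State where
  var : ℕ → ℕ
  arr : ℕ → ℕ → ℕ

/-- The arithmetic operations and tests. -/
inductive Op where
  | add | sub | mul | eq | lt

/-- Subtraction is truncated; the tests return `1` for true and `0` for false. -/
def Op.apply : Op → ℕ → ℕ → ℕ
  | .add, x, y => x + y
  | .sub, x, y => x - y
  | .mul, x, y => x * y
  | .eq, x, y => if x = y then 1 else 0
  | .lt, x, y => if x < y then 1 else 0

inductive Expr where
  | lit (k : ℕ)
  | var (x : ℕ)
  | get (a : ℕ) (index : Expr)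
  | bin (op : Op) (e₁ e₂ : Expr)

/-- The value of an expression. -/
def Expr.eval (s : State) : Expr → ℕ
  | .lit k => k
  | .var x => s.var x
  | .get a e => s.arr a (e.eval s)
  | .bin op e₁ e₂ => op.apply (e₁.eval s) (e₂.eval s)

/-- The number of elementary operations in the evaluation of an expression. -/
def Expr.cost : Expr → ℕ
  | .lit _ => 1
  | .var _ => 1
  | .get _ e => e.cost + 1
  | .bin _ e₁ e₂ => e₁.cost + e₂.cost + 1

/-- All numbers that occur in the evaluation of an expression, array indices included, are at
most `B`. -/
def Expr.Fits (B : ℕ) (s : State) : Expr → Prop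
  | .lit k => k ≤ B
  | .var x => s.var x ≤ B
  | .get a e => e.Fits B s ∧ s.arr a (e.eval s) ≤ B
  | .bin op e₁ e₂ => e₁.Fits B s ∧ e₂.Fits B s ∧ op.apply (e₁.eval s) (e₂.eval s) ≤ B

inductive Cmd where
  | skip
  | assign (x : ℕ) (e : Expr)
  | store (a : ℕ) (index e : Expr)
  | seq (c₁ c₂ : Cmd)
  | ite (cond : Expr) (c₁ c₂ : Cmd)
  | while (cond : Expr) (body : Cmd)

/-- `s` with the variable `x` set to `v`. -/
def State.setVar (s : State) (x v : ℕ) : State :=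
  { s with var := Function.update s.var x v }

/-- `s` with the cell `a[i]` set to `v`. -/
def State.setArr (s : State) (a i v : ℕ) : State :=
  { s with arr := Function.update s.arr a (Function.update (s.arr a) i v) }

/-- `Exec B c s s' t`: started in state `s`, the program `c` halts in state `s'` after exactly
`t` steps, and all numbers that occur in the run are at most `B`. A condition counts as true
if its value is nonzero. -/
inductive Exec (B : ℕ) : Cmd → State → State → ℕ → Prop where
  | skip (s : State) : Exec B .skip s s 1
  | assign (s : State) (x : ℕ) (e : Expr) (he : e.Fits B s) :
      Exec B (.assign x e) s (s.setVar x (e.eval s)) (e.cost + 1)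
  | store (s : State) (a : ℕ) (i e : Expr) (hi : i.Fits B s) (he : e.Fits B s) :
      Exec B (.store a i e) s (s.setArr a (i.eval s) (e.eval s)) (i.cost + e.cost + 1)
  | seq {c₁ c₂ : Cmd} {s s' s'' : State} {t₁ t₂ : ℕ}
      (h₁ : Exec B c₁ s s' t₁) (h₂ : Exec B c₂ s' s'' t₂) :
      Exec B (.seq c₁ c₂) s s'' (t₁ + t₂)
  | ite_true {e : Expr} {c₁ c₂ : Cmd} {s s' : State} {t : ℕ} (he : e.Fits B s)
      (hv : e.eval s ≠ 0) (h : Exec B c₁ s s' t) :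
      Exec B (.ite e c₁ c₂) s s' (e.cost + 1 + t)
  | ite_false {e : Expr} {c₁ c₂ : Cmd} {s s' : State} {t : ℕ} (he : e.Fits B s)
      (hv : e.eval s = 0) (h : Exec B c₂ s s' t) :
      Exec B (.ite e c₁ c₂) s s' (e.cost + 1 + t)
  | while_false {e : Expr} {c : Cmd} {s : State} (he : e.Fits B s) (hv : e.eval s = 0) :
      Exec B (.while e c) s s (e.cost + 1)
  | while_true {e : Expr} {c : Cmd} {s s' s'' : State} {t₁ t₂ : ℕ} (he : e.Fits B s)
      (hv : e.eval s ≠ 0) (h₁ : Exec B c s s' t₁) (h₂ : Exec B (.while e c) s' s'' t₂) :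
      Exec B (.while e c) s s'' (e.cost + 1 + t₁ + t₂)

/-- The output of a halted run: the list of the first `m` cells of array `1`, where `m` is the
value of variable `3`. -/
def State.output (s : State) : List ℕ :=
  (List.range (s.var 3)).map (s.arr 1)

end RAM

namespace StableRoommates

variable {n : ℕ}

/-- The input encoding: variable `0` holds the number of agents, variables `1` and `2` hold the
two agents of the pair, and array `0` holds the preference lists one after the other, `n` cells
per list, the agent itself in the last of them. All other variables and cells are `0`. -/
def Instance.input (I : Instance n) (a b : Fin n) : RAM.State where
  var x := if x = 0 then n else if x = 1 then a else if x = 2 then b else 0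
  arr x k :=
    if h : x = 0 ∧ k < n * n then
      I.pref ⟨k / n, Nat.div_lt_of_lt_mul h.2⟩
        ⟨k % n, Nat.mod_lt _ (Nat.pos_of_mul_pos_left (Nat.zero_lt_of_lt h.2))⟩
    else 0

end StableRoommates

/-!
Both parts of the theorem come out of the analysis of one algorithm.

*Tables.* In the proposal process every agent proposes down its list, and an agent holding a
proposal accepts only better proposers. When it ends, all that matters is the permutation `f` that
sends each agent to the one holding its proposal: `f x` is the first and `f⁻¹ x` the last entry of
the reduced list of `x` (`Instance.IsTable`). A table without blocking pairs is a stable partition.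
Otherwise let `h x` be the agent whose proposal is held by the second entry of the list of `x`. The
iterates of `h` lead from a blocking agent into a cycle of `h`, a rotation, and eliminating it, that
is, letting all its agents move on to their second entries, gives a smaller table. Unions of cycles
of `f` that take part in no blocking pair survive all eliminations, and so every table refines to a
stable partition that contains any given such cycles (`Instance.IsTable.exists_stablePartition`).

*Finding the cycle.* Suppose that some stable partitions `P` satisfy `P a = b` and `P b ≠ a`
(`Instance.Completing`). They survive if `a` first makes offers to all agents that it prefers to
`b` and starts proposing at `b`, so `b` is the first choice of `a` in the resulting table, or there
are no such partitions. The search follows `h` from `a`, keeping the agents visited on a stack. A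
step from `u` to `w = h u` carries information backwards (`Instance.Link.apply`): if `P` gives `w`
its first choice, then it gives `u` its first choice, and either `u` lies on a cycle of length two
or `P (P w) = u`. There are two ways in which the search can close up.

* At `a`. Then all agents on the stack have their first choices as successors in `P`. A cycle of
  length two would propagate to the bottom of the stack, where `a` is not on one. So `P` runs
  through the stack in steps of two, from `a` back to `a`, and the cycle is determined completely
  (`Instance.SearchInv.found`, `Found.eq_map_candidate`). This gives uniqueness.
* At an agent `q ≠ a`. If an agent of the rotation kept its first choice in `P`, then so would `q`,
  and `P (P q)` would be both the top of the stack and the agent below `q`. So the rotation can be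
  eliminated without losing any `P` (`Instance.SearchInv.later`), and the search goes on.

If the list of the top of the stack is found to be exhausted, there are no such partitions
(`Instance.SearchInv.eq_empty`).

*Verifying the candidate.* To decide whether the candidate is a cycle of a stable partition, each
of its agents makes offers in advance to all agents, besides its successor, that it prefers to its
predecessor, and starts proposing at its successor. If there is such a partition, the proposal
process leaves these agents where they started. Conversely, if it does so, the offers ensure that
the candidate takes part in no blocking pair, and the existence theorem yields the partition
(`Instance.OfferInv.nonempty`).

*Running time.* All parts are quadratic, by amortization: first choices, second choices and bounds
move in one direction only (`proposePotential`, `Reaches.while`), and every agent that is pushed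
onto the stack advances its second choice.

*Memory.* Besides the preference lists (array `0`) and the candidate (array `1`), the program
keeps the positions of all agents on all lists (array `2`), the positions `F` of first choices
(array `3`), the bounds `U` below which proposers are accepted (array `4`), the proposals `H` that
are held (array `5`), the positions `G` of second choices (array `6`) and the stack (array `8`).
Variable `7` reports a failure of the proposal process, variable `12` holds the height of the
stack, variable `16` the success of the search, and variable `17` the length of the candidate.
-/

namespace StableRoommates

variable {n : ℕ}

/-! ### Tables and the existence of stable partitions -/

/-- The position of `y` in the preference list of `x`; smaller is better. -/
def Instance.rank (I : Instance n) (x y : Fin n) : ℕ := (I.pref x).symm y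

theorem Instance.rank_lt (I : Instance n) (x y : Fin n) : I.rank x y < n :=
  ((I.pref x).symm y).2

theorem Instance.rank_inj (I : Instance n) {x y z : Fin n} :
    I.rank x y = I.rank x z ↔ y = z := by
  simp [Instance.rank, Fin.val_inj]

theorem Instance.rank_ne (I : Instance n) {x y z : Fin n} (h : y ≠ z) :
    I.rank x y ≠ I.rank x z := fun e => h (I.rank_inj.1 e)

theorem Instance.rank_self (I : Instance n) (x y : Fin n) : I.rank x y ≤ I.rank x x :=
  I.self_last x y

/-- A preference table that is closed under proposals, encoded by the permutation `f` that sends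
each agent to the first entry of its reduced list. The last entry is then `f⁻¹ x`, and the reduced
list of `x` consists of those agents `y` between the two that also have `x` between theirs. The
agents that `x` prefers to `f x` have rejected `x`: they prefer their last entry to it. -/
structure Instance.IsTable (I : Instance n) (f : Equiv.Perm (Fin n)) : Prop where
  first_le_last : ∀ x, I.rank x (f x) ≤ I.rank x (f⁻¹ x)
  rejected : ∀ x y, I.rank x y < I.rank x (f x) → I.rank y (f⁻¹ y) < I.rank y x

/-- `x` and `y` prefer each other to their predecessors under `f`. -/
def Instance.Blocks (I : Instance n) (f : Equiv.Perm (Fin n)) (x y : Fin n) : Prop :=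
  I.rank x y < I.rank x (f⁻¹ x) ∧ I.rank y x < I.rank y (f⁻¹ y)

/-- A union of cycles of `f` whose agents take part in no blocking pair, so that their reduced
lists have no entries besides successor and predecessor. -/
structure Instance.IsIsolated (I : Instance n) (f : Equiv.Perm (Fin n)) (C : Set (Fin n)) :
    Prop where
  map : ∀ x ∈ C, f x ∈ C
  not_blocks : ∀ x ∈ C, ∀ y, ¬ I.Blocks f x y

/-- `y` comes after the first entry of the list of `x`, and would rather have `x` than its
own last entry. -/
def Instance.Accepts (I : Instance n) (f : Equiv.Perm (Fin n)) (x y : Fin n) : Prop :=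
  I.rank x (f x) < I.rank x y ∧ I.rank y x < I.rank y (f⁻¹ y)

/-- For every agent `x` whose list has at least two entries, `f (h x)` is the second one. -/
def Instance.IsNext (I : Instance n) (f : Equiv.Perm (Fin n)) (h : Fin n → Fin n) : Prop :=
  ∀ x, f (f x) ≠ x → I.Accepts f x (f (h x)) ∧
    ∀ z, I.Accepts f x z → I.rank x (f (h x)) ≤ I.rank x z

theorem perm_inv_apply_self (f : Equiv.Perm (Fin n)) (x : Fin n) : f⁻¹ (f x) = x :=
  f.symm_apply_apply x

theorem surjOn_self_of_injOn {s : Set (Fin n)} {g : Fin n → Fin n} (hm : Set.MapsTo g s s)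
    (hi : Set.InjOn g s) : Set.SurjOn g s s :=
  (Set.eq_of_subset_of_ncard_le hm.image_subset hi.ncard_image.ge
    (Set.toFinite s)).ge

section Table

variable {I : Instance n} {f : Equiv.Perm (Fin n)} {h : Fin n → Fin n}

theorem perm_inv_eq_of_apply_eq {x y : Fin n} (hxy : f x = y) : f⁻¹ y = x := by
  rw [← hxy]; simp

theorem Instance.IsTable.accepts_last (hf : I.IsTable f) {x : Fin n} (hx : f (f x) ≠ x) :
    I.Accepts f x (f⁻¹ x) := by
  have h1 := hf.first_le_last x
  have h2 := hf.first_le_last (f⁻¹ x)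
  have hne : f x ≠ f⁻¹ x := fun e => hx (by rw [e]; simp)
  have hne' : x ≠ f⁻¹ (f⁻¹ x) := fun e => hne (by nth_rewrite 1 [e]; simp)
  refine ⟨lt_of_le_of_ne h1 (I.rank_ne hne), lt_of_le_of_ne ?_ (I.rank_ne hne')⟩
  simpa using h2

theorem Instance.IsTable.exists_isNext (hf : I.IsTable f) : ∃ h, I.IsNext f h := by
  have : ∀ x, ∃ w, f (f x) ≠ x → I.Accepts f x (f w) ∧
      ∀ z, I.Accepts f x z → I.rank x (f w) ≤ I.rank x z := by
    intro x
    by_cases hx : f (f x) = x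
    · exact ⟨x, fun hh => absurd hx hh⟩
    · obtain ⟨y, hy, hm⟩ := Set.exists_min_image {y | I.Accepts f x y} (I.rank x)
        (Set.toFinite _) ⟨_, hf.accepts_last hx⟩
      exact ⟨f⁻¹ y, fun _ => by simpa using ⟨hy, hm⟩⟩
  choose h hh using this
  exact ⟨h, hh⟩

theorem Instance.IsTable.next_le_last (hf : I.IsTable f) (hh : I.IsNext f h) {x : Fin n}
    (hx : f (f x) ≠ x) : I.rank x (f (h x)) ≤ I.rank x (f⁻¹ x) :=
  (hh x hx).2 _ (hf.accepts_last hx)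

theorem Instance.IsTable.le_of_next (hf : I.IsTable f) (hh : I.IsNext f h) {x : Fin n}
    (hx : f (f x) ≠ x) : I.rank (f (h x)) (f (f (h x))) ≤ I.rank (f (h x)) x := by
  by_contra hlt
  have h1 := hf.rejected _ _ (not_le.1 hlt)
  have h2 := hf.next_le_last hh hx
  omega

theorem Instance.IsTable.next_mem (hf : I.IsTable f) (hh : I.IsNext f h) {x : Fin n}
    (hx : f (f x) ≠ x) : f (f (h x)) ≠ h x := by
  intro e
  have h1 := hf.le_of_next hh hx
  have h2 := (hh x hx).1.2
  rw [e] at h1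
  simp only [perm_inv_apply_self] at h2
  omega

theorem Instance.IsTable.ne_of_blocks (hf : I.IsTable f) {x y : Fin n} (hb : I.Blocks f x y) :
    f (f x) ≠ x := by
  intro e
  have h1 : f⁻¹ x = f x := perm_inv_eq_of_apply_eq e
  have := hf.rejected x y (h1 ▸ hb.1)
  have := hb.2
  omega

theorem Instance.IsTable.accepts_of_blocks (hf : I.IsTable f) {x y : Fin n}
    (hb : I.Blocks f x y) : I.Accepts f x y := by
  refine ⟨?_, hb.2⟩
  by_contra hlt
  rcases (not_lt.1 hlt).lt_or_eq with h1 | h1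
  · have := hf.rejected x y h1
    have := hb.2
    omega
  · have h2 := hb.2
    rw [I.rank_inj.1 h1] at h2
    simp at h2

/-- An isolated set cannot be entered from outside along the map `h`. -/
theorem Instance.IsIsolated.mem_of_next (hf : I.IsTable f) (hh : I.IsNext f h)
    {G : Set (Fin n)} (hG : I.IsIsolated f G) {x : Fin n} (hx : f (f x) ≠ x) (hm : h x ∈ G) :
    x ∈ G := by
  by_contra hxG
  have hy := hG.map _ hm
  refine hG.not_blocks _ hy x ⟨(hh x hx).1.2, lt_of_le_of_ne (hf.next_le_last hh hx) ?_⟩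
  refine I.rank_ne fun e => hxG ?_
  have := hG.map _ hy
  rw [e] at this
  simpa using this

theorem Instance.IsIsolated.mem_of_iterate (hf : I.IsTable f) (hh : I.IsNext f h)
    {G : Set (Fin n)} (hG : I.IsIsolated f G) (k : ℕ) :
    ∀ {x : Fin n}, f (f x) ≠ x → h^[k] x ∈ G → x ∈ G := by
  induction k with
  | zero => intro x _ hm; exact hm
  | succ k ih =>
    intro x hx hm
    exact hG.mem_of_next hf hh hx (ih (hf.next_mem hh hx) hm)

theorem Instance.IsTable.iterate_mem (hf : I.IsTable f) (hh : I.IsNext f h) (k : ℕ) :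
    ∀ {x : Fin n}, f (f x) ≠ x → f (f (h^[k] x)) ≠ h^[k] x := by
  induction k with
  | zero => intro x hx; exact hx
  | succ k ih => intro x hx; exact ih (hf.next_mem hh hx)

/-- The agents at which the elimination of the rotation `O` would exhaust a reduced list form an
isolated set. If `O` is a single orbit of `h`, this is an odd cycle of `f`, which `h` traverses
backwards in steps of two. -/
theorem Instance.IsTable.isIsolated_bad (hf : I.IsTable f) (hh : I.IsNext f h)
    {O : Set (Fin n)} (hO : ∀ x ∈ O, f (f x) ≠ x) (hsurj : ∀ x ∈ O, ∃ w ∈ O, h w = x) :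
    I.IsIsolated f {x | x ∈ O ∧ f x ∈ O ∧ f (f x) ∈ O ∧ h (f (f x)) = x} := by
  set D : Set (Fin n) := {x | x ∈ O ∧ f x ∈ O ∧ f (f x) ∈ O ∧ h (f (f x)) = x} with hD
  have hmap : ∀ x ∈ D, f x ∈ D := by
    rintro x ⟨hx, hfx, hffx, hx'⟩
    obtain ⟨w, hw, hwx⟩ := hsurj _ hfx
    suffices hs : w = f (f (f x)) by
      refine ⟨hfx, hffx, ?_, ?_⟩ <;> rw [← hs] <;> assumption
    by_contra hne
    -- `f (f x)` is the second choice of `w`. As `w` is not its first choice, `w` is an entry of its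
    -- list between the first one and `f x`, but `f x` is the second entry there.
    have hm := (hh _ (hO _ hffx)).2 w
    rw [hx'] at hm
    have h1 := hf.le_of_next hh (hO w hw)
    have h2 := hf.next_le_last hh (hO w hw)
    have h3 := (hh w (hO w hw)).1.2
    rw [hwx] at h1 h2 h3
    have h4 : f (f (f x)) ≠ w := fun e => hne e.symm
    have h5 : f (f x) ≠ f⁻¹ w := fun e => hne (by rw [e]; simp)
    have h6 := hm ⟨lt_of_le_of_ne h1 (I.rank_ne h4), lt_of_le_of_ne h2 (I.rank_ne h5)⟩
    simp only [perm_inv_apply_self] at h3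
    omega
  refine ⟨hmap, ?_⟩
  have hbij : Set.SurjOn f D D :=
    surjOn_self_of_injOn hmap f.injective.injOn
  rintro u hu y hb
  obtain ⟨v, hv, rfl⟩ := hbij hu
  obtain ⟨x, ⟨hx, hfx, hffx, hx'⟩, rfl⟩ := hbij hv
  -- `f (f x)` has no entries between the first one and `f x`, which is its last one
  have h1 := (hh _ (hO _ hffx)).2 y (hf.accepts_of_blocks hb)
  have h2 := hb.1
  rw [hx'] at h1
  simp only [perm_inv_apply_self] at h2
  omega

/-- Eliminating the rotation `O`: every agent of `O` moves on to the second entry of its list. By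
`hbad` this exhausts no list. -/
theorem Instance.IsTable.eliminate (hf : I.IsTable f) (hh : I.IsNext f h)
    {O : Set (Fin n)} (hO : ∀ x ∈ O, f (f x) ≠ x)
    (hbad : ∀ x, ¬ (x ∈ O ∧ f x ∈ O ∧ f (f x) ∈ O ∧ h (f (f x)) = x))
    {σ : Equiv.Perm (Fin n)} (hσ : ∀ x ∈ O, σ x = h x) (hσO : ∀ x ∈ O, h x ∈ O)
    (hσ' : ∀ x ∉ O, σ x = x) :
    I.IsTable (f * σ) ∧ ∀ z, I.rank z ((f * σ)⁻¹ z) ≤ I.rank z (f⁻¹ z) := by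
  have key : ∀ z, ∃ w, (f * σ)⁻¹ z = w ∧ f (σ w) = z :=
    fun z => ⟨_, rfl, Equiv.apply_symm_apply (f * σ) z⟩
  have himp : ∀ z, I.rank z ((f * σ)⁻¹ z) ≤ I.rank z (f⁻¹ z) := by
    intro z
    obtain ⟨w, hw, hz⟩ := key z
    rw [hw]
    by_cases hwO : w ∈ O
    · rw [hσ w hwO] at hz
      have := (hh w (hO w hwO)).1.2
      rw [hz] at this
      exact this.le
    · rw [hσ' w hwO] at hz
      rw [perm_inv_eq_of_apply_eq hz]
  refine ⟨⟨?_, ?_⟩, himp⟩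
  · intro z
    obtain ⟨w, hw, hz⟩ := key z
    rw [hw, Equiv.Perm.mul_apply]
    by_cases hwO : w ∈ O
    · rw [hσ w hwO] at hz
      have h1 := hf.le_of_next hh (hO w hwO)
      rw [hz] at h1
      by_cases hzO : z ∈ O
      · rw [hσ z hzO]
        -- `w` now proposes to `z`, and `z` only moves past `w` if `w` was its first choice
        by_cases hfz : f z = w
        · exact absurd ⟨hσO w hwO, hz ▸ hzO, by rw [hz, hfz]; exact hwO,
            by rw [hz, hfz]⟩ (hbad (h w))
        · refine (hh z (hO z hzO)).2 w ⟨lt_of_le_of_ne h1 (I.rank_ne hfz), ?_⟩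
          have h2 := hf.next_le_last hh (hO w hwO)
          rw [hz] at h2
          exact lt_of_le_of_ne h2 (I.rank_ne fun e => hfz (by rw [e]; simp))
      · rw [hσ' z hzO]
        exact h1
    · rw [hσ' w hwO] at hz
      rw [← perm_inv_eq_of_apply_eq hz]
      by_cases hzO : z ∈ O
      · rw [hσ z hzO]
        exact hf.next_le_last hh (hO z hzO)
      · rw [hσ' z hzO]
        exact hf.first_le_last z
  · intro x y hxy
    rw [Equiv.Perm.mul_apply] at hxy
    by_cases hxO : x ∈ O
    · rw [hσ x hxO] at hxy
      rcases lt_trichotomy (I.rank x y) (I.rank x (f x)) with h1 | h1 | h1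
      · exact (himp y).trans_lt (hf.rejected x y h1)
      · have h1 := I.rank_inj.1 h1
        obtain ⟨w, hw, hz⟩ := key y
        have hwx : σ w = x := f.injective (hz.trans h1)
        have hwO : w ∈ O := by
          by_contra hwO
          exact hwO (by rw [← hσ' w hwO, hwx]; exact hxO)
        have h2 := (hh w (hO w hwO)).1.2
        rw [← hσ w hwO, hz, h1] at h2
        rw [hw, h1]
        simpa using h2
      · have h2 : ¬ I.Accepts f x y := fun ha => by
          have := (hh x (hO x hxO)).2 y ha
          omega
        have h3 : I.rank y (f⁻¹ y) ≤ I.rank y x := by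
          by_contra hlt
          exact h2 ⟨h1, not_le.1 hlt⟩
        refine (himp y).trans_lt (lt_of_le_of_ne h3 (I.rank_ne fun e => ?_))
        rw [← e] at h1
        simp at h1
    · rw [hσ' x hxO] at hxy
      exact (himp y).trans_lt (hf.rejected x y hxy)

end Table

/-- Every table can be refined to a stable partition, and the agents of an isolated set keep
their successors. The number `m` bounds by how much the positions of the first entries can still
grow. -/
theorem Instance.IsTable.exists_stablePartition (I : Instance n) (C : Set (Fin n)) :
    ∀ (m : ℕ) (f : Equiv.Perm (Fin n)), n * n ≤ m + ∑ x, I.rank x (f x) → I.IsTable f →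
      I.IsIsolated f C → ∃ P, I.IsStablePartition P ∧ ∀ x ∈ C, P x = f x := by
  intro m
  induction m with
  | zero =>
    intro f hm hf hC
    have hle : ∀ x ∈ Finset.univ, I.rank x (f x) + 1 ≤ n := fun x _ => I.rank_lt x (f x)
    have := Finset.sum_le_sum hle
    simp only [Finset.sum_add_distrib, Finset.sum_const, Finset.card_univ, Fintype.card_fin,
      smul_eq_mul, mul_one] at this
    have hn : n = 0 := by omega
    subst hn
    exact ⟨f, ⟨fun i => i.elim0, fun ⟨i, _⟩ => i.elim0⟩, fun x _ => rfl⟩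
  | succ m ih =>
    intro f hm hf hC
    by_cases hb : ∃ x y, I.Blocks f x y
    · obtain ⟨x, y, hb⟩ := hb
      obtain ⟨h, hh⟩ := hf.exists_isNext
      have hx := hf.ne_of_blocks hb
      -- The iterates of `h` lead from `x` into a periodic orbit `O`, which is the rotation to
      -- eliminate. An isolated set that meets `O` would contain `x`, so `O` avoids both `C` and
      -- the isolated set of agents whose lists would be exhausted.
      obtain ⟨i, j, hij, he⟩ := Finite.exists_ne_map_eq_of_infinite fun k : ℕ => h^[k] x
      wlog hlt : i < j generalizing i j
      · exact this j i hij.symm he.symm (by omega)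
      set u := h^[i] x with hu
      set O : Set (Fin n) := {w | ∃ k, h^[k] u = w} with hOdef
      have hper : Function.IsPeriodicPt h (j - i) u := by
        change h^[j - i] (h^[i] x) = h^[i] x
        rw [← Function.iterate_add_apply, Nat.sub_add_cancel hlt.le]
        exact he.symm
      have huX : f (f u) ≠ u := hf.iterate_mem hh i hx
      have hO : ∀ w ∈ O, f (f w) ≠ w := by
        rintro w ⟨k, rfl⟩
        exact hf.iterate_mem hh k huX
      have hOh : ∀ w ∈ O, h w ∈ O := by
        rintro w ⟨k, rfl⟩
        exact ⟨k + 1, Function.iterate_succ_apply' h k u⟩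
      have hOx : ∀ w ∈ O, ∃ k, h^[k] x = w := by
        rintro w ⟨k, rfl⟩
        exact ⟨k + i, Function.iterate_add_apply h k i x⟩
      have hOper : O ⊆ Function.periodicPts h := by
        rintro w ⟨k, rfl⟩
        exact Function.mk_mem_periodicPts (by omega) (hper.apply_iterate k)
      have hinj : Set.InjOn h O := (Function.bijOn_periodicPts h).injOn.mono hOper
      have hsurj : ∀ w ∈ O, ∃ v ∈ O, h v = w :=
        surjOn_self_of_injOn hOh hinj
      have hnotin : ∀ G, I.IsIsolated f G → ∀ w ∈ O, w ∉ G := by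
        intro G hG w hw hwG
        obtain ⟨k, rfl⟩ := hOx w hw
        exact hG.not_blocks x (hG.mem_of_iterate hf hh k hx hwG) y hb
      have hbad := hf.isIsolated_bad hh hO hsurj
      classical
      have hσ : Function.Injective fun w => if w ∈ O then h w else w := by
        intro v w hvw
        by_cases hv : v ∈ O <;> by_cases hw : w ∈ O <;> simp only [hv, hw, if_true, if_false] at hvw
        · exact hinj hv hw hvw
        · exact absurd (hvw ▸ hOh v hv) hw
        · exact absurd (hvw ▸ hOh w hw) hv
        · exact hvw
      set σ : Equiv.Perm (Fin n) := Equiv.ofBijective _ (Finite.injective_iff_bijective.1 hσ)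
      have hσ1 : ∀ w ∈ O, σ w = h w := fun w hw => if_pos hw
      have hσ2 : ∀ w ∉ O, σ w = w := fun w hw => if_neg hw
      obtain ⟨hf', himp⟩ := hf.eliminate hh hO
        (fun w hw => hnotin _ hbad w hw.1 hw) hσ1 hOh hσ2
      have hCO : ∀ w ∈ C, (f * σ) w = f w := fun w hw => by
        rw [Equiv.Perm.mul_apply, hσ2 w fun hwO => hnotin C hC w hwO hw]
      have hC' : I.IsIsolated (f * σ) C :=
        ⟨fun w hw => by rw [hCO w hw]; exact hC.map w hw, fun w hw z hz =>
          hC.not_blocks w hw z ⟨hz.1.trans_le (himp w), hz.2.trans_le (himp z)⟩⟩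
      have hsum : ∑ w, I.rank w (f w) < ∑ w, I.rank w ((f * σ) w) := by
        refine Finset.sum_lt_sum (fun w _ => ?_) ⟨u, Finset.mem_univ _, ?_⟩
        · by_cases hw : w ∈ O
          · rw [Equiv.Perm.mul_apply, hσ1 w hw]
            exact (hh w (hO w hw)).1.1.le
          · rw [Equiv.Perm.mul_apply, hσ2 w hw]
        · rw [Equiv.Perm.mul_apply, hσ1 u ⟨0, rfl⟩]
          exact (hh u huX).1.1
      obtain ⟨P, hP, hPC⟩ := ih (f * σ) (by omega) hf' hC'
      exact ⟨P, hP, fun w hw => (hPC w hw).trans (hCO w hw)⟩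
    · push Not at hb
      refine ⟨f, ⟨fun x => ?_, ?_⟩, fun x _ => rfl⟩
      · rcases (hf.first_le_last x).lt_or_eq with h1 | h1
        · exact Or.inr (Fin.lt_def.2 h1)
        · exact Or.inl (I.rank_inj.1 h1)
      · rintro ⟨x, y, -, h1, h2⟩
        exact hb x y ⟨Fin.lt_def.1 h1, Fin.lt_def.1 h2⟩

end StableRoommates

namespace RAM

/-! ### Reasoning about programs -/

@[simp] theorem State.setVar_var (s : State) (x v y : ℕ) :
    (s.setVar x v).var y = if y = x then v else s.var y := by
  simp [State.setVar, Function.update_apply]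

@[simp] theorem State.setVar_arr (s : State) (x v : ℕ) : (s.setVar x v).arr = s.arr := rfl

@[simp] theorem State.setArr_var (s : State) (a i v : ℕ) : (s.setArr a i v).var = s.var := rfl

@[simp] theorem State.setArr_arr (s : State) (a i v b j : ℕ) :
    (s.setArr a i v).arr b j = if b = a ∧ j = i then v else s.arr b j := by
  by_cases hb : b = a
  · subst hb
    simp [State.setArr, Function.update_apply]
  · simp [State.setArr, hb]

/-- The first `n` cells of the array `a`. -/
def State.tab (n : ℕ) (s : State) (a : ℕ) : Fin n → ℕ := fun x => s.arr a x

@[simp] theorem State.tab_apply {n : ℕ} (s : State) (a : ℕ) (x : Fin n) :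
    s.tab n a x = s.arr a x := rfl

@[simp] theorem State.tab_setVar (n : ℕ) (s : State) (x v a : ℕ) :
    (s.setVar x v).tab n a = s.tab n a := rfl

theorem State.tab_setArr_self {n : ℕ} (s : State) (a : ℕ) (i : Fin n) (v : ℕ) :
    (s.setArr a i v).tab n a = Function.update (s.tab n a) i v := by
  funext x
  simp [Function.update_apply, Fin.val_inj]

theorem State.tab_setArr_of_ne (n : ℕ) (s : State) {a b : ℕ} (i v : ℕ) (h : b ≠ a) :
    (s.setArr a i v).tab n b = s.tab n b := by
  funext x
  simp [h]

/-- The expression `e` has value `v` and its evaluation respects the bound `B`. -/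
def Evals (B : ℕ) (s : State) (e : Expr) (v : ℕ) : Prop :=
  e.Fits B s ∧ e.eval s = v

section Evals

variable {B : ℕ} {s : State} {e e₁ e₂ : Expr} {v w : ℕ}

theorem Evals.lit {k : ℕ} (h : k ≤ B) : Evals B s (.lit k) k := ⟨h, rfl⟩

theorem Evals.var {x : ℕ} (h : s.var x = v) (hv : v ≤ B) : Evals B s (.var x) v :=
  ⟨h.trans_le hv, h⟩

theorem Evals.get {a : ℕ} (h : Evals B s e v) (hw : s.arr a v = w) (hB : w ≤ B) :
    Evals B s (.get a e) w := by
  obtain ⟨h1, rfl⟩ := h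
  exact ⟨⟨h1, hw.trans_le hB⟩, hw⟩

theorem Evals.add (h₁ : Evals B s e₁ v) (h₂ : Evals B s e₂ w) (hB : v + w ≤ B) :
    Evals B s (.bin .add e₁ e₂) (v + w) := by
  obtain ⟨h1, rfl⟩ := h₁
  obtain ⟨h2, rfl⟩ := h₂
  exact ⟨⟨h1, h2, hB⟩, rfl⟩

theorem Evals.mul (h₁ : Evals B s e₁ v) (h₂ : Evals B s e₂ w) (hB : v * w ≤ B) :
    Evals B s (.bin .mul e₁ e₂) (v * w) := by
  obtain ⟨h1, rfl⟩ := h₁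
  obtain ⟨h2, rfl⟩ := h₂
  exact ⟨⟨h1, h2, hB⟩, rfl⟩

theorem Evals.sub (h₁ : Evals B s e₁ v) (h₂ : Evals B s e₂ w) (hB : v ≤ B) :
    Evals B s (.bin .sub e₁ e₂) (v - w) := by
  obtain ⟨h1, rfl⟩ := h₁
  obtain ⟨h2, rfl⟩ := h₂
  exact ⟨⟨h1, h2, (Nat.sub_le _ _).trans hB⟩, rfl⟩

theorem Evals.lt (h₁ : Evals B s e₁ v) (h₂ : Evals B s e₂ w) (hB : 1 ≤ B) :
    Evals B s (.bin .lt e₁ e₂) (if v < w then 1 else 0) := by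
  obtain ⟨h1, rfl⟩ := h₁
  obtain ⟨h2, rfl⟩ := h₂
  refine ⟨⟨h1, h2, ?_⟩, rfl⟩
  simp only [Op.apply]
  split <;> omega

theorem Evals.eq (h₁ : Evals B s e₁ v) (h₂ : Evals B s e₂ w) (hB : 1 ≤ B) :
    Evals B s (.bin .eq e₁ e₂) (if v = w then 1 else 0) := by
  obtain ⟨h1, rfl⟩ := h₁
  obtain ⟨h2, rfl⟩ := h₂
  refine ⟨⟨h1, h2, ?_⟩, rfl⟩
  simp only [Op.apply]
  split <;> omega

end Evals

/-- The program `c`, started in `s`, halts within the bound `B` in a state and after a time that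
satisfy `Q`. -/
def Reaches (B : ℕ) (c : Cmd) (s : State) (Q : State → ℕ → Prop) : Prop :=
  ∃ s' t, Exec B c s s' t ∧ Q s' t

section Reaches

variable {B : ℕ} {s : State} {c c₁ c₂ : Cmd} {e i : Expr} {Q R : State → ℕ → Prop}

theorem Reaches.mono (h : Reaches B c s Q) (hQ : ∀ s' t, Q s' t → R s' t) : Reaches B c s R :=
  let ⟨s', t, he, hq⟩ := h
  ⟨s', t, he, hQ s' t hq⟩

theorem Reaches.skip (h : Q s 1) : Reaches B .skip s Q := ⟨_, _, .skip s, h⟩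

theorem Reaches.assign {x v : ℕ} (he : Evals B s e v) (h : Q (s.setVar x v) (e.cost + 1)) :
    Reaches B (.assign x e) s Q := by
  obtain ⟨h1, rfl⟩ := he
  exact ⟨_, _, .assign s x e h1, h⟩

theorem Reaches.store {a u v : ℕ} (hi : Evals B s i u) (he : Evals B s e v)
    (h : Q (s.setArr a u v) (i.cost + e.cost + 1)) : Reaches B (.store a i e) s Q := by
  obtain ⟨h1, rfl⟩ := hi
  obtain ⟨h2, rfl⟩ := he
  exact ⟨_, _, .store s a i e h1 h2, h⟩

theorem Reaches.seq
    (h : Reaches B c₁ s fun s₁ t₁ => Reaches B c₂ s₁ fun s₂ t₂ => Q s₂ (t₁ + t₂)) :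
    Reaches B (.seq c₁ c₂) s Q :=
  let ⟨_, _, h₁, _, _, h₂, hq⟩ := h
  ⟨_, _, .seq h₁ h₂, hq⟩

theorem Reaches.ite {p : Prop} [Decidable p] (he : Evals B s e (if p then 1 else 0))
    (h₁ : p → Reaches B c₁ s fun s' t => Q s' (e.cost + 1 + t))
    (h₂ : ¬ p → Reaches B c₂ s fun s' t => Q s' (e.cost + 1 + t)) :
    Reaches B (.ite e c₁ c₂) s Q := by
  by_cases hp : p
  · obtain ⟨s', t, hx, hq⟩ := h₁ hp
    exact ⟨s', _, .ite_true he.1 (by rw [he.2, if_pos hp]; exact one_ne_zero) hx, hq⟩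
  · obtain ⟨s', t, hx, hq⟩ := h₂ hp
    exact ⟨s', _, .ite_false he.1 (by rw [he.2, if_neg hp]) hx, hq⟩

/-- The rule for loops: `Inv s k` is an invariant in which `k` bounds the time that the remaining
iterations take. -/
theorem Reaches.while {Inv : State → ℕ → Prop}
    (hstep : ∀ s k, Inv s k → e.Fits B s ∧ (e.eval s ≠ 0 → Reaches B c s fun s' t =>
      ∃ k', Inv s' k' ∧ e.cost + 1 + t + k' ≤ k)) {k : ℕ} (h : Inv s k) :
    Reaches B (.while e c) s fun s' t =>
      ∃ k', Inv s' k' ∧ e.eval s' = 0 ∧ t + k' ≤ k + (e.cost + 1) := by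
  induction k using Nat.strong_induction_on generalizing s with
  | _ k ih =>
    obtain ⟨hf, hb⟩ := hstep s k h
    by_cases hv : e.eval s = 0
    · exact ⟨s, _, .while_false hf hv, k, h, hv, by omega⟩
    · obtain ⟨s₁, t₁, hx, k₁, hI, hk⟩ := hb hv
      obtain ⟨s₂, t₂, hx₂, k₂, hI₂, hv₂, hk₂⟩ := ih k₁ (by omega) hI
      exact ⟨s₂, _, .while_true hf hv hx hx₂, k₂, hI₂, hv₂, by omega⟩

/-- `for i < e do body`. -/
def Cmd.for (i : ℕ) (e : Expr) (body : Cmd) : Cmd :=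
  .seq (.assign i (.lit 0)) (.while (.bin .lt (.var i) e)
    (.seq body (.assign i (.bin .add (.var i) (.lit 1)))))

/-- The rule for counting loops: `Inv k` holds after `k` rounds, each of which takes at most `T`
steps. -/
theorem Reaches.for {i m T : ℕ} {Inv : ℕ → State → Prop} (hm : m < B)
    (h0 : Inv 0 (s.setVar i 0))
    (hc : ∀ k s, k ≤ m → Inv k s → s.var i = k ∧ Evals B s e m)
    (hb : ∀ k s, k < m → Inv k s → Reaches B c s fun s' t =>
      t ≤ T ∧ s'.var i = k ∧ Inv (k + 1) (s'.setVar i (k + 1)))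
    (hQ : ∀ s' t, Inv m s' → t ≤ (m + 1) * (T + e.cost + 9) → Q s' t) :
    Reaches B (.for i e c) s Q := by
  refine Reaches.seq (Reaches.assign (Evals.lit (Nat.zero_le B)) ?_)
  have hloop := Reaches.while (B := B) (e := .bin .lt (.var i) e)
    (c := .seq c (.assign i (.bin .add (.var i) (.lit 1)))) (s := s.setVar i 0)
    (Inv := fun s k => ∃ j, j ≤ m ∧ Inv j s ∧ k = (m - j) * (T + e.cost + 9))
    (k := m * (T + e.cost + 9)) ?_ ⟨0, Nat.zero_le m, h0, rfl⟩
  · refine hloop.mono ?_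
    rintro s' t ⟨k', ⟨j, hj, hI, rfl⟩, hv, hk⟩
    obtain ⟨h1, h2⟩ := hc j s' hj hI
    have hj' : j = m := by
      have h3 := (Evals.lt (Evals.var h1 (by omega)) h2 (by omega)).2
      rw [h3] at hv
      by_contra hne
      rw [if_pos (by omega)] at hv
      omega
    subst hj'
    refine hQ s' _ hI ?_
    simp only [Expr.cost] at hk ⊢
    rw [Nat.succ_mul]
    omega
  · rintro s k ⟨j, hj, hI, rfl⟩
    obtain ⟨h1, h2⟩ := hc j s hj hI
    have h3 := Evals.lt (Evals.var h1 (by omega)) h2 (by omega)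
    refine ⟨h3.1, fun hv => ?_⟩
    have hj' : j < m := by
      by_contra hne
      rw [h3.2, if_neg hne] at hv
      exact hv rfl
    refine Reaches.seq ((hb j s hj' hI).mono ?_)
    rintro s₁ t₁ ⟨ht, h4, h5⟩
    refine Reaches.assign (Evals.add (Evals.var h4 (by omega)) (Evals.lit (by omega))
      (by omega)) ⟨_, ⟨j + 1, hj', h5, rfl⟩, ?_⟩
    obtain ⟨d, rfl⟩ : ∃ d, m = j + 1 + d := ⟨m - (j + 1), by omega⟩
    rw [Nat.add_sub_cancel_left, show j + 1 + d - j = d + 1 by omega, Nat.succ_mul]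
    simp only [Expr.cost]
    omega

/-- The variables that a program may change. -/
def Cmd.WritesVar (y : ℕ) : Cmd → Prop
  | .skip => False
  | .assign x _ => y = x
  | .store _ _ _ => False
  | .seq c₁ c₂ => c₁.WritesVar y ∨ c₂.WritesVar y
  | .ite _ c₁ c₂ => c₁.WritesVar y ∨ c₂.WritesVar y
  | .while _ c => c.WritesVar y

/-- The arrays that a program may change. -/
def Cmd.WritesArr (b : ℕ) : Cmd → Prop
  | .skip => False
  | .assign _ _ => False
  | .store a _ _ => b = a
  | .seq c₁ c₂ => c₁.WritesArr b ∨ c₂.WritesArr b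
  | .ite _ c₁ c₂ => c₁.WritesArr b ∨ c₂.WritesArr b
  | .while _ c => c.WritesArr b

theorem Exec.var_eq {s' : State} {t y : ℕ} (h : Exec B c s s' t) (hy : ¬ c.WritesVar y) :
    s'.var y = s.var y := by
  induction h with
  | skip => rfl
  | assign s x e he => exact if_neg hy |> (State.setVar_var s x _ y).trans
  | store => rfl
  | seq h₁ h₂ ih₁ ih₂ =>
    simp only [Cmd.WritesVar, not_or] at hy
    rw [ih₂ hy.2, ih₁ hy.1]
  | ite_true he hv h ih =>
    simp only [Cmd.WritesVar, not_or] at hy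
    exact ih hy.1
  | ite_false he hv h ih =>
    simp only [Cmd.WritesVar, not_or] at hy
    exact ih hy.2
  | while_false => rfl
  | while_true he hv h₁ h₂ ih₁ ih₂ => rw [ih₂ hy, ih₁ hy]

theorem Exec.arr_eq {s' : State} {t b : ℕ} (h : Exec B c s s' t) (hb : ¬ c.WritesArr b) :
    s'.arr b = s.arr b := by
  induction h with
  | skip => rfl
  | assign => rfl
  | store s a i e hi he => exact Function.update_of_ne hb _ _
  | seq h₁ h₂ ih₁ ih₂ =>
    simp only [Cmd.WritesArr, not_or] at hb
    rw [ih₂ hb.2, ih₁ hb.1]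
  | ite_true he hv h ih =>
    simp only [Cmd.WritesArr, not_or] at hb
    exact ih hb.1
  | ite_false he hv h ih =>
    simp only [Cmd.WritesArr, not_or] at hb
    exact ih hb.2
  | while_false => rfl
  | while_true he hv h₁ h₂ ih₁ ih₂ => rw [ih₂ hb, ih₁ hb]

/-- Programs leave alone what they do not write to. -/
theorem Reaches.frame (h : Reaches B c s Q) : Reaches B c s fun s' t => Q s' t ∧
    (∀ y, ¬ c.WritesVar y → s'.var y = s.var y) ∧ (∀ b, ¬ c.WritesArr b → s'.arr b = s.arr b) :=
  let ⟨s', t, he, hq⟩ := h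
  ⟨s', t, he, hq, fun _ hy => he.var_eq hy, fun _ hb => he.arr_eq hb⟩

end Reaches

end RAM

namespace StableRoommates

open RAM

variable {n : ℕ}

/-! ### The ranking tables -/

theorem index_lt {x k n : ℕ} (hx : x < n) (hk : k < n) : x * n + k < n * n := by
  have := Nat.mul_le_mul_right n (Nat.succ_le_of_lt hx)
  rw [Nat.succ_mul] at this
  omega

theorem index_inj {x k y j n : ℕ} (hk : k < n) (hj : j < n) (h : x * n + k = y * n + j) :
    x = y ∧ k = j := by
  have h1 : x = y := by
    have := congrArg (· / n) h
    have hn : 0 < n := by omega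
    simpa [Nat.add_comm _ k, Nat.add_comm _ j, Nat.add_mul_div_right _ _ hn,
      Nat.div_eq_of_lt hk, Nat.div_eq_of_lt hj] using this
  subst h1
  exact ⟨rfl, by omega⟩

/-- The expression for the agent at position `k` of the list of agent `x`. -/
def prefE (x k : Expr) : Expr := .get 0 (.bin .add (.bin .mul x (.var 0)) k)

/-- The expression for the position of `y` in the list of `x`, read off array `2`. -/
def rankE (x y : Expr) : Expr := .get 2 (.bin .add (.bin .mul x (.var 0)) y)

/-- The memory holds the preference lists of `I`. -/
structure HasPref (I : Instance n) (s : State) : Prop where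
  size : s.var 0 = n
  pref : ∀ x k : Fin n, s.arr 0 (x * n + k) = I.pref x k

/-- The memory holds the preference lists of `I` and their inverses. -/
structure HasRank (I : Instance n) (s : State) : Prop extends HasPref I s where
  rank : ∀ x y : Fin n, s.arr 2 (x * n + y) = I.rank x y

theorem HasRank.congr {I : Instance n} {s s' : State} (h : HasRank I s) (h0 : s'.var 0 = s.var 0)
    (h1 : s'.arr 0 = s.arr 0) (h2 : s'.arr 2 = s.arr 2) : HasRank I s' :=
  ⟨⟨h0.trans h.size, fun x k => h1 ▸ h.pref x k⟩, fun x y => h2 ▸ h.rank x y⟩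

theorem HasRank.setVar {I : Instance n} {s : State} (h : HasRank I s) {x : ℕ} (v : ℕ)
    (hx : 0 ≠ x) : HasRank I (s.setVar x v) :=
  h.congr (by simp [hx]) rfl rfl

theorem HasRank.setArr {I : Instance n} {s : State} (h : HasRank I s) {a : ℕ} (i v : ℕ)
    (h0 : 0 ≠ a) (h2 : 2 ≠ a) : HasRank I (s.setArr a i v) :=
  h.congr rfl (by funext j; simp [h0]) (by funext j; simp [h2])

theorem HasPref.evals_pref {I : Instance n} {s : State} {B : ℕ} (h : HasPref I s)
    (hB : n * n + 4 * n + 4 ≤ B) {e₁ e₂ : Expr} {x k : Fin n} (h₁ : Evals B s e₁ x)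
    (h₂ : Evals B s e₂ k) : Evals B s (prefE e₁ e₂) (I.pref x k : Fin n) := by
  have := index_lt x.2 k.2
  have := (I.pref x k).2
  exact Evals.get (Evals.add (Evals.mul h₁ (Evals.var h.size (by omega)) (by omega)) h₂ (by omega))
    (h.pref x k) (by omega)

theorem HasRank.evals_rank {I : Instance n} {s : State} {B : ℕ} (h : HasRank I s)
    (hB : n * n + 4 * n + 4 ≤ B) {e₁ e₂ : Expr} {x y : Fin n} (h₁ : Evals B s e₁ x)
    (h₂ : Evals B s e₂ y) : Evals B s (rankE e₁ e₂) (I.rank x y) := by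
  have := index_lt x.2 y.2
  have := I.rank_lt x y
  exact Evals.get (Evals.add (Evals.mul h₁ (Evals.var h.size (by omega)) (by omega)) h₂ (by omega))
    (h.rank x y) (by omega)

/-- Inverts the preference lists, so that array `2` holds the positions. -/
def rankCmd : Cmd :=
  .for 4 (.var 0) (.for 5 (.var 0) (.store 2
    (.bin .add (.bin .mul (.var 4) (.var 0)) (prefE (.var 4) (.var 5))) (.var 5)))

theorem reaches_rankCmd {I : Instance n} {s : State} {B : ℕ} (h : HasPref I s)
    (hB : n * n + 4 * n + 4 ≤ B) :
    Reaches B rankCmd s fun s' t => HasRank I s' ∧ t ≤ (n + 1) * ((n + 1) * 30 + 10) := by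
  refine Reaches.for (m := n) (T := (n + 1) * 30) (Inv := fun k s => s.var 4 = k ∧ HasPref I s ∧
    ∀ x y : Fin n, x < k → s.arr 2 (x * n + y) = I.rank x y) (by omega) ?_ ?_ ?_ ?_
  · exact ⟨by simp, ⟨by simpa using h.size, h.pref⟩, fun x y hx => absurd hx (Nat.not_lt_zero _)⟩
  · rintro k s hk ⟨h1, h2, -⟩
    exact ⟨h1, Evals.var h2.size (by omega)⟩
  · rintro k s hk ⟨h1, h2, h3⟩
    refine Reaches.for (m := n) (T := 20) (Inv := fun j s => s.var 5 = j ∧ s.var 4 = k ∧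
      HasPref I s ∧ (∀ x y : Fin n, x < k → s.arr 2 (x * n + y) = I.rank x y) ∧
      ∀ l : Fin n, l < j → s.arr 2 (k * n + (I.pref ⟨k, hk⟩ l : Fin n)) = l) (by omega) ?_ ?_ ?_ ?_
    · exact ⟨by simp, by simpa using h1, ⟨by simpa using h2.size, h2.pref⟩, h3,
        fun x hx => absurd hx (Nat.not_lt_zero _)⟩
    · rintro j s hj ⟨h4, -, h5, -⟩
      exact ⟨h4, Evals.var h5.size (by omega)⟩
    · rintro j s hj ⟨h4, h5, h6, h7, h8⟩
      have hi : Evals B s (.var 4) ((⟨k, hk⟩ : Fin n) : ℕ) := Evals.var h5 (by simp; omega)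
      have hj' : Evals B s (.var 5) ((⟨j, hj⟩ : Fin n) : ℕ) := Evals.var h4 (by simp; omega)
      have h9 := index_lt hk (I.pref ⟨k, hk⟩ ⟨j, hj⟩).2
      refine Reaches.store (Evals.add (Evals.mul hi (Evals.var h6.size (by omega))
        (by simp only; omega)) (h6.evals_pref hB hi hj') (by simp only; omega)) hj' ?_
      refine ⟨by simp [Expr.cost, prefE], by simpa using h4, by simp, by simpa using h5,
        ⟨by simpa using h6.size, fun x y => by simpa using h6.pref x y⟩, ?_, ?_⟩
      · intro x y hx
        have : (x : ℕ) * n + y ≠ k * n + (I.pref ⟨k, hk⟩ ⟨j, hj⟩ : Fin n) := fun e => by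
          have := (index_inj y.2 (Fin.is_lt _) e).1
          omega
        simpa [this] using h7 x y hx
      · intro l hl
        by_cases hlj : (l : ℕ) = j
        · have : l = ⟨j, hj⟩ := Fin.ext hlj
          subst this
          simp
        · have : (I.pref ⟨k, hk⟩ l : Fin n) ≠ I.pref ⟨k, hk⟩ ⟨j, hj⟩ := fun e =>
            hlj (congrArg Fin.val ((I.pref ⟨k, hk⟩).injective e))
          have h10 : ((I.pref ⟨k, hk⟩ l : Fin n) : ℕ) ≠ (I.pref ⟨k, hk⟩ ⟨j, hj⟩ : Fin n) :=
            fun e => this (Fin.ext e)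
          simpa [h10] using h8 l (by omega)
    · rintro s' t ⟨h4, h5, h6, h7, h8⟩ ht
      refine ⟨ht.trans (by simp [Expr.cost]), h5, by simp,
        ⟨by simpa using h6.size, h6.pref⟩, fun x y hx => ?_⟩
      rcases Nat.lt_succ_iff_lt_or_eq.1 hx with hx | hx
      · exact h7 x y hx
      · have := h8 ((I.pref ⟨k, hk⟩).symm y) (Fin.is_lt _)
        subst hx
        simpa [Instance.rank] using this
  · rintro s' t ⟨h1, h2, h3⟩ ht
    exact ⟨⟨h2, fun x y => h3 x y x.2⟩, ht.trans (by simp [Expr.cost])⟩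

/-! ### Proposals -/

/-- No agent has its successor in `P` before position `F`, or its predecessor at position `U` or
later. -/
def Instance.Between (I : Instance n) (F U : Fin n → ℕ) (P : Equiv.Perm (Fin n)) : Prop :=
  ∀ x, F x ≤ I.rank x (P x) ∧ I.rank x (P⁻¹ x) < U x

theorem Instance.IsStablePartition.succ_le_pred {I : Instance n} {P : Equiv.Perm (Fin n)}
    (hP : I.IsStablePartition P) (x : Fin n) : I.rank x (P x) ≤ I.rank x (P⁻¹ x) := by
  rcases hP.succ_ge_pred x with h | h
  · rw [h]
  · exact (Fin.lt_def.1 h).le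

theorem Instance.IsStablePartition.not_blocks {I : Instance n} {P : Equiv.Perm (Fin n)}
    (hP : I.IsStablePartition P) {x y : Fin n} (hxy : x ≠ y)
    (h : I.rank x y < I.rank x (P⁻¹ x)) : I.rank y (P⁻¹ y) ≤ I.rank y x := by
  by_contra hlt
  exact hP.no_blocking_pair ⟨x, y, hxy, Fin.lt_def.2 h, Fin.lt_def.2 (not_le.1 hlt)⟩

/-- An agent whose successor is not better than `y` makes an offer to `y` that `y` can only refuse
for a predecessor that it likes at least as much. -/
theorem Instance.IsStablePartition.pred_le {I : Instance n} {P : Equiv.Perm (Fin n)}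
    (hP : I.IsStablePartition P) {x y : Fin n} (h : I.rank x y ≤ I.rank x (P x)) :
    I.rank y (P⁻¹ y) ≤ I.rank y x := by
  by_cases hxy : x = y
  · subst hxy
    exact I.rank_self _ _
  have h1 := hP.succ_le_pred x
  rcases (h.trans h1).lt_or_eq with h2 | h2
  · exact hP.not_blocks hxy h2
  · have h3 : P x = y := I.rank_inj (x := x) |>.1 (by omega)
    rw [perm_inv_eq_of_apply_eq h3]

theorem Instance.Between.reject {I : Instance n} {P : Equiv.Perm (Fin n)} {F U : Fin n → ℕ}
    (h : I.Between F U P) {q y : Fin n} (hq : I.rank q y = F q) (hy : U y ≤ I.rank y q) :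
    I.Between (Function.update F q (F q + 1)) U P := by
  intro x
  refine ⟨?_, (h x).2⟩
  by_cases hx : x = q
  · subst hx
    rw [Function.update_self]
    refine lt_of_le_of_ne (h x).1 fun e => ?_
    have h1 : P x = y := I.rank_inj.1 (e.symm.trans hq.symm)
    have h2 := (h y).2
    rw [perm_inv_eq_of_apply_eq h1] at h2
    omega
  · rw [Function.update_of_ne hx]
    exact (h x).1

theorem Instance.Between.accept {I : Instance n} {P : Equiv.Perm (Fin n)} {F U : Fin n → ℕ}
    (hP : I.IsStablePartition P) (h : I.Between F U P) {q y : Fin n}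
    (hq : I.rank q y ≤ I.rank q (P q)) :
    I.Between F (Function.update U y (I.rank y q + 1)) P := by
  intro x
  refine ⟨(h x).1, ?_⟩
  by_cases hx : x = y
  · subst hx
    rw [Function.update_self]
    exact Nat.lt_succ_of_le (hP.pred_le hq)
  · rw [Function.update_of_ne hx]
    exact (h x).2

/-- The state of the proposal process, in which the agents below `i` have made their first
proposal: `F x` is the position of the agent to which `x` proposes, `U y` bounds the positions of
the proposers that `y` still accepts, `H y` is `x + 1` if `y` holds the proposal of `x`, and `p` is
`x + 1` if `x` is about to propose; the value `0` stands for no agent. The set `S` contains the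
stable partitions that must not be excluded. -/
structure Instance.ProposeInv (I : Instance n) (S : Set (Equiv.Perm (Fin n))) (F₀ U₀ : Fin n → ℕ)
    (i p : ℕ) (F U H : Fin n → ℕ) : Prop where
  first_ge : ∀ x, F₀ x ≤ F x
  bound_le : ∀ x, U x ≤ U₀ x
  first_le : ∀ x, F x ≤ n
  bound_le_size : ∀ x, U x ≤ n
  rejected : ∀ x y, I.rank x y < F x → U y ≤ I.rank y x
  holder : ∀ x y : Fin n, H y = x + 1 →
    I.rank x y = F x ∧ U y = I.rank y x + 1 ∧ x < i ∧ p ≠ x + 1 ∧ F x < U x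
  holder_le : ∀ y, H y ≤ n
  placed : ∀ x : Fin n, x < i → p ≠ x + 1 → ∃ y, I.rank x y = F x ∧ H y = x + 1
  sound : ∀ P ∈ S, I.Between F U P
  le_size : i ≤ n
  le_count : p ≤ i

namespace Instance.ProposeInv

variable {I : Instance n} {S : Set (Equiv.Perm (Fin n))} {F₀ U₀ F U H : Fin n → ℕ} {i p : ℕ}

theorem init (hF : ∀ x, F₀ x ≤ n) (hU : ∀ x, U₀ x ≤ n)
    (hr : ∀ x y, I.rank x y < F₀ x → U₀ y ≤ I.rank y x) (hS : ∀ P ∈ S, I.Between F₀ U₀ P) :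
    I.ProposeInv S F₀ U₀ 0 0 F₀ U₀ fun _ => 0 where
  first_ge _ := le_rfl
  bound_le _ := le_rfl
  first_le := hF
  bound_le_size := hU
  rejected := hr
  holder _ _ h := by omega
  holder_le _ := Nat.zero_le _
  placed _ h := by omega
  sound := hS
  le_size := Nat.zero_le _
  le_count := le_rfl

theorem fresh (h : I.ProposeInv S F₀ U₀ i 0 F U H) (hi : i < n) :
    I.ProposeInv S F₀ U₀ (i + 1) (i + 1) F U H :=
  { h with
    holder := fun x y hy => by
      have := h.holder x y hy
      omega
    placed := fun x hx hp => h.placed x (by omega) (by omega)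
    le_size := hi
    le_count := le_rfl }

theorem reject {q y : Fin n} (h : I.ProposeInv S F₀ U₀ i (q + 1) F U H)
    (hq : I.rank q y = F q) (hy : U y ≤ I.rank y q) :
    I.ProposeInv S F₀ U₀ i (q + 1) (Function.update F q (F q + 1)) U H :=
  { h with
    first_ge := fun x => (h.first_ge x).trans (by
      by_cases hx : x = q
      · subst hx; simp
      · simp [hx])
    first_le := fun x => by
      by_cases hx : x = q
      · subst hx
        have := I.rank_lt x y
        simp
        omega
      · simpa [hx] using h.first_le x
    rejected := fun x z hz => by
      by_cases hx : x = q
      · subst hx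
        rw [Function.update_self] at hz
        rcases Nat.lt_succ_iff_lt_or_eq.1 hz with h1 | h1
        · exact h.rejected x z h1
        · rw [I.rank_inj.1 (h1.trans hq.symm)]
          exact hy
      · rw [Function.update_of_ne hx] at hz
        exact h.rejected x z hz
    holder := fun x z hz => by
      have h1 := h.holder x z hz
      have hx : x ≠ q := fun e => h1.2.2.2.1 (by rw [e])
      simpa [hx] using h1
    placed := fun x hx hp => by
      have hxq : x ≠ q := fun e => hp (by rw [e])
      simpa [hxq] using h.placed x hx hp
    sound := fun P hP => (h.sound P hP).reject hq hy }

theorem accept (hS : ∀ P ∈ S, I.IsStablePartition P) {q y : Fin n}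
    (h : I.ProposeInv S F₀ U₀ i (q + 1) F U H) (hq : I.rank q y = F q) (hFU : F q < U q)
    (hy : I.rank y q < U y) :
    I.ProposeInv S F₀ U₀ i (H y) F (Function.update U y (I.rank y q + 1))
      (Function.update H y (q + 1)) := by
  have hle : ∀ x, Function.update U y (I.rank y q + 1) x ≤ U x := fun x => by
    by_cases hx : x = y
    · subst hx
      simpa using hy
    · simp [hx]
  have hi : (q : ℕ) < i := h.le_count
  have hHq : H y ≠ q + 1 := fun e => (h.holder q y e).2.2.2.1 rfl
  have hFy : F y < I.rank y q + 1 := by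
    by_contra hlt
    have := h.rejected y q (by omega)
    omega
  have hFU' : ∀ x, F x < U x → F x < Function.update U y (I.rank y q + 1) x := fun x hx => by
    by_cases hxy : x = y
    · subst hxy
      simpa using hFy
    · simpa [hxy] using hx
  refine
  { h with
    bound_le := fun x => (hle x).trans (h.bound_le x)
    bound_le_size := fun x => (hle x).trans (h.bound_le_size x)
    rejected := fun x z hz => (hle z).trans (h.rejected x z hz)
    holder := fun x z hz => ?_
    holder_le := fun z => ?_
    placed := fun x hx hp => ?_
    sound := fun P hP => (h.sound P hP).accept (hS P hP) (hq.trans_le ((h.sound P hP) q).1)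
    le_count := ?_ }
  · by_cases hzy : z = y
    · subst hzy
      have hxq : x = q := Fin.ext (by simpa using hz.symm)
      subst hxq
      exact ⟨hq, by simp, hi, hHq, hFU' x hFU⟩
    · rw [Function.update_of_ne hzy] at hz ⊢
      obtain ⟨h1, h2, h3, -, h4⟩ := h.holder x z hz
      refine ⟨h1, h2, h3, fun e => hzy ?_, hFU' x h4⟩
      exact I.rank_inj.1 (h1.trans (h.holder x y e).1.symm)
  · by_cases hzy : z = y
    · subst hzy
      simp [Nat.succ_le_of_lt q.2]
    · simpa [hzy] using h.holder_le z
  · by_cases hxq : x = q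
    · subst hxq
      exact ⟨y, hq, by simp⟩
    · obtain ⟨z, h1, h2⟩ := h.placed x hx (by simpa [Fin.val_inj] using fun e => hxq e.symm)
      have hzy : z ≠ y := fun e => hp (e ▸ h2)
      exact ⟨z, h1, by simpa [hzy] using h2⟩
  · rcases Nat.eq_zero_or_pos (H y) with h0 | h0
    · omega
    · have h1 := h.holder_le y
      have := (h.holder ⟨H y - 1, by omega⟩ y (by simp; omega)).2.2.1
      simp at this
      omega

/-- A proposer without any agent left that could accept it shows that no partition remains. -/
theorem eq_empty (hS : ∀ P ∈ S, I.IsStablePartition P) (h : I.ProposeInv S F₀ U₀ i p F U H)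
    {q : Fin n} (hq : U q ≤ F q) : S = ∅ := by
  refine Set.eq_empty_of_forall_notMem fun P hP => ?_
  have h1 := h.sound P hP q
  have := (hS P hP).succ_le_pred q
  omega

end Instance.ProposeInv

/-- Every agent `x` has its proposal held by the agent at position `F x`, and an agent accepts no
proposer that is worse than the one it holds. -/
def Instance.Matched (I : Instance n) (F U H : Fin n → ℕ) : Prop :=
  ∀ x : Fin n, ∃ y, I.rank x y = F x ∧ H y = x + 1 ∧ U y = I.rank y x + 1

theorem Instance.ProposeInv.matched {I : Instance n} {S : Set (Equiv.Perm (Fin n))}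
    {F₀ U₀ F U H : Fin n → ℕ} (h : I.ProposeInv S F₀ U₀ n 0 F U H) : I.Matched F U H := by
  intro x
  obtain ⟨y, h1, h2⟩ := h.placed x x.2 (by omega)
  exact ⟨y, h1, h2, (h.holder x y h2).2.1⟩

theorem Instance.Matched.exists_perm {I : Instance n} {F U H : Fin n → ℕ}
    (h : I.Matched F U H) : ∃ f : Equiv.Perm (Fin n),
      ∀ x, I.rank x (f x) = F x ∧ H (f x) = x + 1 ∧ U (f x) = I.rank (f x) x + 1 := by
  choose f hf using h
  have hinj : Function.Injective f := fun x y hxy => by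
    have h1 := (hf x).2.1
    rw [hxy, (hf y).2.1] at h1
    exact Fin.ext (by omega)
  exact ⟨Equiv.ofBijective f (Finite.injective_iff_bijective.1 hinj), hf⟩

/-- The outcome of the proposal process is a table. -/
theorem Instance.ProposeInv.isTable {I : Instance n} {S : Set (Equiv.Perm (Fin n))}
    {F₀ U₀ F U H : Fin n → ℕ} (h : I.ProposeInv S F₀ U₀ n 0 F U H) {f : Equiv.Perm (Fin n)}
    (hf : ∀ x, I.rank x (f x) = F x ∧ H (f x) = x + 1 ∧ U (f x) = I.rank (f x) x + 1) :
    I.IsTable f := by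
  have hU : ∀ y, U y = I.rank y (f⁻¹ y) + 1 := fun y => by
    have h1 := (hf (f⁻¹ y)).2.2
    rwa [show f (f⁻¹ y) = y from f.apply_symm_apply y] at h1
  constructor
  · intro x
    have h1 := (h.holder x (f x) (hf x).2.1).2.2.2.2
    rw [hU x] at h1
    rw [(hf x).1]
    omega
  · intro x y hxy
    rw [(hf x).1] at hxy
    have := h.rejected x y hxy
    rw [hU y] at this
    omega

theorem sum_update_le {U : Fin n → ℕ} {y : Fin n} {v : ℕ} (h : v ≤ U y) :
    ∑ x, Function.update U y v x + (U y - v) ≤ ∑ x, U x := by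
  rw [Finset.sum_update_of_mem (Finset.mem_univ y), ← Finset.add_sum_erase _ U (Finset.mem_univ y),
    Finset.erase_eq]
  omega

theorem sum_sub_update_lt {F : Fin n → ℕ} {q : Fin n} (h : F q < n) :
    ∑ x, (n - Function.update F q (F q + 1) x) < ∑ x, (n - F x) := by
  refine Finset.sum_lt_sum (fun x _ => ?_) ⟨q, Finset.mem_univ q, ?_⟩
  · by_cases hx : x = q
    · subst hx
      simp only [Function.update_self]
      omega
    · simp [hx]
  · simp only [Function.update_self]
    omega

theorem sum_le_sq {g : Fin n → ℕ} (h : ∀ x, g x ≤ n) : ∑ x, g x ≤ n * n := by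
  simpa using Finset.sum_le_sum fun x (_ : x ∈ Finset.univ) => h x

/-- A bound for the number of steps that remain in the proposal process. -/
def proposePotential (F U : Fin n → ℕ) (i p : ℕ) : ℕ :=
  ∑ x, (n - F x) + ∑ x, U x + 2 * (n - i) + if p = 0 then 0 else 1

/-- The proposal process. Array `3` holds the positions of the next proposals, array `4` the bounds
for accepted proposers, array `5` the held proposals. The variable `7` is set if the process
fails. -/
def proposeCmd : Cmd :=
  .seq (.assign 4 (.lit 0)) <| .seq (.assign 6 (.lit 0)) <|
  .while (.bin .add (.bin .lt (.var 4) (.var 0)) (.var 6)) <|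
    .ite (.bin .eq (.var 6) (.lit 0))
      (.seq (.assign 4 (.bin .add (.var 4) (.lit 1))) (.assign 6 (.var 4)))
      (.seq (.assign 14 (.bin .sub (.var 6) (.lit 1))) <|
        .ite (.bin .lt (.get 3 (.var 14)) (.get 4 (.var 14)))
          (.seq (.assign 11 (prefE (.var 14) (.get 3 (.var 14)))) <|
            .ite (.bin .lt (rankE (.var 11) (.var 14)) (.get 4 (.var 11)))
              (.seq (.store 4 (.var 11) (.bin .add (rankE (.var 11) (.var 14)) (.lit 1))) <|
                .seq (.assign 6 (.get 5 (.var 11))) <|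
                .store 5 (.var 11) (.bin .add (.var 14) (.lit 1)))
              (.store 3 (.var 14) (.bin .add (.get 3 (.var 14)) (.lit 1))))
          (.seq (.assign 7 (.lit 1)) <| .seq (.assign 6 (.lit 0)) (.assign 4 (.var 0))))

theorem Instance.exists_rank_eq (I : Instance n) (x : Fin n) {k : ℕ} (hk : k < n) :
    ∃ y, I.pref x ⟨k, hk⟩ = y ∧ I.rank x y = k :=
  ⟨_, rfl, by simp [Instance.rank]⟩

/-- The proposal process takes quadratic time, since each round takes at most `80` steps and lowers
the potential. It fails only if `S` is empty. -/
theorem reaches_proposeCmd {I : Instance n} {S : Set (Equiv.Perm (Fin n))}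
    (hS : ∀ P ∈ S, I.IsStablePartition P) {s : State} {B : ℕ}
    (hB : n * n + 4 * n + 4 ≤ B) (hs : HasRank I s) (hH : s.tab n 5 = fun _ => 0)
    (hF : ∀ x, s.tab n 3 x ≤ n) (hU : ∀ x, s.tab n 4 x ≤ n)
    (hr : ∀ x y, I.rank x y < s.tab n 3 x → s.tab n 4 y ≤ I.rank y x)
    (hb : ∀ P ∈ S, I.Between (s.tab n 3) (s.tab n 4) P) :
    Reaches B proposeCmd s fun s' t => HasRank I s' ∧ t ≤ 80 * (2 * (n * n) + 2 * n + 1) ∧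
      (s'.var 7 = 1 ∧ S = ∅ ∨ s'.var 7 = s.var 7 ∧
        I.ProposeInv S (s.tab n 3) (s.tab n 4) n 0 (s'.tab n 3) (s'.tab n 4) (s'.tab n 5)) := by
  refine Reaches.seq (Reaches.assign (Evals.lit (by omega)) ?_)
  refine Reaches.seq (Reaches.assign (Evals.lit (by omega)) ?_)
  refine (Reaches.while (Inv := fun s' k => HasRank I s' ∧
    (s'.var 7 = 1 ∧ S = ∅ ∧ s'.var 4 = n ∧ s'.var 6 = 0 ∨
      s'.var 7 = s.var 7 ∧ I.ProposeInv S (s.tab n 3) (s.tab n 4) (s'.var 4) (s'.var 6)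
        (s'.tab n 3) (s'.tab n 4) (s'.tab n 5) ∧
      80 * proposePotential (s'.tab n 3) (s'.tab n 4) (s'.var 4) (s'.var 6) ≤ k))
    ?_ (k := 80 * (2 * (n * n) + 2 * n)) ?_).mono ?_
  · rintro s₁ k ⟨h1, h2⟩
    have hcond : ∀ i p, i ≤ n → p ≤ n → s₁.var 4 = i → s₁.var 6 = p →
        Evals B s₁ (.bin .add (.bin .lt (.var 4) (.var 0)) (.var 6))
          ((if i < n then 1 else 0) + p) := fun i p hi hp h4 h6 =>
      Evals.add (Evals.lt (Evals.var h4 (by omega)) (Evals.var h1.size (by omega)) (by omega))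
        (Evals.var h6 (by omega)) (by split <;> omega)
    rcases h2 with ⟨h7, hSe, h4, h6⟩ | ⟨h7, hI, hk⟩
    · have h3 := hcond n 0 le_rfl (Nat.zero_le _) h4 h6
      exact ⟨h3.1, fun hv => absurd (by rw [h3.2]; simp) hv⟩
    have hin := hI.le_size
    have hpi := hI.le_count
    generalize hi : s₁.var 4 = i at *
    generalize hp : s₁.var 6 = p at *
    have h3 := hcond i p hin (by omega) rfl rfl
    refine ⟨h3.1, fun hv => ?_⟩
    rw [h3.2] at hv
    refine Reaches.ite (Evals.eq (Evals.var hp (by omega)) (Evals.lit (by omega)) (by omega)) ?_ ?_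
    · rintro rfl
      have hin : i < n := by
        by_contra hn
        exact hv (by simp [hn])
      refine Reaches.seq (Reaches.assign (Evals.add (Evals.var hi (by omega))
        (Evals.lit (by omega)) (by omega)) ?_)
      refine Reaches.assign (Evals.var (v := i + 1) (by simp) (by omega)) ?_
      refine ⟨80 * proposePotential (s₁.tab n 3) (s₁.tab n 4) (i + 1) (i + 1),
        ⟨(h1.setVar _ (by omega)).setVar _ (by omega), Or.inr ⟨by simpa using h7, ?_, ?_⟩⟩, ?_⟩
      · simpa using hI.fresh hin
      · simp
      · simp only [proposePotential, Expr.cost] at hk ⊢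
        simp at hk ⊢
        omega
    · intro hp0
      obtain ⟨q, rfl⟩ : ∃ q : Fin n, p = q + 1 := ⟨⟨p - 1, by omega⟩, by simp; omega⟩
      have hFq := hI.first_le q
      have hUq := hI.bound_le_size q
      have hqn := q.2
      refine Reaches.seq (Reaches.assign (Evals.sub (Evals.var hp (by omega))
        (Evals.lit (by omega)) (by omega)) ?_)
      rw [Nat.add_sub_cancel]
      have h1' := h1.setVar (x := 14) q (by omega)
      have e14 : Evals B (s₁.setVar 14 q) (.var 14) q := Evals.var (by simp) (by omega)
      have eF : Evals B (s₁.setVar 14 q) (.get 3 (.var 14)) (s₁.tab n 3 q) :=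
        Evals.get e14 rfl (by omega)
      refine Reaches.ite (Evals.lt eF (Evals.get (w := s₁.tab n 4 q) e14 rfl (by omega))
        (by omega)) ?_ ?_
      · intro hFU
        have hFn : s₁.tab n 3 q < n := by omega
        obtain ⟨y, hy, hqy⟩ := I.exists_rank_eq q hFn
        have hUy := hI.bound_le_size y
        have hHy := hI.holder_le y
        have hyn := y.2
        refine Reaches.seq (Reaches.assign (h1'.toHasPref.evals_pref hB e14 (k := ⟨_, hFn⟩) eF) ?_)
        rw [hy]
        have h1'' := h1'.setVar (x := 11) y (by omega)
        generalize hs₂ : (s₁.setVar 14 q).setVar 11 y = s₂ at h1''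
        have e14 : Evals B s₂ (.var 14) q := Evals.var (by simp [← hs₂]) (by omega)
        have e11 : Evals B s₂ (.var 11) y := Evals.var (by simp [← hs₂]) (by omega)
        have er := h1''.evals_rank hB e11 e14
        have hryn := I.rank_lt y q
        have t3 : s₂.tab n 3 = s₁.tab n 3 := by rw [← hs₂]; simp
        have t4 : s₂.tab n 4 = s₁.tab n 4 := by rw [← hs₂]; simp
        have t5 : s₂.tab n 5 = s₁.tab n 5 := by rw [← hs₂]; simp
        have v11 : s₂.var 11 = y := e11.2
        have v14 : s₂.var 14 = q := e14.2
        have v7 : s₂.var 7 = s.var 7 := by rw [← hs₂]; simpa using h7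
        have v4 : s₂.var 4 = i := by rw [← hs₂]; simpa using hi
        have v6 : s₂.var 6 = q + 1 := by rw [← hs₂]; simpa using hp
        rw [← t3, ← t4, ← t5] at hI
        rw [← t3, ← t4] at hk
        rw [← t3] at hqy hFn hFU hFq
        rw [← t4] at hFU hUy
        rw [← t5] at hHy
        refine Reaches.ite (Evals.lt er (Evals.get (w := s₂.tab n 4 y) e11 rfl (by omega))
          (by omega)) ?_ ?_
        · intro hacc
          refine Reaches.seq (Reaches.store e11 (Evals.add er (Evals.lit (by omega))
            (by omega)) ?_)
          refine Reaches.seq (Reaches.assign (v := s₂.tab n 5 y) (Evals.get (v := y)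
            (Evals.var (by simpa using v11) (by omega)) (by simp) (by omega)) ?_)
          refine Reaches.store (u := y) (v := q + 1) (Evals.var (by simpa using v11) (by omega))
            (Evals.add (Evals.var (by simpa using v14) (by omega)) (Evals.lit (by omega))
            (by omega)) ?_
          refine ⟨80 * proposePotential (s₂.tab n 3)
            (Function.update (s₂.tab n 4) y (I.rank y q + 1)) i (s₂.tab n 5 y),
            ⟨((h1''.setArr _ _ (by omega) (by omega)).setVar _ (by omega)).setArr _ _
              (by omega) (by omega), Or.inr ⟨by simpa using v7, ?_, ?_⟩⟩, ?_⟩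
          · rw [State.tab_setArr_self]
            simp only [State.tab_setArr_of_ne, State.tab_setVar, State.tab_setArr_self, ne_eq,
              Nat.reduceEqDiff, not_false_eq_true, State.setArr_var,
              State.setVar_var, if_true, if_false, v4]
            exact hI.accept hS hqy hFU hacc
          · simp only [State.tab_setArr_of_ne, State.tab_setVar, State.tab_setArr_self, ne_eq,
              Nat.reduceEqDiff, not_false_eq_true, State.setArr_var,
              State.setVar_var, if_true, if_false, v4]
            exact le_rfl
          · -- either `y` held no proposal and `q` gets placed, or `q` replaces a worse proposer and
            -- the bound of `y` falls
            have hsum := sum_update_le (U := s₂.tab n 4) (y := y) (v := I.rank y q + 1) hacc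
            have hstrict : s₂.tab n 5 y ≠ 0 → I.rank y q + 1 < s₂.tab n 4 y := fun h0 => by
              obtain ⟨x, hx⟩ : ∃ x : Fin n, s₂.tab n 5 y = x + 1 :=
                ⟨⟨s₂.tab n 5 y - 1, by omega⟩, by simp only; omega⟩
              obtain ⟨-, h5, -, h6, -⟩ := hI.holder x y hx
              have : I.rank y q ≠ I.rank y x := I.rank_ne fun e => h6 (by rw [e])
              omega
            simp only [proposePotential, Expr.cost, prefE, rankE] at hk ⊢
            rw [if_neg (Nat.succ_ne_zero _)] at hk
            split
            · omega
            · have := hstrict (by assumption)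
              omega
        · intro hrej
          refine Reaches.store (u := q) (v := s₂.tab n 3 q + 1) e14
            (Evals.add (Evals.get e14 rfl (by simp only [State.tab] at *; omega))
              (Evals.lit (by omega)) (by simp only [State.tab] at *; omega)) ?_
          refine ⟨80 * proposePotential (Function.update (s₂.tab n 3) q (s₂.tab n 3 q + 1))
            (s₂.tab n 4) i (q + 1),
            ⟨h1''.setArr _ _ (by omega) (by omega), Or.inr ⟨by simpa using v7, ?_, ?_⟩⟩, ?_⟩
          · simp only [State.tab_setArr_of_ne, State.tab_setArr_self, ne_eq,
              Nat.reduceEqDiff, not_false_eq_true, State.setArr_var, v4, v6]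
            exact hI.reject hqy (not_lt.1 hrej)
          · simp only [State.tab_setArr_of_ne, State.tab_setArr_self, ne_eq,
              Nat.reduceEqDiff, not_false_eq_true, State.setArr_var, v4, v6]
            exact le_rfl
          · have hsum := sum_sub_update_lt hFn
            simp only [proposePotential, Expr.cost, prefE, rankE] at hk ⊢
            omega
      · intro hFU
        refine Reaches.seq (Reaches.assign (Evals.lit (by omega)) ?_)
        refine Reaches.seq (Reaches.assign (Evals.lit (by omega)) ?_)
        refine Reaches.assign (v := n) (Evals.var (by simpa using h1.size) (by omega)) ?_
        refine ⟨0, ⟨(((h1.setVar _ (by omega)).setVar _ (by omega)).setVar _ (by omega)).setVar _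
          (by omega), Or.inl ⟨by simp, hI.eq_empty hS (not_lt.1 hFU), by simp, by simp⟩⟩, ?_⟩
        simp only [proposePotential, Expr.cost] at hk ⊢
        rw [if_neg (Nat.succ_ne_zero _)] at hk
        omega
  · refine ⟨(hs.setVar _ (by omega)).setVar _ (by omega), Or.inr ⟨by simp, ?_, ?_⟩⟩
    · have := Instance.ProposeInv.init hF hU hr hb
      simpa [hH] using this
    · have h1 := sum_le_sq (g := fun x => n - s.tab n 3 x) fun x => Nat.sub_le _ _
      have h2 := sum_le_sq hU
      simp only [proposePotential, State.tab_setVar, State.setVar_var] at h1 ⊢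
      simp
      simp at h1 h2
      omega
  · rintro s' t ⟨k', ⟨h1, h2⟩, hv, hk⟩
    refine ⟨h1, by simp only [Expr.cost] at hk ⊢; omega, ?_⟩
    rcases h2 with ⟨h7, hSe, -⟩ | ⟨h7, hI, -⟩
    · exact Or.inl ⟨h7, hSe⟩
    · have hin := hI.le_size
      have hpi := hI.le_count
      simp only [Expr.eval, Op.apply, h1.size] at hv
      have h6 : s'.var 6 = 0 := by omega
      have h4 : s'.var 4 = n := by
        by_contra hne
        rw [if_pos (by omega)] at hv
        omega
      rw [h4, h6] at hI
      exact Or.inr ⟨h7, hI⟩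

/-! ### The search for the cycle -/

/-- The stable partitions in which `b` follows `a` on a cycle of length greater than two. -/
def Instance.Completing (I : Instance n) (a b : Fin n) : Set (Equiv.Perm (Fin n)) :=
  {P | I.IsStablePartition P ∧ P a = b ∧ P b ≠ a}

/-- The second choice `y` of `u`, at position `G u` of its list, would accept `u`, but currently has
`w` as its last choice, for which `y` in turn is the first choice. The search thus passes from `u`
to `w`. -/
def Instance.Link (I : Instance n) (F U H G : Fin n → ℕ) (w u : Fin n) : Prop :=
  ∃ y, I.rank u y = G u ∧ I.rank y u < U y ∧ H y = w + 1 ∧ I.rank w y = F w ∧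
    U y = I.rank y w + 1

/-- The part of the invariants of the search that holds at all times: `l` is the stack, with its
top at the head and `a` at the bottom, and `G u` is a candidate for the position of the second
choice of `u`, equal to `F u` off the stack. By `gap`, no agent strictly between the two positions
accepts `u`. By `start`, the first choice of `a` is its successor in every completing partition. -/
structure Instance.SearchCore (I : Instance n) (a b : Fin n) (l : List (Fin n))
    (F U G : Fin n → ℕ) : Prop where
  first_le : ∀ x, F x ≤ G x
  second_le : ∀ x, G x ≤ n
  bound_le : ∀ x, U x ≤ n
  mem_iff : ∀ x, x ∈ l ↔ F x < G x
  nodup : l.Nodup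
  last : l.getLast? = some a
  gap : ∀ u z, F u < I.rank u z → I.rank u z < G u → U z ≤ I.rank z u
  sound : ∀ P ∈ I.Completing a b, I.Between F U P
  start : I.rank a b ≤ F a

/-- The invariant of the search. -/
structure Instance.SearchInv (I : Instance n) (a b : Fin n) (l : List (Fin n))
    (F U H G : Fin n → ℕ) : Prop extends I.SearchCore a b l F U G where
  matched : I.Matched F U H
  links : l.IsChain (I.Link F U H G)

/-- The invariant while the rotation ending in `q` is eliminated, with the part `l₁ ++ [q]` still to
be popped off the stack `l₁ ++ q :: l₂`. By `later`, all of its agents may leave their first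
choices. The proposal of `q` need not be held any more, and by `top` the agent to which the top of
the stack turns holds no proposal besides that. -/
structure Instance.PopInv (I : Instance n) (a b : Fin n) (l₁ : List (Fin n)) (q : Fin n)
    (l₂ : List (Fin n)) (F U H G : Fin n → ℕ) : Prop
    extends I.SearchCore a b (l₁ ++ q :: l₂) F U G where
  ne_nil : l₂ ≠ []
  matched : ∀ x ≠ q, ∃ y, I.rank x y = F x ∧ H y = x + 1 ∧ U y = I.rank y x + 1
  links₁ : (l₁ ++ [q]).IsChain (I.Link F U H G)
  links₂ : l₂.IsChain (I.Link F U H G)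
  top : ∀ x ∈ (l₁ ++ [q]).head?, ∃ y, I.rank x y = G x ∧ I.rank y x < U y ∧
    ∀ z ≠ q, I.rank z y ≠ F z
  later : ∀ P ∈ I.Completing a b, ∀ x ∈ l₁ ++ [q], G x ≤ I.rank x (P x)

theorem perm_apply_apply {P : Equiv.Perm (Fin n)} {x : Fin n} (h : P⁻¹ x = P x) : P (P x) = x := by
  rw [← h]
  exact P.apply_symm_apply x

section Search

variable {I : Instance n} {F U H G : Fin n → ℕ} {P : Equiv.Perm (Fin n)}

/-- The link from `u` to `w` carries information backwards: if the successor of `w` is its first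
choice, then so is the successor of `u`, and the predecessor of `u` is its first or its second
choice. -/
theorem Instance.Link.apply {w u : Fin n} (h : I.Link F U H G w u) (hP : I.IsStablePartition P)
    (hb : I.Between F U P)
    (hgap : ∀ u z, F u < I.rank u z → I.rank u z < G u → U z ≤ I.rank z u) (hFG : F u < G u)
    (hw : I.rank w (P w) = F w) :
    I.rank u (P u) = F u ∧ (P (P u) = u ∨ P (P w) = u) := by
  obtain ⟨y, hy, hyu, -, hwy, hU⟩ := h
  have hPw : P w = y := I.rank_inj.1 (hw.trans hwy.symm)
  have hinv := perm_inv_eq_of_apply_eq hPw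
  have huw : u ≠ w := by
    rintro rfl
    omega
  have hyu' : I.rank y u < I.rank y (P⁻¹ y) := by
    rw [hinv]
    have := I.rank_ne (x := y) huw
    omega
  have h1 : I.rank u (P⁻¹ u) ≤ G u := by
    rw [← hy]
    by_cases hyu2 : y = u
    · subst hyu2
      exact I.rank_self _ _
    · exact hP.not_blocks hyu2 hyu'
  have h2 := hP.succ_le_pred u
  have h3 : I.rank u (P u) = F u := by
    have h4 := (hb u).1
    by_contra hne
    rcases (h2.trans h1).lt_or_eq with h5 | h5
    · have h6 := hgap u (P u) (by omega) h5
      have h7 := (hb (P u)).2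
      rw [perm_inv_apply_self] at h7
      omega
    · have h6 : P u = y := I.rank_inj.1 (h5.trans hy.symm)
      exact huw (P.injective (h6.trans hPw.symm))
  refine ⟨h3, ?_⟩
  rcases h1.lt_or_eq with h4 | h4
  · by_cases h5 : I.rank u (P⁻¹ u) = F u
    · exact Or.inl (perm_apply_apply (I.rank_inj.1 (h5.trans h3.symm)))
    · have h6 := hgap u (P⁻¹ u) (by omega) h4
      have h7 := hP.succ_le_pred (P⁻¹ u)
      have h8 := (hb (P⁻¹ u)).2
      rw [show P (P⁻¹ u) = u from P.apply_symm_apply u] at h7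
      omega
  · have h5 : P⁻¹ u = y := I.rank_inj.1 (h4.trans hy.symm)
    refine Or.inr ?_
    rw [hPw, ← h5]
    exact P.apply_symm_apply u

theorem Instance.Link.ne {w u : Fin n} (h : I.Link F U H G w u) (hFG : F u < G u) : u ≠ w := by
  obtain ⟨y, hy, -, -, hwy, -⟩ := h
  rintro rfl
  omega

/-- Along the stack, first choices propagate from the top to the bottom. -/
theorem Instance.chain_first (hP : I.IsStablePartition P) (hb : I.Between F U P)
    (hgap : ∀ u z, F u < I.rank u z → I.rank u z < G u → U z ≤ I.rank z u) {w : Fin n} :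
    ∀ {l : List (Fin n)}, (w :: l).IsChain (I.Link F U H G) → (∀ x ∈ w :: l, F x < G x) →
      I.rank w (P w) = F w → ∀ x ∈ w :: l, I.rank x (P x) = F x := by
  intro l
  induction l generalizing w with
  | nil => intro _ _ hw x hx; simp at hx; exact hx ▸ hw
  | cons u l ih =>
    intro hl hm hw x hx
    rw [List.isChain_cons_cons] at hl
    rcases List.mem_cons.1 hx with rfl | hx
    · exact hw
    · exact ih hl.2 (fun x hx => hm x (List.mem_cons_of_mem _ hx))
        (hl.1.apply hP hb hgap (hm u (by simp)) hw).1 x hx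

/-- Along the stack, cycles of length two propagate from the top to the bottom. -/
theorem Instance.chain_two (hP : I.IsStablePartition P) (hb : I.Between F U P)
    (hgap : ∀ u z, F u < I.rank u z → I.rank u z < G u → U z ≤ I.rank z u) {w : Fin n} :
    ∀ {l : List (Fin n)}, (w :: l).IsChain (I.Link F U H G) → (∀ x ∈ w :: l, F x < G x) →
      I.rank w (P w) = F w → P (P w) = w → ∀ x ∈ w :: l, P (P x) = x := by
  intro l
  induction l generalizing w with
  | nil => intro _ _ _ hw x hx; simp at hx; exact hx ▸ hw
  | cons u l ih =>
    intro hl hm hw hw' x hx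
    rw [List.isChain_cons_cons] at hl
    rcases List.mem_cons.1 hx with rfl | hx
    · exact hw'
    · have h1 := hl.1.apply hP hb hgap (hm u (by simp)) hw
      refine ih hl.2 (fun x hx => hm x (List.mem_cons_of_mem _ hx)) h1.1 (h1.2.resolve_right ?_)
        x hx
      rw [hw']
      exact (hl.1.ne (hm u (by simp))).symm

/-- Unless cycles of length two occur, consecutive entries of the stack are two apart in `P`. -/
theorem Instance.chain_step (hP : I.IsStablePartition P) (hb : I.Between F U P)
    (hgap : ∀ u z, F u < I.rank u z → I.rank u z < G u → U z ≤ I.rank z u) {w a : Fin n} :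
    ∀ {l : List (Fin n)}, (w :: l).IsChain (I.Link F U H G) → (∀ x ∈ w :: l, F x < G x) →
      a ∈ w :: l → P (P a) ≠ a → I.rank w (P w) = F w → (w :: l).getLast? = some a →
      (w :: l).IsChain fun w u => P (P w) = u := by
  intro l
  induction l generalizing w with
  | nil => intros; simp
  | cons u l ih =>
    intro hl hm ha ha' hw hlast
    rw [List.isChain_cons_cons] at hl ⊢
    have hm' : ∀ x ∈ u :: l, F x < G x := fun x hx => hm x (List.mem_cons_of_mem _ hx)
    rw [List.getLast?_cons_cons] at hlast
    have hau : a ∈ u :: l := List.mem_of_getLast? hlast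
    have h1 := hl.1.apply hP hb hgap (hm u (by simp)) hw
    refine ⟨h1.2.resolve_left fun h2 => ha' ?_, ih hl.2 hm' hau ha' h1.1 hlast⟩
    exact Instance.chain_two hP hb hgap hl.2 hm' h1.1 h2 a hau

namespace Instance.SearchInv

variable {a b : Fin n} {l : List (Fin n)} {p q : Fin n}

theorem apply_apply_ne (hP : P ∈ I.Completing a b) : P (P a) ≠ a := by
  rw [hP.2.1]
  exact hP.2.2

theorem mem_lt (h : I.SearchInv a b l F U H G) : ∀ x ∈ l, F x < G x :=
  fun x hx => (h.mem_iff x).1 hx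

theorem mem_last (h : I.SearchInv a b l F U H G) : a ∈ l := List.mem_of_getLast? h.last

/-- If the list of the top of the stack has just one entry, then the search has failed. -/
theorem eq_empty (h : I.SearchInv a b (p :: l) F U H G) (hp : U p ≤ G p) :
    I.Completing a b = ∅ := by
  refine Set.eq_empty_of_forall_notMem fun P hP => ?_
  have hb := h.sound P hP
  have h1 := hb p
  have h2 := hP.1.succ_le_pred p
  have h3 : I.rank p (P p) = F p := by
    by_contra hne
    have h4 := h.gap p (P p) (by omega) (by omega)
    have h5 := (hb (P p)).2
    rw [perm_inv_apply_self] at h5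
    omega
  have h4 : I.rank p (P⁻¹ p) = F p := by
    by_contra hne
    have h4 := h.gap p (P⁻¹ p) (by omega) (by omega)
    have h5 := (hb (P⁻¹ p)).2
    have h6 := hP.1.succ_le_pred (P⁻¹ p)
    rw [show P (P⁻¹ p) = p from P.apply_symm_apply p] at h6
    omega
  exact apply_apply_ne hP (Instance.chain_two hP.1 hb h.gap h.links h.mem_lt h3
    (perm_apply_apply (I.rank_inj.1 (h4.trans h3.symm))) a h.mem_last)

theorem advance (h : I.SearchInv a b (p :: l) F U H G) {y : Fin n} (hy : I.rank p y = G p)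
    (hU : U y ≤ I.rank y p) :
    I.SearchInv a b (p :: l) F U H (Function.update G p (G p + 1)) := by
  have hp := h.mem_lt p (by simp)
  refine { h with first_le := ?_, second_le := ?_, mem_iff := ?_, gap := ?_, links := ?_ }
  · intro x
    by_cases hx : x = p
    · subst hx
      simp
      omega
    · simpa [hx] using h.first_le x
  · intro x
    by_cases hx : x = p
    · subst hx
      have := I.rank_lt x y
      simp
      omega
    · simpa [hx] using h.second_le x
  · intro x
    by_cases hx : x = p
    · subst hx
      simp
      omega
    · simpa [hx] using h.mem_iff x
  · intro u z hz hz'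
    by_cases hu : u = p
    · subst hu
      rw [Function.update_self] at hz'
      rcases Nat.lt_succ_iff_lt_or_eq.1 hz' with h1 | h1
      · exact h.gap u z hz h1
      · rw [I.rank_inj.1 (h1.trans hy.symm)]
        exact hU
    · rw [Function.update_of_ne hu] at hz'
      exact h.gap u z hz hz'
  · refine h.links.imp_of_mem_tail_imp fun w u _ hu hl => ?_
    have hup : u ≠ p := fun e => (List.nodup_cons.1 h.nodup).1 (e ▸ hu)
    simpa [Instance.Link, hup] using hl

theorem exists_holder (h : I.SearchInv a b l F U H G) (y : Fin n) :
    ∃ x : Fin n, H y = x + 1 ∧ I.rank x y = F x ∧ U y = I.rank y x + 1 := by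
  obtain ⟨f, hf⟩ := h.matched.exists_perm
  have := hf (f.symm y)
  rw [f.apply_symm_apply] at this
  exact ⟨_, this.2.1, this.1, this.2.2⟩

theorem push (h : I.SearchInv a b (p :: l) F U H G) (hl : I.Link F U H G q p) (hq : G q = F q) :
    I.SearchInv a b (q :: p :: l) F U H (Function.update G q (G q + 1)) := by
  have hqm : q ∉ p :: l := fun hm => by
    have := h.mem_lt q hm
    omega
  have hlink : ∀ w u, u ∈ p :: l → I.Link F U H G w u →
      I.Link F U H (Function.update G q (G q + 1)) w u := fun w u hu hl => by
    have huq : u ≠ q := fun e => hqm (e ▸ hu)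
    simpa [Instance.Link, huq] using hl
  refine { h with
    first_le := ?_, second_le := ?_, mem_iff := ?_, gap := ?_, links := ?_, nodup := ?_,
    last := ?_ }
  · intro x
    by_cases hx : x = q
    · subst hx
      simp
      omega
    · simpa [hx] using h.first_le x
  · intro x
    by_cases hx : x = q
    · subst hx
      obtain ⟨y, hy, -⟩ := h.matched x
      have := I.rank_lt x y
      simp
      omega
    · simpa [hx] using h.second_le x
  · intro x
    by_cases hx : x = q
    · subst hx
      simp
      omega
    · simpa [hx] using h.mem_iff x
  · exact List.nodup_cons.2 ⟨hqm, h.nodup⟩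
  · rw [List.getLast?_cons_cons]
    exact h.last
  · intro u z hz hz'
    by_cases hu : u = q
    · subst hu
      rw [Function.update_self] at hz'
      omega
    · rw [Function.update_of_ne hu] at hz'
      exact h.gap u z hz hz'
  · rw [List.isChain_cons_cons]
    exact ⟨hlink _ _ (by simp) hl, h.links.imp_of_mem_imp fun w u _ hu hl => hlink w u hu hl⟩

/-- When the search closes up at `a`, every completing partition runs through the stack in steps
of two, and each entry of the stack is followed by its first choice. -/
theorem found (h : I.SearchInv a b (p :: l) F U H G) (hl : I.Link F U H G a p)
    (hP : P ∈ I.Completing a b) : (∀ x ∈ p :: l, I.rank x (P x) = F x) ∧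
      (a :: p :: l).IsChain fun w u => P (P w) = u := by
  have hb := h.sound P hP
  have ha : I.rank a (P a) = F a := by
    have h1 := (hb a).1
    have h2 := h.start
    rw [hP.2.1] at h1 ⊢
    omega
  have h1 := hl.apply hP.1 hb h.gap (h.mem_lt p (by simp)) ha
  have hne := apply_apply_ne hP
  refine ⟨Instance.chain_first hP.1 hb h.gap h.links h.mem_lt h1.1, ?_⟩
  rw [List.isChain_cons_cons]
  refine ⟨h1.2.resolve_left fun h2 => hne ?_, Instance.chain_step hP.1 hb h.gap h.links h.mem_lt
    h.mem_last hne h1.1 h.last⟩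
  exact Instance.chain_two hP.1 hb h.gap h.links h.mem_lt h1.1 h2 a h.mem_last

/-- When the search closes up at `q ≠ a`, no completing partition lets an agent of the rotation
keep its first choice. Otherwise all agents of the rotation and below keep theirs, and the agent
reached twice, from the top and from below, cannot accommodate both. -/
theorem later {l₁ l₂ : List (Fin n)} (h : I.SearchInv a b (l₁ ++ q :: l₂) F U H G)
    (hne : l₂ ≠ []) (hp : ∀ p ∈ (l₁ ++ [q]).head?, I.Link F U H G q p)
    (hP : P ∈ I.Completing a b) {x : Fin n} (hx : x ∈ l₁ ++ [q]) : G x ≤ I.rank x (P x) := by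
  have hb := h.sound P hP
  by_contra hlt
  have hxF : I.rank x (P x) = F x := by
    have h4 := (hb x).1
    by_contra hne
    have h6 := h.gap x (P x) (by omega) (by omega)
    have h7 := (hb (P x)).2
    rw [perm_inv_apply_self] at h7
    omega
  have hqF : I.rank q (P q) = F q := by
    obtain ⟨s, t, hst⟩ := List.append_of_mem hx
    have e : l₁ ++ q :: l₂ = s ++ x :: (t ++ l₂) := by
      rw [List.append_cons, hst]
      simp
    have hq : (x :: t).getLast? = some q := by
      have := congrArg List.getLast? hst
      rw [List.getLast?_append_of_ne_nil _ (by simp : x :: t ≠ [])] at this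
      simpa using this.symm
    have hlinks := h.links
    have hmem := h.mem_lt
    rw [e] at hlinks hmem
    refine Instance.chain_first hP.1 hb h.gap hlinks.right_of_append
      (fun z hz => hmem z (List.mem_append_right _ hz)) hxF q ?_
    rw [← List.cons_append]
    exact List.mem_append_left _ (List.mem_of_getLast? hq)
  obtain ⟨r, l₃, rfl⟩ := List.exists_cons_of_ne_nil hne
  obtain ⟨p, l₀, hpl⟩ : ∃ p l₀, l₁ ++ [q] = p :: l₀ := List.exists_cons_of_ne_nil (by simp)
  have hstack : l₁ ++ q :: r :: l₃ = p :: (l₀ ++ r :: l₃) := by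
    rw [← List.cons_append, ← hpl]
    simp
  have hlinkp := hp p (by rw [hpl]; simp)
  have hlinks := h.links
  have hmem := h.mem_lt
  have hnodup := h.nodup
  have hlast := h.mem_last
  have hlinkr : I.Link F U H G q r := by
    have := (h.links.right_of_append)
    rw [List.isChain_cons_cons] at this
    exact this.1
  rw [hstack] at hlinks hmem hnodup hlast
  have hr := hlinkr.apply hP.1 hb h.gap (hmem r (by simp)) hqF
  have hp' := hlinkp.apply hP.1 hb h.gap (hmem p (by simp)) hqF
  have hpr : p ≠ r := by
    rintro rfl
    simp at hnodup
  have hne := apply_apply_ne hP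
  rcases hp'.2 with h1 | h1
  · exact hne (Instance.chain_two hP.1 hb h.gap hlinks hmem hp'.1 h1 a hlast)
  · rcases hr.2 with h2 | h2
    · have h3 : (r :: l₃).IsChain (I.Link F U H G) := by
        have : (l₁ ++ [q] ++ r :: l₃).IsChain (I.Link F U H G) := by
          simpa using h.links
        exact this.right_of_append
      refine hne (Instance.chain_two hP.1 hb h.gap h3 (fun x hx => hmem x ?_) hr.1 h2 a ?_)
      · exact List.mem_cons_of_mem _ (List.mem_append_right _ hx)
      · have := h.last
        rw [List.getLast?_append_of_ne_nil _ (by simp), List.getLast?_cons_cons] at this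
        exact List.mem_of_getLast? this
    · exact hpr (h1.symm.trans h2)

theorem popInv {l₁ l₂ : List (Fin n)} (h : I.SearchInv a b (l₁ ++ q :: l₂) F U H G)
    (hqa : q ≠ a) (hp : ∀ p ∈ (l₁ ++ [q]).head?, I.Link F U H G q p) :
    I.PopInv a b l₁ q l₂ F U H G := by
  have hne : l₂ ≠ [] := by
    rintro rfl
    exact hqa (by simpa using h.last)
  have h1 : (l₁ ++ [q] ++ l₂).IsChain (I.Link F U H G) := by simpa using h.links
  refine { h.toSearchCore with
    ne_nil := hne
    matched := fun x _ => h.matched x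
    links₁ := h1.left_of_append
    links₂ := h1.right_of_append
    top := fun x hx => ?_
    later := fun P hP x hx => h.later hne hp hP hx }
  obtain ⟨y, h2, h3, h4, -, -⟩ := hp x hx
  refine ⟨y, h2, h3, fun z hz hzy => hz ?_⟩
  obtain ⟨y', h5, h6, -⟩ := h.matched z
  rw [I.rank_inj.1 (h5.trans hzy.symm), h4] at h6
  exact Fin.ext (by omega)

end Instance.SearchInv

theorem Instance.Between.advance (hb : I.Between F U P) {x : Fin n} {k : ℕ}
    (hk : k ≤ I.rank x (P x)) : I.Between (Function.update F x k) U P := by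
  intro z
  refine ⟨?_, (hb z).2⟩
  by_cases hz : z = x
  · subst hz
    simpa using hk
  · simpa [hz] using (hb z).1

theorem Instance.SearchCore.pop {a b x y : Fin n} {l : List (Fin n)}
    (h : I.SearchCore a b (x :: l) F U G) (hl : l ≠ []) (hy : I.rank x y = G x)
    (hU : I.rank y x < U y) (hlater : ∀ P ∈ I.Completing a b, G x ≤ I.rank x (P x)) :
    I.SearchCore a b l (Function.update F x (G x)) (Function.update U y (I.rank y x + 1)) G := by
  have hUle : ∀ z, Function.update U y (I.rank y x + 1) z ≤ U z := fun z => by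
    by_cases hz : z = y
    · subst hz
      simpa using hU
    · simp [hz]
  refine { h with
    first_le := ?_, bound_le := fun z => (hUle z).trans (h.bound_le z), mem_iff := ?_,
    nodup := (List.nodup_cons.1 h.nodup).2, last := ?_, gap := ?_, sound := ?_, start := ?_ }
  · intro z
    by_cases hz : z = x
    · subst hz
      simp
    · simpa [hz] using h.first_le z
  · intro z
    by_cases hz : z = x
    · subst hz
      simpa using (List.nodup_cons.1 h.nodup).1
    · simpa [hz] using h.mem_iff z
  · obtain ⟨u, l, rfl⟩ := List.exists_cons_of_ne_nil hl
    simpa [List.getLast?_cons_cons] using h.last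
  · intro u z hz hz'
    by_cases hu : u = x
    · subst hu
      rw [Function.update_self] at hz
      omega
    · rw [Function.update_of_ne hu] at hz
      exact (hUle z).trans (h.gap u z hz hz')
  · intro P hP
    exact ((h.sound P hP).accept hP.1 (hy.trans_le (hlater P hP))).advance (hlater P hP)
  · by_cases ha : a = x
    · subst ha
      simpa using h.start.trans (h.first_le a)
    · simpa [ha] using h.start

theorem Instance.Link.pop {w u x y : Fin n} (h : I.Link F U H G w u) (hwx : w ≠ x)
    (hwy : I.rank w y ≠ F w) (v k m : ℕ) :
    I.Link (Function.update F x m) (Function.update U y v) (Function.update H y k) G w u := by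
  obtain ⟨z, h1, h2, h3, h4, h5⟩ := h
  have hz : z ≠ y := by
    rintro rfl
    exact hwy h4
  exact ⟨z, h1, by simpa [hz] using h2, by simpa [hz] using h3, by simpa [hwx] using h4,
    by simpa [hz] using h5⟩

theorem isChain_imp_of_mem_dropLast {R S : Fin n → Fin n → Prop} {q : Fin n} :
    ∀ {l : List (Fin n)}, (∀ w ∈ l, ∀ u, R w u → S w u) → (l ++ [q]).IsChain R →
      (l ++ [q]).IsChain S := by
  intro l
  induction l with
  | nil => intros; simp
  | cons x l ih =>
    intro H h
    rw [List.cons_append, List.isChain_cons] at h ⊢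
    exact ⟨fun y hy => H x (by simp) y (h.1 y hy),
      ih (fun w hw => H w (List.mem_cons_of_mem _ hw)) h.2⟩

namespace Instance.PopInv

variable {a b x y q : Fin n} {l₁ l₂ : List (Fin n)}

theorem matched_pop {x : Fin n}
    (hm : ∀ z ≠ q, ∃ y, I.rank z y = F z ∧ H y = z + 1 ∧ U y = I.rank y z + 1)
    (hy : I.rank x y = G x) (htop : ∀ z ≠ q, I.rank z y ≠ F z) {z : Fin n} (hz : z = x ∨ z ≠ q) :
    ∃ w, I.rank z w = Function.update F x (G x) z ∧ Function.update H y (x + 1) w = z + 1 ∧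
      Function.update U y (I.rank y x + 1) w = I.rank w z + 1 := by
  by_cases hzx : z = x
  · subst hzx
    exact ⟨y, by simpa using hy, by simp, by simp⟩
  · have hzq := hz.resolve_left hzx
    obtain ⟨w, h1, h2, h3⟩ := hm z hzq
    have hwy : w ≠ y := by
      rintro rfl
      exact htop z hzq h1
    exact ⟨w, by simpa [hzx] using h1, by simpa [hwy] using h2, by simpa [hwy] using h3⟩

/-- Popping an agent `x` other than `q`: its second choice becomes its first choice. -/
theorem pop (h : I.PopInv a b (x :: l₁) q l₂ F U H G) (hy : I.rank x y = G x) :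
    I.PopInv a b l₁ q l₂ (Function.update F x (G x)) (Function.update U y (I.rank y x + 1))
      (Function.update H y (x + 1)) G := by
  obtain ⟨y', h1, hyU, htop⟩ := h.top x (by simp)
  obtain rfl : y' = y := I.rank_inj.1 (h1.trans hy.symm)
  have hcore := h.toSearchCore
  rw [List.cons_append] at hcore
  have hnd := hcore.nodup
  rw [List.nodup_cons, List.nodup_append] at hnd
  have hxq : x ≠ q := fun e => hnd.1 (by simp [e])
  have hl₁q : ∀ w ∈ l₁, w ≠ q := fun w hw => hnd.2.2.2 w hw q (by simp)
  have hl₂q : ∀ w ∈ l₂, w ≠ q := fun w hw e => (List.nodup_cons.1 hnd.2.2.1).1 (e ▸ hw)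
  have hlinks := h.links₁
  rw [List.cons_append] at hlinks
  refine { hcore.pop (by simp) hy hyU (fun P hP => h.later P hP x (by simp)) with
    ne_nil := h.ne_nil
    matched := fun z hz => matched_pop h.matched hy htop (Or.inr hz)
    links₁ := ?_, links₂ := ?_, top := ?_
    later := fun P hP z hz => h.later P hP z (List.mem_cons_of_mem _ hz) }
  · refine isChain_imp_of_mem_dropLast (fun w hw u hl => hl.pop ?_ (htop w (hl₁q w hw)) _ _ _)
      (List.isChain_cons.1 hlinks).2
    exact fun e => hnd.1 (List.mem_append_left _ (e ▸ hw))
  · refine h.links₂.imp_of_mem_imp fun w u hw _ hl => hl.pop ?_ (htop w (hl₂q w hw)) _ _ _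
    exact fun e => hnd.1 (List.mem_append_right _ (List.mem_cons_of_mem _ (e ▸ hw)))
  · intro u hu
    obtain ⟨z, h2, h3, h4, h5, h6⟩ := (List.isChain_cons.1 hlinks).1 u hu
    have hxF : F x < G x := (hcore.mem_iff x).1 (by simp)
    have hzy : z ≠ y' := by
      rintro rfl
      omega
    refine ⟨z, h2, by simpa [hzy] using h3, fun w hw e => ?_⟩
    by_cases hwx : w = x
    · subst hwx
      rw [Function.update_self] at e
      omega
    · rw [Function.update_of_ne hwx] at e
      obtain ⟨z', h7, h8, -⟩ := h.matched w hw
      rw [I.rank_inj.1 (h7.trans e.symm), h4] at h8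
      exact hwx (Fin.ext (by omega))

/-- Popping `q` completes the elimination of the rotation. -/
theorem pop_last (h : I.PopInv a b [] q l₂ F U H G) (hy : I.rank q y = G q) :
    I.SearchInv a b l₂ (Function.update F q (G q)) (Function.update U y (I.rank y q + 1))
      (Function.update H y (q + 1)) G := by
  obtain ⟨y', h1, hyU, htop⟩ := h.top q (by simp)
  obtain rfl : y' = y := I.rank_inj.1 (h1.trans hy.symm)
  have hcore := h.toSearchCore
  rw [List.nil_append] at hcore
  have hnd := List.nodup_cons.1 hcore.nodup
  refine { hcore.pop h.ne_nil hy hyU (fun P hP => h.later P hP q (by simp)) with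
    matched := fun z => matched_pop h.matched hy htop (em _)
    links := ?_ }
  refine h.links₂.imp_of_mem_imp fun w u hw _ hl => ?_
  have hwq : w ≠ q := fun e => hnd.1 (e ▸ hw)
  exact hl.pop hwq (htop w hwq) _ _ _

end Instance.PopInv

end Search

/-! ### The search as a program -/

/-- The cells of `g` hold the stack `l`, whose top is the head of the list. -/
def StackRep (g : ℕ → ℕ) : List (Fin n) → Prop
  | [] => True
  | x :: l => g l.length = x ∧ StackRep g l

theorem StackRep.congr {g g' : ℕ → ℕ} : ∀ {l : List (Fin n)}, StackRep g l →
    (∀ i < l.length, g' i = g i) → StackRep g' l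
  | [], _, _ => trivial
  | x :: l, h, hg => ⟨(hg _ (by simp)).trans h.1, h.2.congr fun i hi => hg i (by simp; omega)⟩

/-- The memory represents a state of the search with stack `l`. -/
structure Searching (I : Instance n) (a b : Fin n) (l : List (Fin n)) (s : State) : Prop where
  hasRank : HasRank I s
  start : s.var 1 = a
  size : s.var 12 = l.length
  stack : StackRep (s.arr 8) l
  inv : I.SearchInv a b l (s.tab n 3) (s.tab n 4) (s.tab n 5) (s.tab n 6)

/-- The agent on top of the stack leaves it, and its second choice becomes its first. -/
def popCmd : Cmd :=
  .seq (.assign 12 (.bin .sub (.var 12) (.lit 1))) <|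
  .seq (.assign 8 (.get 8 (.var 12))) <|
  .seq (.store 3 (.var 8) (.get 6 (.var 8))) <|
  .seq (.assign 11 (prefE (.var 8) (.get 3 (.var 8)))) <|
  .seq (.store 4 (.var 11) (.bin .add (rankE (.var 11) (.var 8)) (.lit 1)))
    (.store 5 (.var 11) (.bin .add (.var 8) (.lit 1)))

theorem reaches_popCmd {I : Instance n} {s : State} {B : ℕ} (hB : n * n + 4 * n + 4 ≤ B)
    (hs : HasRank I s) {x y : Fin n} {l : List (Fin n)} (hl : l.length ≤ n)
    (hsp : s.var 12 = l.length + 1) (hst : StackRep (s.arr 8) (x :: l))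
    (hy : I.rank x y = s.tab n 6 x) :
    Reaches B popCmd s fun s' t => t ≤ 60 ∧ HasRank I s' ∧ s'.var 12 = l.length ∧
      s'.var 8 = x ∧ s'.tab n 3 = Function.update (s.tab n 3) x (s.tab n 6 x) ∧
      s'.tab n 4 = Function.update (s.tab n 4) y (I.rank y x + 1) ∧
      s'.tab n 5 = Function.update (s.tab n 5) y (x + 1) := by
  have hxn := x.2
  have hyn := y.2
  have hrx := I.rank_lt x y
  have hry := I.rank_lt y x
  have hgx : s.arr 6 x = I.rank x y := hy.symm
  have hpr : I.pref x ⟨I.rank x y, hrx⟩ = y := by simp [Instance.rank]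
  refine Reaches.seq (Reaches.assign (Evals.sub (Evals.var hsp (by omega)) (Evals.lit (by omega))
    (by omega)) ?_)
  rw [Nat.add_sub_cancel]
  refine Reaches.seq (Reaches.assign (Evals.get (Evals.var (v := l.length) (by simp) (by omega))
    (w := x) (by simpa using hst.1) (by omega)) ?_)
  refine Reaches.seq (Reaches.store (u := x) (v := I.rank x y) (Evals.var (by simp) (by omega))
    (Evals.get (v := x) (Evals.var (by simp) (by omega)) (by simpa using hgx) (by omega)) ?_)
  have h1 := ((hs.setVar (x := 12) l.length (by omega)).setVar (x := 8) x (by omega)).setArr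
    (a := 3) x (I.rank x y) (by omega) (by omega)
  refine Reaches.seq (Reaches.assign (h1.toHasPref.evals_pref hB (x := x) (k := ⟨_, hrx⟩)
    (Evals.var (by simp) (by omega)) (Evals.get (v := x) (Evals.var (by simp) (by omega))
    (by simp) (by simp only; omega))) ?_)
  rw [hpr]
  have h2 := h1.setVar (x := 11) y (by omega)
  refine Reaches.seq (Reaches.store (u := y) (Evals.var (by simp) (by omega))
    (Evals.add (h2.evals_rank hB (x := y) (y := x) (Evals.var (by simp) (by omega))
      (Evals.var (by simp) (by omega))) (Evals.lit (by omega)) (by omega)) ?_)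
  have h3 := h2.setArr (a := 4) y (I.rank y x + 1) (by omega) (by omega)
  refine Reaches.store (u := y) (v := x + 1) (Evals.var (by simp) (by omega))
    (Evals.add (Evals.var (by simp) (by omega)) (Evals.lit (by omega)) (by omega)) ?_
  refine ⟨by simp [Expr.cost, prefE, rankE], h3.setArr _ _ (by omega) (by omega), by simp,
    by simp, ?_, ?_, ?_⟩
  · simp [State.tab_setArr_of_ne, State.tab_setArr_self, ← hgx]
  · simp [State.tab_setArr_of_ne, State.tab_setArr_self]
  · simp [State.tab_setArr_of_ne, State.tab_setArr_self]

/-- Pops the rotation that ends in the agent held in variable `14`. -/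
def eliminateCmd : Cmd :=
  .seq (.assign 15 (.lit 1)) <|
  .while (.var 15) <| .seq popCmd <|
    .ite (.bin .eq (.var 8) (.var 14)) (.assign 15 (.lit 0)) .skip

theorem reaches_eliminateCmd {I : Instance n} {a b q : Fin n} {l₁ l₂ : List (Fin n)} {s : State}
    {B : ℕ} (hB : n * n + 4 * n + 4 ≤ B) (hs : HasRank I s) (ha : s.var 1 = a)
    (hq : s.var 14 = q) (hsp : s.var 12 = (l₁ ++ q :: l₂).length)
    (hst : StackRep (s.arr 8) (l₁ ++ q :: l₂))
    (hI : I.PopInv a b l₁ q l₂ (s.tab n 3) (s.tab n 4) (s.tab n 5) (s.tab n 6)) :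
    Reaches B eliminateCmd s fun s' t => t ≤ 80 * (l₁.length + 1) + 10 ∧
      Searching I a b l₂ s' := by
  have hqn := q.2
  refine Reaches.seq (Reaches.assign (Evals.lit (by omega)) ?_)
  refine (Reaches.while (Inv := fun s k => HasRank I s ∧ s.var 1 = a ∧ s.var 14 = q ∧
    (s.var 15 = 1 ∧ (∃ l₁ : List (Fin n), 80 * (l₁.length + 1) ≤ k ∧
      s.var 12 = (l₁ ++ q :: l₂).length ∧ StackRep (s.arr 8) (l₁ ++ q :: l₂) ∧
      I.PopInv a b l₁ q l₂ (s.tab n 3) (s.tab n 4) (s.tab n 5) (s.tab n 6)) ∨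
    s.var 15 = 0 ∧ Searching I a b l₂ s)) (k := 80 * (l₁.length + 1)) ?_ ?_).mono ?_
  · rintro s k ⟨hs, ha, hq, h⟩
    rcases h with ⟨hr, l₁, hk, hsp, hst, hI⟩ | ⟨hr, hS⟩
    · refine ⟨(Evals.var hr (by omega)).1, fun _ => ?_⟩
      have hlen := hI.nodup.length_le_card
      rw [Fintype.card_fin] at hlen
      cases l₁ with
      | nil =>
        simp only [List.nil_append, List.length_cons, List.length_nil] at hsp hst hk hlen
        obtain ⟨y, hy, -⟩ := hI.top q (by simp)
        refine Reaches.seq ((reaches_popCmd hB hs (by omega) hsp hst hy).frame.mono ?_)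
        rintro s₁ t₁ ⟨⟨ht, h1, h2, h3, h4, h5, h6⟩, hv, harr⟩
        have v1 := hv 1 (by simp [popCmd, Cmd.WritesVar])
        have v14 := hv 14 (by simp [popCmd, Cmd.WritesVar])
        have a8 := harr 8 (by simp [popCmd, Cmd.WritesArr])
        have a6 : s₁.tab n 6 = s.tab n 6 := by
          funext x; simp [harr 6 (by simp [popCmd, Cmd.WritesArr])]
        refine Reaches.ite (Evals.eq (Evals.var h3 (by omega)) (Evals.var (v14.trans hq)
          (by omega)) (by omega)) (fun _ => ?_) (fun hne => absurd rfl hne)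
        refine Reaches.assign (Evals.lit (by omega)) ⟨0, ⟨h1.setVar _ (by omega), ?_, ?_,
          Or.inr ⟨by simp, h1.setVar _ (by omega), ?_, ?_, ?_, ?_⟩⟩, ?_⟩
        · simpa using v1.trans ha
        · simpa using v14.trans hq
        · simpa using v1.trans ha
        · simpa using h2
        · rw [State.setVar_arr, a8]
          exact hst.2
        · simp only [State.tab_setVar, h4, h5, h6, a6]
          exact hI.pop_last hy
        · simp [Expr.cost]
          omega
      | cons x l₁ =>
        simp only [List.cons_append, List.length_cons] at hsp hst hk hlen
        obtain ⟨y, hy, -⟩ := hI.top x (by simp)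
        refine Reaches.seq ((reaches_popCmd hB hs (by omega) hsp hst hy).frame.mono ?_)
        rintro s₁ t₁ ⟨⟨ht, h1, h2, h3, h4, h5, h6⟩, hv, harr⟩
        have v1 := hv 1 (by simp [popCmd, Cmd.WritesVar])
        have v14 := hv 14 (by simp [popCmd, Cmd.WritesVar])
        have v15 := hv 15 (by simp [popCmd, Cmd.WritesVar])
        have a8 := harr 8 (by simp [popCmd, Cmd.WritesArr])
        have a6 : s₁.tab n 6 = s.tab n 6 := by
          funext x; simp [harr 6 (by simp [popCmd, Cmd.WritesArr])]
        have hxq : (x : ℕ) ≠ q := fun e => by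
          have := hI.nodup
          rw [List.cons_append, List.nodup_cons] at this
          exact this.1 (by simp [Fin.ext e])
        have hxn := x.2
        refine Reaches.ite (Evals.eq (Evals.var h3 (by omega)) (Evals.var (v14.trans hq)
          (by omega)) (by omega)) (fun hne => absurd hne hxq) (fun _ => ?_)
        refine Reaches.skip ⟨80 * (l₁.length + 1), ⟨h1, v1.trans ha, v14.trans hq,
          Or.inl ⟨v15.trans hr, l₁, le_rfl, h2, ?_, ?_⟩⟩, ?_⟩
        · rw [a8]
          exact hst.2
        · rw [h4, h5, h6, a6]
          exact hI.pop hy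
        · simp [Expr.cost]
          omega
    · exact ⟨(Evals.var hr (by omega)).1, fun hv => absurd hr hv⟩
  · exact ⟨hs.setVar _ (by omega), by simpa using ha, by simpa using hq,
      Or.inl ⟨by simp, l₁, le_rfl, by simpa using hsp, hst, hI⟩⟩
  · rintro s' t ⟨k, ⟨-, -, -, h⟩, hv, hk⟩
    rcases h with ⟨hr, -⟩ | ⟨hr, hS⟩
    · simp only [Expr.eval] at hv
      omega
    · refine ⟨?_, hS⟩
      simp only [Expr.cost] at hk ⊢
      omega

/-- The search for the cycle. From the top `p` of the stack it proceeds to the agent `q` whose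
proposal is held by the second choice of `p`. If `q` is new, it is pushed onto the stack. If it is
not, the search has closed up: variable `16` is set if `q` is the first agent, and otherwise the
rotation down to `q` is eliminated. -/
def searchCmd : Cmd :=
  .while (.var 13) <|
  .seq (.assign 8 (.get 8 (.bin .sub (.var 12) (.lit 1)))) <|
  .ite (.bin .lt (.get 6 (.var 8)) (.get 4 (.var 8)))
    (.seq (.assign 11 (prefE (.var 8) (.get 6 (.var 8)))) <|
      .ite (.bin .lt (rankE (.var 11) (.var 8)) (.get 4 (.var 11)))
        (.seq (.assign 14 (.bin .sub (.get 5 (.var 11)) (.lit 1))) <|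
          .ite (.bin .lt (.get 3 (.var 14)) (.get 6 (.var 14)))
            (.ite (.bin .eq (.var 14) (.var 1))
              (.seq (.assign 16 (.lit 1)) (.assign 13 (.lit 0)))
              eliminateCmd)
            (.seq (.store 8 (.var 12) (.var 14)) <|
              .seq (.assign 12 (.bin .add (.var 12) (.lit 1)))
                (.store 6 (.var 14) (.bin .add (.get 6 (.var 14)) (.lit 1)))))
        (.store 6 (.var 8) (.bin .add (.get 6 (.var 8)) (.lit 1))))
    (.assign 13 (.lit 0))

/-- The search has closed up at `a`, with stack `l`. -/
def Found (I : Instance n) (a b : Fin n) (l : List (Fin n)) (s : State) : Prop :=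
  Searching I a b l s ∧ ∀ p ∈ l.head?, I.Link (s.tab n 3) (s.tab n 4) (s.tab n 5) (s.tab n 6) a p

theorem Searching.length_le {I : Instance n} {a b : Fin n} {l : List (Fin n)} {s : State}
    (h : Searching I a b l s) : l.length ≤ n := by
  simpa using h.inv.nodup.length_le_card

/-- The search takes quadratic time: the positions `G` only grow, and each agent on the stack
carries the cost of its own removal. -/
theorem reaches_searchCmd {I : Instance n} {a b : Fin n} {l : List (Fin n)} {s : State}
    {B : ℕ} (hB : n * n + 4 * n + 4 ≤ B) (hs : Searching I a b l s) (h13 : s.var 13 = 1)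
    (h16 : s.var 16 = 0) :
    Reaches B searchCmd s fun s' t => t ≤ 1000 * (n * n) + 300 * n + 210 ∧
      (s'.var 16 = 0 ∧ I.Completing a b = ∅ ∨ s'.var 16 = 1 ∧ ∃ l, Found I a b l s') := by
  have han := a.2
  refine (Reaches.while (Inv := fun s k =>
    s.var 13 = 1 ∧ s.var 16 = 0 ∧ (∃ l, Searching I a b l s ∧
      1000 * ∑ x, (n - s.tab n 6 x) + 300 * l.length + 200 ≤ k) ∨
    s.var 13 = 0 ∧ (s.var 16 = 0 ∧ I.Completing a b = ∅ ∨
      s.var 16 = 1 ∧ ∃ l, Found I a b l s)) (k := 1000 * (n * n) + 300 * n + 200) ?_ ?_).mono ?_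
  · clear h13 h16 hs
    rintro s k (⟨h13, h16, l, hs, hk⟩ | ⟨h13, h⟩)
    swap
    · exact ⟨(Evals.var h13 (by omega)).1, fun hv => absurd h13 hv⟩
    refine ⟨(Evals.var h13 (by omega)).1, fun _ => ?_⟩
    have hlen := hs.length_le
    obtain ⟨p, l, rfl⟩ : ∃ p l', l = p :: l' := by
      refine List.exists_cons_of_ne_nil ?_
      rintro rfl
      simpa using hs.inv.last
    have hpn := p.2
    have hsize := hs.size
    rw [List.length_cons] at hsize hlen hk
    refine Reaches.seq (Reaches.assign (Evals.get (w := p) (Evals.sub (Evals.var hsize (by omega))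
      (Evals.lit (by omega)) (by omega)) hs.stack.1 (by omega)) ?_)
    have hGp := hs.inv.second_le p
    have hUp := hs.inv.bound_le p
    have e8 : Evals B (s.setVar 8 p) (.var 8) p := Evals.var (by simp) (by omega)
    have e6 : Evals B (s.setVar 8 p) (.get 6 (.var 8)) (s.tab n 6 p) :=
      Evals.get e8 rfl (by omega)
    have hr₁ := hs.hasRank.setVar (x := 8) p (by omega)
    refine Reaches.ite (Evals.lt e6 (Evals.get (w := s.tab n 4 p) e8 rfl (by omega))
      (by omega)) ?_ ?_
    · intro hGU
      have hGn : s.tab n 6 p < n := by omega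
      obtain ⟨y, hy, hpy⟩ := I.exists_rank_eq p hGn
      have hUy := hs.inv.bound_le y
      have hyn := y.2
      have hryp := I.rank_lt y p
      refine Reaches.seq (Reaches.assign (hr₁.toHasPref.evals_pref hB e8 (k := ⟨_, hGn⟩) e6) ?_)
      rw [hy]
      have hr₂ := hr₁.setVar (x := 11) y (by omega)
      have e8 : Evals B ((s.setVar 8 p).setVar 11 y) (.var 8) p := Evals.var (by simp) (by omega)
      have e11 : Evals B ((s.setVar 8 p).setVar 11 y) (.var 11) y :=
        Evals.var (by simp) (by omega)
      refine Reaches.ite (Evals.lt (hr₂.evals_rank hB e11 e8)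
        (Evals.get (w := s.tab n 4 y) e11 rfl (by omega)) (by omega)) ?_ ?_
      · intro hacc
        obtain ⟨q, hHy, hqy, hUyq⟩ := hs.inv.exists_holder y
        have hlink : I.Link (s.tab n 3) (s.tab n 4) (s.tab n 5) (s.tab n 6) q p :=
          ⟨y, hpy, hacc, hHy, hqy, hUyq⟩
        have hqn := q.2
        have hFq := hs.inv.first_le q
        have hGq := hs.inv.second_le q
        refine Reaches.seq (Reaches.assign (Evals.sub (Evals.get (w := q + 1) e11 hHy (by omega))
          (Evals.lit (by omega)) (by omega)) ?_)
        rw [Nat.add_sub_cancel]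
        have hr₃ := hr₂.setVar (x := 14) q (by omega)
        have e14 : Evals B (((s.setVar 8 p).setVar 11 y).setVar 14 q) (.var 14) q :=
          Evals.var (by simp) (by omega)
        refine Reaches.ite (Evals.lt (Evals.get (w := s.tab n 3 q) e14 rfl (by omega))
          (Evals.get (w := s.tab n 6 q) e14 rfl (by omega)) (by omega)) ?_ ?_
        · intro hon
          refine Reaches.ite (Evals.eq e14 (Evals.var (v := a) (by simpa using hs.start)
            (by omega)) (by omega)) ?_ ?_
          · intro hqa
            obtain rfl : q = a := Fin.ext hqa
            refine Reaches.seq (Reaches.assign (Evals.lit (by omega)) ?_)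
            refine Reaches.assign (Evals.lit (by omega)) ⟨0, Or.inr ⟨by simp, Or.inr
              ⟨by simp, p :: l, ⟨(hr₃.setVar _ (by omega)).setVar _ (by omega), by simpa using
                hs.start, by simpa using hsize, hs.stack, hs.inv⟩, ?_⟩⟩, ?_⟩
            · intro p' hp'
              simp only [List.head?_cons, Option.mem_some_iff] at hp'
              subst hp'
              exact hlink
            · simp only [Expr.cost, prefE, rankE]
              omega
          · intro hqa
            have hqa' : q ≠ a := fun e => hqa (by rw [e])
            have hqm : q ∈ p :: l := (hs.inv.mem_iff q).2 hon
            obtain ⟨l₁, l₂, hl⟩ := List.append_of_mem hqm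
            have hinv := hs.inv
            rw [hl] at hinv
            have hhead : ∀ p' ∈ (l₁ ++ [q]).head?, p' = p := by
              intro p' hp'
              cases l₁ with
              | nil =>
                simp only [List.nil_append, List.cons.injEq] at hl
                simp at hp'
                exact hp'.symm.trans hl.1.symm
              | cons z l₁ =>
                simp only [List.cons_append, List.cons.injEq] at hl
                simp at hp'
                exact hp'.symm.trans hl.1.symm
            have hpop := hinv.popInv hqa' fun p' hp' => by
              rw [hhead p' hp']
              exact hlink
            have hlen' := congrArg List.length hl
            rw [List.length_append, List.length_cons, List.length_cons] at hlen'
            refine (reaches_eliminateCmd (l₁ := l₁) (l₂ := l₂) hB hr₃ (by simpa using hs.start)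
              e14.2 ?_ ?_ hpop).frame.mono ?_
            · rw [← hl]
              simpa using hsize
            · rw [← hl]
              exact hs.stack
            rintro s₁ t₁ ⟨⟨ht, hS⟩, hv, harr⟩
            have v13 := hv 13 (by simp [eliminateCmd, popCmd, Cmd.WritesVar])
            have v16 := hv 16 (by simp [eliminateCmd, popCmd, Cmd.WritesVar])
            have a6 : s₁.tab n 6 = s.tab n 6 := by
              funext x
              simp [harr 6 (by simp [eliminateCmd, popCmd, Cmd.WritesArr])]
            refine ⟨_, Or.inl ⟨v13.trans (by simpa using h13), v16.trans (by simpa using h16),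
              l₂, hS, le_rfl⟩, ?_⟩
            rw [a6]
            simp only [Expr.cost, prefE, rankE]
            omega
        · intro hoff
          have hGF : s.tab n 6 q = s.tab n 3 q := by omega
          refine Reaches.seq (Reaches.store (u := l.length + 1) (Evals.var (by simpa using hsize)
            (by omega)) e14 ?_)
          refine Reaches.seq (Reaches.assign (v := l.length + 1 + 1)
            (Evals.add (Evals.var (by simpa using hsize)
            (by omega)) (Evals.lit (by omega)) (by omega)) ?_)
          have hFqn : s.tab n 3 q < n := by
            have := I.rank_lt q y
            omega
          refine Reaches.store (u := q) (v := s.tab n 6 q + 1) (Evals.var (by simp) (by omega))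
            (Evals.add (Evals.get (v := q) (Evals.var (by simp) (by omega)) (by simp) (by omega))
            (Evals.lit (by omega)) (by omega)) ?_
          refine ⟨_, Or.inl ⟨by simpa using h13, by simpa using h16, q :: p :: l,
            ⟨((hr₃.setArr _ _ (by omega) (by omega)).setVar _ (by omega)).setArr _ _ (by omega)
              (by omega), by simpa using hs.start, by simp, ⟨by simp, ?_⟩, ?_⟩, le_rfl⟩, ?_⟩
          · refine hs.stack.congr fun i hi => ?_
            simp only [List.length_cons] at hi
            simp
            omega
          · have := hs.inv.push hlink hGF
            simpa [State.tab_setArr_of_ne, State.tab_setArr_self] using this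
          · have := sum_sub_update_lt (F := s.tab n 6) (q := q) (by omega)
            simp only [Expr.cost, prefE, rankE, State.tab_setArr_of_ne, State.tab_setArr_self,
              State.tab_setVar, ne_eq, Nat.reduceEqDiff, not_false_eq_true, List.length_cons]
            generalize ∑ x, (n - s.tab n 6 x) = A at *
            generalize ∑ x, (n - Function.update (s.tab n 6) q (s.tab n 6 q + 1) x) = A' at *
            clear * - this hk
            linarith
      · intro hrej
        refine Reaches.store (u := p) (v := s.tab n 6 p + 1) e8 (Evals.add (Evals.get e8 rfl
          (by simpa using hGp.trans (by omega))) (Evals.lit (by omega)) (by omega)) ?_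
        refine ⟨_, Or.inl ⟨by simpa using h13, by simpa using h16, p :: l,
          ⟨hr₂.setArr _ _ (by omega) (by omega), by simpa using hs.start, by simpa using hsize,
            hs.stack.congr fun i _ => by simp, ?_⟩, le_rfl⟩, ?_⟩
        · have := hs.inv.advance hpy (not_lt.1 hrej)
          simpa [State.tab_setArr_of_ne, State.tab_setArr_self] using this
        · have := sum_sub_update_lt (F := s.tab n 6) (q := p) hGn
          simp only [Expr.cost, prefE, rankE, State.tab_setArr_self, State.tab_setVar,
            List.length_cons]
          generalize ∑ x, (n - s.tab n 6 x) = A at *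
          generalize ∑ x, (n - Function.update (s.tab n 6) p (s.tab n 6 p + 1) x) = A' at *
          clear * - this hk
          linarith
    · intro hGU
      refine Reaches.assign (Evals.lit (by omega)) ⟨0, Or.inr ⟨by simp, Or.inl
        ⟨by simpa using h16, hs.inv.eq_empty (not_lt.1 hGU)⟩⟩, ?_⟩
      simp only [Expr.cost]
      omega
  · refine Or.inl ⟨h13, h16, l, hs, ?_⟩
    have h1 := sum_le_sq (g := fun x => n - s.tab n 6 x) fun x => Nat.sub_le _ _
    have h2 := hs.length_le
    omega
  · rintro s' t ⟨k, h, hv, hk⟩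
    simp only [Expr.cost, Expr.eval] at hk hv
    rcases h with ⟨h, -⟩ | ⟨-, h⟩
    · omega
    · exact ⟨by omega, h⟩

/-! ### Offers made in advance -/

/-- Forgets all proposals. -/
def resetCmd : Cmd :=
  .for 4 (.var 0) <|
    .seq (.store 3 (.var 4) (.lit 0)) <| .seq (.store 4 (.var 4) (.var 0))
      (.store 5 (.var 4) (.lit 0))

theorem reaches_resetCmd {I : Instance n} {s : State} {B : ℕ} (hB : n * n + 4 * n + 4 ≤ B)
    (hs : HasRank I s) :
    Reaches B resetCmd s fun s' t => t ≤ (n + 1) * 19 ∧ HasRank I s' ∧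
      (s'.tab n 3 = fun _ => 0) ∧ (s'.tab n 4 = fun _ => n) ∧ s'.tab n 5 = fun _ => 0 := by
  refine Reaches.for (m := n) (T := 9) (Inv := fun k s => s.var 4 = k ∧ HasRank I s ∧
    ∀ x : Fin n, x < k → s.arr 3 x = 0 ∧ s.arr 4 x = n ∧ s.arr 5 x = 0) (by omega) ?_ ?_ ?_ ?_
  · exact ⟨by simp, hs.setVar _ (by omega), fun x hx => by omega⟩
  · rintro k s hk ⟨h1, h2, -⟩
    exact ⟨h1, Evals.var h2.size (by omega)⟩
  · rintro k s hk ⟨h1, h2, h3⟩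
    refine Reaches.seq (Reaches.store (Evals.var h1 (by omega)) (Evals.lit (by omega)) ?_)
    refine Reaches.seq (Reaches.store (v := n) (Evals.var h1 (by omega))
      (Evals.var h2.size (by omega)) ?_)
    refine Reaches.store (Evals.var h1 (by omega)) (Evals.lit (by omega)) ?_
    refine ⟨by simp [Expr.cost], by simpa using h1, by simp,
      (((h2.setArr _ _ (by omega) (by omega)).setArr _ _ (by omega) (by omega)).setArr _ _
        (by omega) (by omega)).setVar _ (by omega), fun x hx => ?_⟩
    by_cases hxk : (x : ℕ) = k
    · simp [hxk]
    · simpa [hxk] using h3 x (by omega)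
  · rintro s' t ⟨-, h2, h3⟩ ht
    refine ⟨ht.trans (by simp [Expr.cost]), h2, ?_, ?_, ?_⟩ <;> funext x <;> have := h3 x x.2 <;>
      simp [this]

/-- The bounds after `x` has made an offer to each of its first `k` choices other than `y`, in which
it will not become a predecessor: the recipients now only accept better proposers. -/
def Instance.cut (I : Instance n) (U : Fin n → ℕ) (x y : Fin n) (k : ℕ) (z : Fin n) : ℕ :=
  if I.rank x z < k ∧ z ≠ y then min (U z) (I.rank z x) else U z

theorem Instance.cut_le (I : Instance n) (U : Fin n → ℕ) (x y : Fin n) (k : ℕ) (z : Fin n) :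
    I.cut U x y k z ≤ U z := by
  unfold Instance.cut
  split
  · exact min_le_left _ _
  · exact le_rfl

theorem Instance.cut_le_rank (I : Instance n) (U : Fin n → ℕ) {x y : Fin n} {k : ℕ} {z : Fin n}
    (h : I.rank x z < k) (hz : z ≠ y) : I.cut U x y k z ≤ I.rank z x := by
  rw [Instance.cut, if_pos ⟨h, hz⟩]
  exact min_le_right _ _

/-- If `P` sends `x` to `y`, then an agent that `x` prefers to its predecessor prefers its own
predecessor to `x`. -/
theorem Instance.Between.cut {I : Instance n} {P : Equiv.Perm (Fin n)} {F U : Fin n → ℕ}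
    (hP : I.IsStablePartition P) (h : I.Between F U P) {x y : Fin n} (hxy : P x = y) {k : ℕ}
    (hk : k ≤ I.rank x (P⁻¹ x)) : I.Between F (I.cut U x y k) P := by
  intro z
  refine ⟨(h z).1, ?_⟩
  unfold Instance.cut
  split
  · rename_i hz
    have hxz : x ≠ z := by
      rintro rfl
      have := I.rank_self x (P⁻¹ x)
      omega
    have h1 := hP.not_blocks hxz (hz.1.trans_le hk)
    refine lt_min (h z).2 (lt_of_le_of_ne h1 (I.rank_ne fun e => hz.2 ?_))
    rw [← hxy, ← e]
    exact (P.apply_symm_apply z).symm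
  · exact (h z).2

/-- The agent in variable `8` makes offers to all agents on its list before position `10`, except
the one in variable `9`. -/
def offerCmd : Cmd :=
  .for 5 (.var 10) <| .seq (.assign 11 (prefE (.var 8) (.var 5))) <|
    .ite (.bin .eq (.var 11) (.var 9)) .skip <|
      .ite (.bin .lt (rankE (.var 11) (.var 8)) (.get 4 (.var 11)))
        (.store 4 (.var 11) (rankE (.var 11) (.var 8))) .skip

theorem reaches_offerCmd {I : Instance n} {s : State} {B : ℕ} (hB : n * n + 4 * n + 4 ≤ B)
    (hs : HasRank I s) {x y : Fin n} (hx : s.var 8 = x) (hy : s.var 9 = y) {k : ℕ} (hk : k ≤ n)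
    (h10 : s.var 10 = k) (hU : ∀ x, s.tab n 4 x ≤ n) :
    Reaches B offerCmd s fun s' t => t ≤ (n + 1) * 60 ∧ HasRank I s' ∧
      s'.tab n 4 = I.cut (s.tab n 4) x y k := by
  have hxn := x.2
  have hyn := y.2
  refine Reaches.for (m := k) (T := 40) (Inv := fun k' s' => s'.var 5 = k' ∧ HasRank I s' ∧
    s'.var 8 = x ∧ s'.var 9 = y ∧ s'.var 10 = k ∧ s'.tab n 4 = I.cut (s.tab n 4) x y k')
    (by omega) ?_ ?_ ?_ ?_
  · refine ⟨by simp, hs.setVar _ (by omega), by simpa using hx, by simpa using hy,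
      by simpa using h10, ?_⟩
    funext z
    simp [Instance.cut]
  · rintro k' s' hk' ⟨h1, -, -, -, h2, -⟩
    exact ⟨h1, Evals.var h2 (by omega)⟩
  · rintro k' s' hk' ⟨h1, h2, h3, h4, h5, h6⟩
    have hk'n : k' < n := by omega
    obtain ⟨z, hz, hxz⟩ := I.exists_rank_eq x hk'n
    have hzn := z.2
    refine Reaches.seq (Reaches.assign (h2.toHasPref.evals_pref hB (x := x) (k := ⟨k', hk'n⟩)
      (Evals.var h3 (by omega)) (Evals.var h1 (by simp only; omega))) ?_)
    rw [hz]
    have h2' := h2.setVar (x := 11) z (by omega)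
    have e11 : Evals B (s'.setVar 11 z) (.var 11) z := Evals.var (by simp) (by omega)
    have e8 : Evals B (s'.setVar 11 z) (.var 8) x := Evals.var (by simpa using h3) (by omega)
    have hrz := I.rank_lt z x
    have hUz : s'.tab n 4 z ≤ n := by
      rw [h6]
      exact (I.cut_le _ _ _ _ _).trans (hU z)
    -- passing position `k'` affects only the agent `z` there
    have hne : ∀ w ≠ z, I.cut (s.tab n 4) x y (k' + 1) w = I.cut (s.tab n 4) x y k' w := by
      intro w hw
      have : I.rank x w ≠ k' := fun e => hw (I.rank_inj.1 (e.trans hxz.symm))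
      have h7 : I.rank x w < k' + 1 ↔ I.rank x w < k' := by omega
      simp only [Instance.cut, h7]
    have hold : I.cut (s.tab n 4) x y k' z = s.tab n 4 z := by
      rw [Instance.cut, if_neg (by omega)]
    refine Reaches.ite (Evals.eq e11 (Evals.var (v := y) (by simpa using h4) (by omega))
      (by omega)) (fun hzy => ?_) (fun hzy => ?_)
    · refine Reaches.skip ⟨by simp [Expr.cost, prefE], by simpa using h1, by simp,
        h2'.setVar _ (by omega), by simpa using h3, by simpa using h4, by simpa using h5, ?_⟩
      rw [State.tab_setVar, State.tab_setVar, h6]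
      funext w
      by_cases hw : w = z
      · rw [hw, hold, Instance.cut, if_neg (fun h => h.2 (Fin.ext hzy))]
      · exact (hne w hw).symm
    · have hnew : I.cut (s.tab n 4) x y (k' + 1) z = min (s.tab n 4 z) (I.rank z x) := by
        rw [Instance.cut, if_pos ⟨by omega, fun e => hzy (by rw [e])⟩]
      have h6z : s'.tab n 4 z = s.tab n 4 z := by rw [h6, hold]
      refine Reaches.ite (Evals.lt (h2'.evals_rank hB e11 e8) (Evals.get (w := s'.tab n 4 z) e11
        rfl (by omega)) (by omega)) (fun hlt => ?_) (fun hlt => ?_)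
      · refine Reaches.store e11 (h2'.evals_rank hB e11 e8) ⟨by simp [Expr.cost, prefE, rankE],
          by simpa using h1, by simp, (h2'.setArr _ _ (by omega) (by omega)).setVar _ (by omega),
          by simpa using h3, by simpa using h4, by simpa using h5, ?_⟩
        rw [State.tab_setVar, State.tab_setArr_self, State.tab_setVar]
        funext w
        by_cases hw : w = z
        · subst hw
          rw [hnew, Function.update_self]
          omega
        · rw [Function.update_of_ne hw, hne w hw, h6]
      · refine Reaches.skip ⟨by simp [Expr.cost, prefE, rankE], by simpa using h1, by simp,
          h2'.setVar _ (by omega), by simpa using h3, by simpa using h4, by simpa using h5, ?_⟩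
        rw [State.tab_setVar, State.tab_setVar]
        funext w
        by_cases hw : w = z
        · subst hw
          rw [hnew]
          omega
        · rw [hne w hw, h6]
  · rintro s' t ⟨-, h2, -, -, -, h6⟩ ht
    refine ⟨ht.trans ?_, h2, h6⟩
    simp only [Expr.cost]
    exact Nat.mul_le_mul (by omega) (by omega)

/-! ### Finding the candidate -/

/-- Starts the search, with the first agent `a` alone on the stack. The candidate for the position
of a second choice is the position of the first choice, and the one after that for `a`. -/
def initSearchCmd : Cmd :=
  .seq (.for 4 (.var 0) (.store 6 (.var 4) (.get 3 (.var 4)))) <|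
  .seq (.store 8 (.lit 0) (.var 1)) <| .seq (.assign 12 (.lit 1)) <|
  .seq (.store 6 (.var 1) (.bin .add (.get 6 (.var 1)) (.lit 1))) <| .assign 13 (.lit 1)

theorem reaches_initSearchCmd {I : Instance n} {a b : Fin n} {F₀ U₀ : Fin n → ℕ} {s : State}
    {B : ℕ} (hB : n * n + 4 * n + 4 ≤ B) (hs : HasRank I s) (ha : s.var 1 = a)
    (hF₀ : I.rank a b ≤ F₀ a)
    (hI : I.ProposeInv (I.Completing a b) F₀ U₀ n 0 (s.tab n 3) (s.tab n 4) (s.tab n 5)) :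
    Reaches B initSearchCmd s fun s' t => t ≤ (n + 1) * 14 + 13 ∧ s'.var 13 = 1 ∧
      Searching I a b [a] s' := by
  have han := a.2
  have hFn : ∀ x, s.tab n 3 x < n := fun x => by
    obtain ⟨y, hy, -⟩ := hI.matched x
    rw [← hy]
    exact I.rank_lt x y
  refine Reaches.seq (Reaches.for (m := n) (T := 4) (Inv := fun k s' => s'.var 4 = k ∧
    HasRank I s' ∧ s'.var 1 = a ∧ s'.arr 3 = s.arr 3 ∧ s'.arr 4 = s.arr 4 ∧ s'.arr 5 = s.arr 5 ∧
    ∀ x : Fin n, x < k → s'.arr 6 x = s.arr 3 x) (by omega) ?_ ?_ ?_ ?_)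
  · exact ⟨by simp, hs.setVar _ (by omega), by simpa using ha, rfl, rfl, rfl,
      fun x hx => by omega⟩
  · rintro k s' hk ⟨h1, h2, -⟩
    exact ⟨h1, Evals.var h2.size (by omega)⟩
  · rintro k s' hk ⟨h1, h2, h3, h4, h5, h6, h7⟩
    have hk' := hFn ⟨k, hk⟩
    rw [State.tab_apply, ← h4] at hk'
    refine Reaches.store (Evals.var h1 (by omega)) (Evals.get (Evals.var h1 (by omega)) rfl
      (by simp only at hk'; omega)) ⟨by simp [Expr.cost], by simpa using h1, by simp,
      (h2.setArr _ _ (by omega) (by omega)).setVar _ (by omega), by simpa using h3,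
      by funext j; simp [h4], by funext j; simp [h5], by funext j; simp [h6], fun x hx => ?_⟩
    by_cases hxk : (x : ℕ) = k
    · simp [hxk, h4]
    · simpa [hxk] using h7 x (by omega)
  · rintro s₁ t₁ ⟨-, h2, h3, h4, h5, h6, h7⟩ ht₁
    refine Reaches.seq (Reaches.store (Evals.lit (by omega)) (Evals.var h3 (by omega)) ?_)
    refine Reaches.seq (Reaches.assign (Evals.lit (by omega)) ?_)
    have hFa := hFn a
    rw [State.tab_apply] at hFa
    refine Reaches.seq (Reaches.store (u := a) (v := s.arr 3 a + 1)
      (Evals.var (by simpa using h3) (by omega)) (Evals.add (Evals.get (v := a)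
        (Evals.var (by simpa using h3) (by omega)) (by simpa using h7 a a.2) (by omega))
        (Evals.lit (by omega)) (by omega)) ?_)
    refine Reaches.assign (Evals.lit (by omega)) ⟨?_, by simp,
      (((h2.setArr _ _ (by omega) (by omega)).setVar _ (by omega)).setArr _ _ (by omega)
        (by omega)).setVar _ (by omega), by simpa using h3, by simp, by simp [StackRep], ?_⟩
    · simp only [Expr.cost] at ht₁ ⊢
      omega
    · have t3 : s₁.tab n 3 = s.tab n 3 := by funext x; simp [h4]
      have t4 : s₁.tab n 4 = s.tab n 4 := by funext x; simp [h5]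
      have t5 : s₁.tab n 5 = s.tab n 5 := by funext x; simp [h6]
      have t6 : s₁.tab n 6 = s.tab n 3 := by funext x; simp [h7 x x.2]
      rw [← State.tab_apply]
      simp only [State.tab_setVar, State.tab_setArr_self, State.tab_setArr_of_ne, ne_eq,
        Nat.reduceEqDiff, not_false_eq_true, t3, t4, t5, t6]
      generalize s.tab n 3 = F at *
      exact
      { first_le := fun x => by
          by_cases hx : x = a
          · subst hx; simp
          · simp [hx]
        second_le := fun x => by
          by_cases hx : x = a
          · subst hx
            simpa using hFn x
          · simpa [hx] using hI.first_le x
        bound_le := hI.bound_le_size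
        mem_iff := fun x => by
          by_cases hx : x = a
          · subst hx; simp
          · simp [hx]
        nodup := List.nodup_singleton a
        last := rfl
        gap := fun u z hz hz' => by
          by_cases hu : u = a
          · subst hu
            rw [Function.update_self] at hz'
            omega
          · rw [Function.update_of_ne hu] at hz'
            omega
        sound := hI.sound
        start := hF₀.trans (hI.first_ge a)
        matched := hI.matched
        links := List.isChain_singleton a }

/-- Finds the only candidate for a completion, if there is one. In advance, the first agent makes
offers to all agents that it prefers to the second one, and starts proposing at the latter. -/
def findCmd : Cmd :=
  .seq rankCmd <| .seq resetCmd <| .seq (.assign 8 (.var 1)) <| .seq (.assign 9 (.var 2)) <|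
  .seq (.assign 10 (rankE (.var 1) (.var 2))) <| .seq offerCmd <|
  .seq (.store 3 (.var 1) (.var 10)) <| .seq proposeCmd <|
  .ite (.bin .eq (.var 7) (.lit 0)) (.seq initSearchCmd searchCmd) .skip

theorem reaches_findCmd {I : Instance n} {a b : Fin n} {s : State} {B : ℕ}
    (hB : n * n + 4 * n + 4 ≤ B) (hs : HasPref I s) (ha : s.var 1 = a) (hb : s.var 2 = b)
    (h7 : s.var 7 = 0) (h16 : s.var 16 = 0) :
    Reaches B findCmd s fun s' t => t ≤ 2000 * ((n + 1) * (n + 1)) ∧ HasRank I s' ∧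
      (s'.var 16 = 0 ∧ I.Completing a b = ∅ ∨ s'.var 16 = 1 ∧ ∃ l, Found I a b l s') := by
  have han := a.2
  have hbn := b.2
  refine Reaches.seq ((reaches_rankCmd hs hB).frame.mono ?_)
  rintro s₁ t₁ ⟨⟨hs₁, ht₁⟩, v₁, -⟩
  refine Reaches.seq ((reaches_resetCmd hB hs₁).frame.mono ?_)
  rintro s₂ t₂ ⟨⟨ht₂, hs₂, hF₂, hU₂, hH₂⟩, v₂, -⟩
  have fr : ∀ y, y ≠ 4 → y ≠ 5 → s₂.var y = s.var y := fun y h4 h5 =>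
    (v₂ y (by simp [resetCmd, Cmd.for, Cmd.WritesVar, h4])).trans
      (v₁ y (by simp [rankCmd, Cmd.for, Cmd.WritesVar, h4, h5]))
  have ha₂ := (fr 1 (by omega) (by omega)).trans ha
  have hb₂ := (fr 2 (by omega) (by omega)).trans hb
  have h7₂ := (fr 7 (by omega) (by omega)).trans h7
  have h16₂ := (fr 16 (by omega) (by omega)).trans h16
  clear v₁ v₂ fr
  have hab := I.rank_lt a b
  refine Reaches.seq (Reaches.assign (Evals.var ha₂ (by omega)) ?_)
  refine Reaches.seq (Reaches.assign (v := b) (Evals.var (by simpa using hb₂) (by omega)) ?_)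
  have hs₃ := (hs₂.setVar (x := 8) a (by omega)).setVar (x := 9) b (by omega)
  refine Reaches.seq (Reaches.assign (hs₃.evals_rank hB (x := a) (y := b)
    (Evals.var (by simpa using ha₂) (by omega)) (Evals.var (by simpa using hb₂) (by omega))) ?_)
  refine Reaches.seq ((reaches_offerCmd (x := a) (y := b) (k := I.rank a b) hB
    (hs₃.setVar _ (by omega)) (by simp) (by simp) hab.le (by simp)
    (by intro x; simp only [State.tab_setVar, hU₂]; exact le_rfl)).frame.mono ?_)
  rintro s₄ t₄ ⟨⟨ht₄, hs₄, hU₄⟩, v₄, a₄⟩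
  have fr : ∀ y, y ≠ 5 → y ≠ 11 → s₄.var y = _ := fun y h4 h5 =>
    (v₄ y (by simp [offerCmd, Cmd.for, Cmd.WritesVar, h4, h5]))
  have ha₄ : s₄.var 1 = a := (fr 1 (by omega) (by omega)).trans (by simpa using ha₂)
  have h10₄ : s₄.var 10 = I.rank a b := (fr 10 (by omega) (by omega)).trans (by simp)
  have h7₄ : s₄.var 7 = 0 := (fr 7 (by omega) (by omega)).trans (by simpa using h7₂)
  have h16₄ : s₄.var 16 = 0 := (fr 16 (by omega) (by omega)).trans (by simpa using h16₂)
  have hF₄ : s₄.tab n 3 = fun _ => 0 := by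
    funext x
    rw [State.tab_apply, a₄ 3 (by simp [offerCmd, Cmd.for, Cmd.WritesArr])]
    exact congrFun hF₂ x
  have hH₄ : s₄.tab n 5 = fun _ => 0 := by
    funext x
    rw [State.tab_apply, a₄ 5 (by simp [offerCmd, Cmd.for, Cmd.WritesArr])]
    exact congrFun hH₂ x
  simp only [State.tab_setVar, hU₂] at hU₄
  clear v₄ a₄ fr
  refine Reaches.seq (Reaches.store (Evals.var ha₄ (by omega)) (Evals.var h10₄ (by omega)) ?_)
  have hS : ∀ P ∈ I.Completing a b, I.IsStablePartition P := fun P hP => hP.1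
  have hF₅ : (s₄.setArr 3 a (I.rank a b)).tab n 3 =
      Function.update (fun _ => 0) a (I.rank a b) := by
    rw [State.tab_setArr_self, hF₄]
  have hU₅ : (s₄.setArr 3 a (I.rank a b)).tab n 4 = I.cut (fun _ => n) a b (I.rank a b) := by
    rw [State.tab_setArr_of_ne _ _ _ _ (by omega), hU₄]
  refine Reaches.seq ((reaches_proposeCmd hS hB (hs₄.setArr _ _ (by omega) (by omega)) ?_ ?_ ?_
    ?_ ?_).frame.mono ?_)
  · rw [State.tab_setArr_of_ne _ _ _ _ (by omega), hH₄]
  · rw [hF₅]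
    intro x
    by_cases hx : x = a
    · subst hx
      simpa using hab.le
    · simp [hx]
  · rw [hU₅]
    exact fun x => I.cut_le _ _ _ _ _
  · rw [hF₅, hU₅]
    intro x y hxy
    by_cases hx : x = a
    · subst hx
      rw [Function.update_self] at hxy
      refine I.cut_le_rank _ hxy ?_
      rintro rfl
      omega
    · simp [hx] at hxy
  · rw [hF₅, hU₅]
    intro P hP
    have h0 : I.Between (fun _ => 0) (fun _ => n) P := fun x =>
      ⟨Nat.zero_le _, I.rank_lt _ _⟩
    have h1 : I.rank a b ≤ I.rank a (P a) := by rw [hP.2.1]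
    exact (h0.cut hP.1 hP.2.1 (h1.trans (hP.1.succ_le_pred a))).advance h1
  rintro s₆ t₆ ⟨⟨hs₆, ht₆, h⟩, v₆, -⟩
  have fr : ∀ y, y ≠ 4 → y ≠ 6 → y ≠ 7 → y ≠ 11 → y ≠ 14 → s₆.var y = _ :=
    fun y h1 h2 h3 h4 h5 =>
      v₆ y (by simp [proposeCmd, Cmd.WritesVar, h1, h2, h3, h4, h5])
  have ha₆ : s₆.var 1 = a :=
    (fr 1 (by omega) (by omega) (by omega) (by omega) (by omega)).trans (by simpa using ha₄)
  have h16₆ : s₆.var 16 = 0 :=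
    (fr 16 (by omega) (by omega) (by omega) (by omega) (by omega)).trans (by simpa using h16₄)
  clear v₆ fr
  have htime : ∀ t, t ≤ (n + 1) * 14 + 13 + (1000 * (n * n) + 300 * n + 210) →
      t₁ + t₂ + t₄ + t₆ + t + 50 ≤ 2000 * ((n + 1) * (n + 1)) := by
    intro t ht
    nlinarith
  rcases h with ⟨h7, hSe⟩ | ⟨h7, hI⟩
  · refine Reaches.ite (Evals.eq (Evals.var h7 (by omega)) (Evals.lit (by omega)) (by omega))
      (by omega) (fun _ => Reaches.skip ⟨?_, hs₆, Or.inl ⟨h16₆, hSe⟩⟩)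
    have := htime 0 (Nat.zero_le _)
    simp only [Expr.cost, rankE]
    linarith
  · rw [State.setArr_var, h7₄] at h7
    refine Reaches.ite (Evals.eq (Evals.var h7 (by omega)) (Evals.lit (by omega)) (by omega))
      (fun _ => ?_) (by omega)
    refine Reaches.seq ((reaches_initSearchCmd (b := b) hB hs₆ ha₆ (by rw [hF₅]; simp)
      hI).frame.mono ?_)
    rintro s₇ t₇ ⟨⟨ht₇, h13, hS₇⟩, v₇, -⟩
    have h16₇ : s₇.var 16 = 0 :=
      (v₇ 16 (by simp [initSearchCmd, Cmd.for, Cmd.WritesVar])).trans h16₆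
    refine (reaches_searchCmd hB hS₇ h13 h16₇).frame.mono ?_
    rintro s₈ t₈ ⟨⟨ht₈, h₈⟩, v₈, a₈⟩
    refine ⟨?_, ?_, h₈⟩
    · have := htime (t₇ + t₈) (Nat.add_le_add ht₇ ht₈)
      simp only [Expr.cost, rankE]
      linarith
    exact hS₇.hasRank.congr
      (v₈ 0 (by simp [searchCmd, eliminateCmd, popCmd, Cmd.WritesVar]))
      (a₈ 0 (by simp [searchCmd, eliminateCmd, popCmd, Cmd.WritesArr]))
      (a₈ 2 (by simp [searchCmd, eliminateCmd, popCmd, Cmd.WritesArr]))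

/-! ### Cycles as lists -/

theorem IsCycleOf.getElem_eq {P : Equiv.Perm (Fin n)} {L : List (Fin n)} (h : IsCycleOf P L)
    (h0 : 0 < L.length) : ∀ (i : ℕ) (hi : i < L.length), L[i] = P^[i] L[0] := by
  intro i
  induction i with
  | zero => intro _; rfl
  | succ i ih =>
    intro hi
    rw [Function.iterate_succ_apply', ← ih (by omega)]
    have h1 := List.getElem_of_eq h.2.2 (i := i) (by simp; omega)
    rw [List.getElem_map, List.getElem_rotate] at h1
    simp only [Nat.mod_eq_of_lt hi] at h1
    exact h1.symm

theorem IsCycleOf.iterate_length {P : Equiv.Perm (Fin n)} {L : List (Fin n)} (h : IsCycleOf P L)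
    (h0 : 0 < L.length) : P^[L.length] L[0] = L[0] := by
  have h1 := h.getElem_eq h0 (L.length - 1) (by omega)
  have h2 := List.getElem_of_eq h.2.2 (i := L.length - 1) (by simp; omega)
  rw [List.getElem_map, List.getElem_rotate, h1, ← Function.iterate_succ_apply' P] at h2
  have h3 : (L.length - 1 + 1) % L.length = 0 := by
    rw [Nat.sub_add_cancel h0, Nat.mod_self]
  simp only [h3] at h2
  rw [← h2]
  congr 1
  omega

theorem isCycleOf_map_range {P : Equiv.Perm (Fin n)} {c : ℕ → Fin n} {m : ℕ} (hm : 0 < m)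
    (hP : ∀ i < m, P (c i) = c (i + 1)) (hc : c m = c 0) (hne : ∀ i < m, 0 < i → c i ≠ c 0) :
    IsCycleOf P ((List.range m).map c) := by
  refine ⟨by simp; omega, ?_, ?_⟩
  · have hstep : ∀ d i, i + d < m → c i = c (i + d) → c 0 = c d := by
      intro d i
      induction i with
      | zero => intro _ h; simpa using h
      | succ i ih =>
        intro h1 h2
        refine ih (by omega) (P.injective ?_)
        rw [hP i (by omega), hP (i + d) (by omega), h2]
        congr 1
        omega
    refine List.Nodup.map_on (fun i hi j hj hij => ?_) List.nodup_range
    rw [List.mem_range] at hi hj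
    by_contra hne'
    rcases Nat.lt_or_gt_of_ne hne' with h | h
    · obtain ⟨d, rfl⟩ : ∃ d, j = i + d := ⟨j - i, by omega⟩
      exact hne d (by omega) (by omega) (hstep d i hj hij).symm
    · obtain ⟨d, rfl⟩ : ∃ d, i = j + d := ⟨i - j, by omega⟩
      exact hne d (by omega) (by omega) (hstep d j hi hij.symm).symm
  · refine List.ext_getElem (by simp) fun i h1 h2 => ?_
    simp only [List.length_map, List.length_range] at h1
    rw [List.getElem_rotate]
    simp only [List.getElem_map, List.getElem_range, List.length_map, List.length_range]
    rw [hP i h1]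
    rcases Nat.lt_or_ge (i + 1) m with h | h
    · rw [Nat.mod_eq_of_lt h]
    · have : i + 1 = m := by omega
      rw [this, Nat.mod_self, hc]

/-- A completion is a cycle of a completing partition; this uses that its length exceeds two. -/
theorem Instance.IsEvenCompletion.exists_completing {I : Instance n} {a b : Fin n}
    {r : List (Fin n)} (h : I.IsEvenCompletion a b r) :
    ∃ P ∈ I.Completing a b, IsCycleOf P (a :: b :: r) := by
  obtain ⟨⟨P, hP, hc⟩, -, hlen⟩ := h
  have h1 := hc.getElem_eq (by simp) 1 (by simp)
  obtain ⟨x, r, rfl⟩ : ∃ x r', r = x :: r' := by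
    refine List.exists_cons_of_ne_nil ?_
    rintro rfl
    simp at hlen
  have h2 := hc.getElem_eq (by simp) 2 (by simp)
  simp at h1 h2
  refine ⟨P, ⟨hP, h1.symm, ?_⟩, hc⟩
  rw [h1, ← h2]
  rintro rfl
  have := hc.2.1
  simp at this

/-! ### The candidate -/

/-- The agent at distance `i` from `a` on the candidate for the cycle: the agents at even distances
are those on the stack, and each is followed by its first choice. -/
def candidate (f : Equiv.Perm (Fin n)) (a : Fin n) (l : List (Fin n)) (i : ℕ) : Fin n :=
  if i % 2 = 0 then (a :: l).getD (i / 2) a else f ((a :: l).getD (i / 2) a)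

theorem Found.candidate_eq {I : Instance n} {a b : Fin n} {l : List (Fin n)} {s : State}
    (h : Found I a b l s) {f : Equiv.Perm (Fin n)} (hf : ∀ x, I.rank x (f x) = s.tab n 3 x)
    {P : Equiv.Perm (Fin n)} (hP : P ∈ I.Completing a b) {i : ℕ} (hi : i ≤ 2 * l.length) :
    candidate f a l i = P^[i] a := by
  have hinv := h.1.inv
  have hmem := hinv.mem_last
  obtain ⟨p, l, rfl⟩ := List.exists_cons_of_ne_nil (List.ne_nil_of_mem hmem)
  obtain ⟨h1, h2⟩ := hinv.found (h.2 p (by simp)) hP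
  have h3 : ∀ k, k ≤ (p :: l).length → (a :: p :: l).getD k a = P^[2 * k] a := by
    intro k
    induction k with
    | zero => intro _; rfl
    | succ k ih =>
      intro hk
      have h4 := h2.getElem k (by simp at hk ⊢; omega)
      have ih := ih (by omega)
      rw [List.getD_eq_getElem _ _ (by simp at hk ⊢; omega)] at ih ⊢
      rw [← h4, ih, Nat.mul_succ, Function.iterate_succ_apply', Function.iterate_succ_apply']
  have h5 : ∀ k, k ≤ (p :: l).length → f ((a :: p :: l).getD k a) = P ((a :: p :: l).getD k a) := by
    intro k hk
    rw [List.getD_eq_getElem _ _ (by simp at hk ⊢; omega)]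
    refine I.rank_inj.1 ((hf _).trans (h1 _ ?_).symm)
    cases k with
    | zero => exact hmem
    | succ k => exact List.getElem_mem _
  unfold candidate
  split
  · rw [h3 _ (by omega)]
    congr 1
    omega
  · rw [h5 _ (by omega), h3 _ (by omega), ← Function.iterate_succ_apply' P]
    congr 1
    omega

/-- There is no completion other than the candidate. Its length is determined by `a` occurring just
once on the stack and on the cycle. -/
theorem Found.eq_map_candidate {I : Instance n} {a b : Fin n} {l : List (Fin n)} {s : State}
    (h : Found I a b l s) {f : Equiv.Perm (Fin n)} (hf : ∀ x, I.rank x (f x) = s.tab n 3 x)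
    {r : List (Fin n)} (hr : I.IsEvenCompletion a b r) :
    a :: b :: r = (List.range (2 * l.length)).map (candidate f a l) := by
  obtain ⟨P, hP, hc⟩ := hr.exists_completing
  obtain ⟨k, hk⟩ := hr.2.1
  have hget : ∀ i (hi : i < (a :: b :: r).length), (a :: b :: r)[i] = P^[i] a :=
    hc.getElem_eq (by simp)
  have hlen : P^[(a :: b :: r).length] a = a := hc.iterate_length (by simp)
  have hnodup := hc.2.1
  have hcpos : 0 < (a :: b :: r).length := by simp
  generalize a :: b :: r = L at hk hget hlen hnodup hcpos ⊢
  have hc0 : L[0] = a := hget 0 hcpos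
  have hcand : ∀ i ≤ 2 * l.length, candidate f a l i = P^[i] a :=
    fun i hi => h.candidate_eq hf hP hi
  have hl : 0 < l.length := List.length_pos_of_mem h.1.inv.mem_last
  have hlast : l[l.length - 1] = a := by
    have := h.1.inv.last
    rw [List.getLast?_eq_getElem?, List.getElem?_eq_getElem (by omega)] at this
    simpa using this
  have hstack : ∀ j (hj : j < l.length), candidate f a l (2 * (j + 1)) = l[j] := by
    intro j hj
    unfold candidate
    rw [if_pos (by omega), Nat.mul_div_cancel_left _ (by omega)]
    simp [hj]
  have hkl : k = l.length := by
    rcases lt_trichotomy k l.length with h1 | h1 | h1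
    · -- the stack would contain `a` in a second place
      have h2 := hstack (k - 1) (by omega)
      rw [hcand _ (by omega), show 2 * (k - 1 + 1) = L.length by omega, hlen] at h2
      have := (h.1.inv.nodup.getElem_inj_iff).1 (h2.symm.trans hlast.symm)
      omega
    · exact h1
    · -- the cycle would contain `a` in a second place
      have h2 := hstack (l.length - 1) (by omega)
      rw [hcand _ (by omega), hlast, show 2 * (l.length - 1 + 1) = 2 * l.length by omega,
        ← hget _ (by omega), ← hc0] at h2
      have := (hnodup.getElem_inj_iff).1 h2
      omega
  refine List.ext_getElem (by simp; omega) fun i h1 h2 => ?_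
  rw [List.getElem_map, List.getElem_range, hget i h1, hcand i (by omega)]

/-- Writes the candidate to array `1`, with the first agent repeated at the end, and its length to
variable `17`. -/
def buildCmd : Cmd :=
  .seq (.store 8 (.var 12) (.var 1)) <|
  .seq (.for 4 (.var 12) <|
    .seq (.assign 8 (.get 8 (.bin .sub (.var 12) (.var 4)))) <|
    .seq (.store 1 (.bin .mul (.lit 2) (.var 4)) (.var 8))
      (.store 1 (.bin .add (.bin .mul (.lit 2) (.var 4)) (.lit 1))
        (prefE (.var 8) (.get 3 (.var 8))))) <|
  .seq (.assign 17 (.bin .mul (.lit 2) (.var 12))) <|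
  .store 1 (.var 17) (.var 1)

theorem StackRep.get_eq {g : ℕ → ℕ} : ∀ {l : List (Fin n)}, StackRep g l →
    ∀ k (hk : k < l.length), g (l.length - 1 - k) = l[k]
  | x :: l, h, 0, _ => h.1
  | x :: l, h, k + 1, hk => by
    have := h.2.get_eq k (by simpa using hk)
    rw [List.getElem_cons_succ, ← this]
    congr 1
    simp
    omega

theorem Found.reaches_buildCmd {I : Instance n} {a b : Fin n} {l : List (Fin n)} {s : State}
    {B : ℕ} (hB : n * n + 4 * n + 4 ≤ B) (h : Found I a b l s) {f : Equiv.Perm (Fin n)}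
    (hf : ∀ x, I.rank x (f x) = s.tab n 3 x) :
    Reaches B buildCmd s fun s' t => t ≤ (n + 1) * 60 ∧ s'.var 17 = 2 * l.length ∧
      ∀ i ≤ 2 * l.length, s'.arr 1 i = candidate f a l i := by
  have hlen := h.1.length_le
  have han := a.2
  have hl : 0 < l.length := List.length_pos_of_mem h.1.inv.mem_last
  refine Reaches.seq (Reaches.store (Evals.var h.1.size (by omega))
    (Evals.var h.1.start (by omega)) ?_)
  have hst : StackRep ((s.setArr 8 l.length a).arr 8) (a :: l) :=
    ⟨by simp, h.1.stack.congr fun i hi => by simp; omega⟩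
  refine Reaches.seq (Reaches.for (m := l.length) (T := 40) (Inv := fun k s' => s'.var 4 = k ∧
    HasRank I s' ∧ s'.var 1 = a ∧ s'.var 12 = l.length ∧ StackRep (s'.arr 8) (a :: l) ∧
    s'.tab n 3 = s.tab n 3 ∧ ∀ i < 2 * k, s'.arr 1 i = candidate f a l i) (by omega) ?_ ?_ ?_ ?_)
  · exact ⟨by simp, (h.1.hasRank.setArr _ _ (by omega) (by omega)).setVar _ (by omega),
      by simpa using h.1.start, by simpa using h.1.size, hst, by
      rw [State.tab_setVar, State.tab_setArr_of_ne _ _ _ _ (by omega)], fun i hi => by omega⟩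
  · rintro k s' hk ⟨h1, -, -, h2, -⟩
    exact ⟨h1, Evals.var h2 (by omega)⟩
  · rintro k s' hk ⟨h1, h2, h3, h4, h5, h6, h7⟩
    have h8 := h5.get_eq k (by simp; omega)
    generalize hx : (a :: l)[k]'(by simp; omega) = x at h8
    rw [List.length_cons, Nat.add_sub_cancel] at h8
    have hxn := x.2
    have hfx := hf x
    have hrx := I.rank_lt x (f x)
    have h3x : s'.arr 3 x = I.rank x (f x) := by
      rw [hfx, ← h6, State.tab_apply]
    have hpr : I.pref x ⟨I.rank x (f x), hrx⟩ = f x := by simp [Instance.rank]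
    have hgetD : (a :: l).getD k a = x := by
      rw [List.getD_eq_getElem _ _ (by simp; omega), hx]
    refine Reaches.seq (Reaches.assign (v := x) (Evals.get (Evals.sub (Evals.var h4 (by omega))
      (Evals.var h1 (by omega)) (by omega)) h8 (by omega)) ?_)
    refine Reaches.seq (Reaches.store (u := 2 * k) (v := x) (Evals.mul (Evals.lit (by omega))
      (Evals.var (by simpa using h1) (by omega)) (by omega)) (Evals.var (by simp) (by omega)) ?_)
    have h2' := (h2.setVar (x := 8) x (by omega)).setArr (a := 1) (2 * k) x (by omega) (by omega)
    refine Reaches.store (u := 2 * k + 1) (Evals.add (Evals.mul (Evals.lit (by omega))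
      (Evals.var (v := k) (by simpa using h1) (by omega)) (by omega)) (Evals.lit (by omega))
      (by omega)) (h2'.toHasPref.evals_pref hB (x := x) (k := ⟨_, hrx⟩)
      (Evals.var (by simp) (by omega)) (Evals.get (v := x) (Evals.var (by simp) (by omega))
        (by simpa using h3x) (by simp only; omega))) ?_
    rw [hpr]
    refine ⟨by simp [Expr.cost, prefE], by simpa using h1, by simp,
      (h2'.setArr _ _ (by omega) (by omega)).setVar _ (by omega), by simpa using h3,
      by simpa using h4, h5.congr fun i _ => by simp, ?_, fun i hi => ?_⟩
    · rw [← h6, State.tab_setVar, State.tab_setArr_of_ne _ _ _ _ (by omega),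
        State.tab_setArr_of_ne _ _ _ _ (by omega), State.tab_setVar]
    · by_cases hi1 : i = 2 * k + 1
      · subst hi1
        have : candidate f a l (2 * k + 1) = f x := by
          unfold candidate
          rw [if_neg (by omega), show (2 * k + 1) / 2 = k by omega, hgetD]
        simp [this]
      · by_cases hi0 : i = 2 * k
        · subst hi0
          have : candidate f a l (2 * k) = x := by
            unfold candidate
            rw [if_pos (by omega), show 2 * k / 2 = k by omega, hgetD]
          simp [this]
        · simpa [hi0, hi1] using h7 i (by omega)
  · rintro s₁ t₁ ⟨-, h2, h3, h4, -, -, h7⟩ ht₁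
    refine Reaches.seq (Reaches.assign (v := 2 * l.length) (Evals.mul (Evals.lit (by omega))
      (Evals.var h4 (by omega)) (by omega)) ?_)
    refine Reaches.store (u := 2 * l.length) (v := a) (Evals.var (by simp) (by omega))
      (Evals.var (by simpa using h3) (by omega)) ⟨?_, by simp, fun i hi => ?_⟩
    · simp only [Expr.cost] at ht₁ ⊢
      have : (l.length + 1) * (40 + 1 + 9) ≤ (n + 1) * (40 + 1 + 9) :=
        Nat.mul_le_mul_right _ (by omega)
      omega
    · by_cases hi' : i = 2 * l.length
      · subst hi'
        have hlast := h.1.inv.last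
        rw [List.getLast?_eq_getElem?, List.getElem?_eq_getElem (by omega)] at hlast
        have hlast : l[l.length - 1] = a := by simpa using hlast
        obtain ⟨m, hm⟩ : ∃ m, l.length = m + 1 := ⟨l.length - 1, by omega⟩
        have h8 : (a :: l).getD l.length a = a := by
          rw [List.getD_eq_getElem _ _ (by simp)]
          simp only [hm, List.getElem_cons_succ]
          rw [← hlast]
          congr 1
          omega
        have h9 : candidate f a l (2 * l.length) = a := by
          unfold candidate
          rw [if_pos (by omega), Nat.mul_div_cancel_left _ (by omega), h8]
        rw [h9]
        simp
      · simpa [hi'] using h7 i (by omega)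

/-! ### Verifying the candidate -/

/-- The stable partitions that run through `c 0, …, c m`. -/
def Instance.Through (I : Instance n) (c : ℕ → Fin n) (m : ℕ) : Set (Equiv.Perm (Fin n)) :=
  {P | I.IsStablePartition P ∧ ∀ i < m, P (c i) = c (i + 1)}

/-- The predecessor of `c i` on the closed walk `c` of length `m`. -/
def walkPred (c : ℕ → Fin n) (m : ℕ) : ℕ → Fin n
  | 0 => c (m - 1)
  | i + 1 => c i

theorem apply_walkPred {P : Equiv.Perm (Fin n)} {c : ℕ → Fin n} {m : ℕ}
    (hP : ∀ i < m, P (c i) = c (i + 1)) (hc : c m = c 0) : ∀ i < m, P (walkPred c m i) = c i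
  | 0, hi => by
    rw [walkPred, hP _ (by omega), Nat.sub_add_cancel hi, hc]
  | i + 1, hi => hP i (by omega)

/-- The first choices and the bounds after the first `k` agents of the walk have made their offers
to all agents, except their successors, that they prefer to their predecessors. -/
structure Instance.OfferInv (I : Instance n) (c : ℕ → Fin n) (m k : ℕ) (F U : Fin n → ℕ) :
    Prop where
  first_le : ∀ x, F x ≤ n
  bound_le : ∀ x, U x ≤ n
  rejected : ∀ x y, I.rank x y < F x → U y ≤ I.rank y x
  offers : ∀ i < k, ∀ z, I.rank (c i) z < I.rank (c i) (walkPred c m i) → z ≠ c (i + 1) →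
    U z ≤ I.rank z (c i)
  sound : ∀ P ∈ I.Through c m, I.Between F U P
  first_ge : ∀ P ∈ I.Through c m, ∀ i < k, I.rank (c i) (P (c i)) ≤ F (c i)

namespace Instance.OfferInv

variable {I : Instance n} {c : ℕ → Fin n} {m k : ℕ} {F U : Fin n → ℕ}

theorem pred_eq {P : Equiv.Perm (Fin n)} (hc : c m = c 0) (hk : k < m)
    (hP : P ∈ I.Through c m) : P⁻¹ (c k) = walkPred c m k :=
  perm_inv_eq_of_apply_eq (apply_walkPred hP.2 hc k hk)

theorem offer (h : I.OfferInv c m k F U) (hc : c m = c 0) (hk : k < m) {U' : Fin n → ℕ}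
    (hU : U' = I.cut U (c k) (c (k + 1)) (I.rank (c k) (walkPred c m k))) :
    (∀ x, U' x ≤ n) ∧ (∀ x y, I.rank x y < F x → U' y ≤ I.rank y x) ∧
    (∀ i < k + 1, ∀ z, I.rank (c i) z < I.rank (c i) (walkPred c m i) → z ≠ c (i + 1) →
      U' z ≤ I.rank z (c i)) ∧ ∀ P ∈ I.Through c m, I.Between F U' P := by
  subst hU
  refine ⟨fun x => (I.cut_le _ _ _ _ _).trans (h.bound_le x),
    fun x y hxy => (I.cut_le _ _ _ _ _).trans (h.rejected x y hxy), fun i hi z hz hz' => ?_,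
    fun P hP => (h.sound P hP).cut hP.1 (hP.2 k hk) (by rw [pred_eq hc hk hP])⟩
  rcases Nat.lt_succ_iff_lt_or_eq.1 hi with hi | rfl
  · exact (I.cut_le _ _ _ _ _).trans (h.offers i hi z hz hz')
  · exact I.cut_le_rank _ hz hz'

theorem step (h : I.OfferInv c m k F U) (hc : c m = c 0) (hk : k < m)
    (hle : I.rank (c k) (c (k + 1)) ≤ I.rank (c k) (walkPred c m k)) :
    I.OfferInv c m (k + 1) (Function.update F (c k) (I.rank (c k) (c (k + 1))))
      (I.cut U (c k) (c (k + 1)) (I.rank (c k) (walkPred c m k))) := by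
  obtain ⟨h1, h2, h3, h4⟩ := h.offer hc hk rfl
  refine ⟨fun x => ?_, h1, fun x y hxy => ?_, h3, fun P hP => ?_, fun P hP i hi => ?_⟩
  · by_cases hx : x = c k
    · rw [hx, Function.update_self]
      exact (I.rank_lt _ _).le
    · rw [Function.update_of_ne hx]
      exact h.first_le x
  · by_cases hx : x = c k
    · rw [hx, Function.update_self] at hxy
      rw [hx]
      refine I.cut_le_rank _ (hxy.trans_le hle) ?_
      rintro rfl
      exact lt_irrefl _ hxy
    · rw [Function.update_of_ne hx] at hxy
      exact h2 x y hxy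
  · refine (h4 P hP).advance ?_
    rw [hP.2 k hk]
  · by_cases hx : c i = c k
    · rw [hx, Function.update_self, hP.2 k hk]
    · rw [Function.update_of_ne hx]
      rcases Nat.lt_succ_iff_lt_or_eq.1 hi with hi | rfl
      · exact h.first_ge P hP i hi
      · exact absurd rfl hx

/-- An agent that prefers its predecessor to its successor rules out every partition. -/
theorem eq_empty (hc : c m = c 0) (hk : k < m)
    (hlt : I.rank (c k) (walkPred c m k) < I.rank (c k) (c (k + 1))) : I.Through c m = ∅ := by
  refine Set.eq_empty_of_forall_notMem fun P hP => ?_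
  have h1 := hP.1.succ_le_pred (c k)
  rw [pred_eq hc hk hP, hP.2 k hk] at h1
  omega

theorem step_of_lt (h : I.OfferInv c m k F U) (hc : c m = c 0) (hk : k < m)
    (hlt : I.rank (c k) (walkPred c m k) < I.rank (c k) (c (k + 1))) :
    I.OfferInv c m (k + 1) F (I.cut U (c k) (c (k + 1)) (I.rank (c k) (walkPred c m k))) := by
  obtain ⟨h1, h2, h3, h4⟩ := h.offer hc hk rfl
  refine ⟨h.first_le, h1, h2, h3, h4, fun P hP => ?_⟩
  rw [eq_empty hc hk hlt] at hP
  exact absurd hP (Set.notMem_empty P)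

/-- If, after the offers, the proposal process ends in a table that runs through the walk `c`, then
there is a stable partition that does: the offers make `c` an isolated set of the table, which is
thus preserved by the elimination of rotations. -/
theorem nonempty {F₀ U₀ H : Fin n → ℕ} (h : I.OfferInv c m m F₀ U₀) (hc : c m = c 0)
    (hI : I.ProposeInv (I.Through c m) F₀ U₀ n 0 F U H)
    (hF : ∀ i < m, F (c i) = I.rank (c i) (c (i + 1))) : (I.Through c m).Nonempty := by
  obtain ⟨f, hf⟩ := hI.matched.exists_perm
  have htab := hI.isTable hf
  have hfc : ∀ i < m, f (c i) = c (i + 1) := fun i hi =>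
    I.rank_inj.1 ((hf (c i)).1.trans (hF i hi))
  have hiso : I.IsIsolated f {x | ∃ i < m, c i = x} := by
    constructor
    · rintro _ ⟨i, hi, rfl⟩
      rw [hfc i hi]
      rcases Nat.lt_or_ge (i + 1) m with h1 | h1
      · exact ⟨i + 1, h1, rfl⟩
      · exact ⟨0, by omega, by rw [← hc]; congr 1; omega⟩
    · rintro _ ⟨i, hi, rfl⟩ z ⟨h1, h2⟩
      rw [perm_inv_eq_of_apply_eq (apply_walkPred hfc hc i hi)] at h1
      have hz : z ≠ c (i + 1) := by
        rintro rfl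
        rw [← hfc i hi, perm_inv_apply_self] at h2
        exact lt_irrefl _ h2
      have h3 := h.offers i hi z h1 hz
      have h4 := hI.bound_le z
      have h5 := (hf (f⁻¹ z)).2.2
      rw [show f (f⁻¹ z) = z from f.apply_symm_apply z] at h5
      omega
  obtain ⟨P, hP, hPf⟩ :=
    Instance.IsTable.exists_stablePartition I _ (n * n) f (Nat.le_add_right _ _) htab hiso
  exact ⟨P, hP, fun i hi => (hPf _ ⟨i, hi, rfl⟩).trans (hfc i hi)⟩

end Instance.OfferInv

/-- Every agent of the walk in array `1`, whose length is in variable `17`, makes its offers.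
Variable `18` holds its predecessor, and variable `7` is set if it prefers that to its successor. -/
def offersCmd : Cmd :=
  .for 4 (.var 17) <| .seq (.assign 8 (.get 1 (.var 4))) <|
  .seq (.assign 9 (.get 1 (.bin .add (.var 4) (.lit 1)))) <|
  .seq (.assign 10 (rankE (.var 8) (.var 18))) <| .seq offerCmd <|
  .seq (.ite (.bin .lt (.var 10) (rankE (.var 8) (.var 9))) (.assign 7 (.lit 1))
    (.store 3 (.var 8) (rankE (.var 8) (.var 9)))) (.assign 18 (.var 8))

/-- The preference lists, their inverses and the walk `c` of length `m` are in memory. -/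
structure HasWalk (I : Instance n) (c : ℕ → Fin n) (m : ℕ) (s : State) : Prop
    extends HasRank I s where
  length : s.var 17 = m
  walk : ∀ i ≤ m, s.arr 1 i = c i

theorem HasWalk.congr {I : Instance n} {c : ℕ → Fin n} {m : ℕ} {s s' : State}
    (h : HasWalk I c m s) (hr : HasRank I s') (h17 : s'.var 17 = s.var 17)
    (h1 : s'.arr 1 = s.arr 1) : HasWalk I c m s' :=
  ⟨hr, h17.trans h.length, fun i hi => h1 ▸ h.walk i hi⟩

theorem reaches_offersCmd {I : Instance n} {c : ℕ → Fin n} {m : ℕ} {s : State} {B : ℕ}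
    (hB : n * n + 4 * n + 4 ≤ B) (hm : m ≤ 2 * n) (hc : c m = c 0) (hs : HasWalk I c m s)
    (h18 : s.var 18 = walkPred c m 0) (h7 : s.var 7 = 0)
    (hI : I.OfferInv c m 0 (s.tab n 3) (s.tab n 4)) :
    Reaches B offersCmd s fun s' t => t ≤ (2 * n + 1) * ((n + 1) * 60 + 60) ∧
      HasWalk I c m s' ∧ s'.tab n 5 = s.tab n 5 ∧
      (s'.var 7 = 0 ∨ s'.var 7 = 1 ∧ I.Through c m = ∅) ∧
      I.OfferInv c m m (s'.tab n 3) (s'.tab n 4) := by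
  refine Reaches.for (m := m) (T := (n + 1) * 60 + 50) (Inv := fun k s' => s'.var 4 = k ∧
    HasWalk I c m s' ∧ s'.var 18 = walkPred c m k ∧ s'.tab n 5 = s.tab n 5 ∧
      (s'.var 7 = 0 ∨ s'.var 7 = 1 ∧ I.Through c m = ∅) ∧
      I.OfferInv c m k (s'.tab n 3) (s'.tab n 4)) (by omega) ?_ ?_ ?_ ?_
  · exact ⟨by simp, hs.congr (hs.setVar _ (by omega)) (by simp) rfl, by simpa using h18, rfl,
      Or.inl (by simpa using h7), hI⟩
  · rintro k s' hk ⟨h1, h2, -⟩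
    exact ⟨h1, Evals.var h2.length (by omega)⟩
  · clear h18 h7 hI
    rintro k s₁ hk ⟨h4, hw, h18, h5, h7, hI⟩
    have hxn := (c k).2
    have hyn := (c (k + 1)).2
    have hpn := (walkPred c m k).2
    have hrp := I.rank_lt (c k) (walkPred c m k)
    refine Reaches.seq (Reaches.assign (Evals.get (Evals.var h4 (by omega)) (hw.walk k hk.le)
      (by omega)) ?_)
    refine Reaches.seq (Reaches.assign (v := c (k + 1)) (Evals.get (v := k + 1) (Evals.add
      (Evals.var (by simpa using h4) (by omega)) (Evals.lit (by omega)) (by omega))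
      (by simpa using hw.walk (k + 1) hk) (by omega)) ?_)
    have hr₂ := (hw.setVar (x := 8) (c k) (by omega)).setVar (x := 9) (c (k + 1)) (by omega)
    refine Reaches.seq (Reaches.assign (hr₂.evals_rank hB (x := c k) (y := walkPred c m k)
      (Evals.var (by simp) (by omega)) (Evals.var (by simpa using h18) (by omega))) ?_)
    refine Reaches.seq ((reaches_offerCmd (x := c k) (y := c (k + 1)) hB
      (hr₂.setVar _ (by omega)) (by simp) (by simp) hrp.le (by simp) hI.bound_le).frame.mono ?_)
    rintro s₃ t₃ ⟨⟨ht₃, hr₃, hU₃⟩, v₃, a₃⟩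
    have fr : ∀ y, y ≠ 5 → y ≠ 11 → s₃.var y = _ := fun y h4 h5 =>
      (v₃ y (by simp [offerCmd, Cmd.for, Cmd.WritesVar, h4, h5]))
    have fa : ∀ b, b ≠ 4 → s₃.arr b = s₁.arr b := fun b hb =>
      a₃ b (by simp [offerCmd, Cmd.for, Cmd.WritesArr, hb])
    have v4 : s₃.var 4 = k := (fr 4 (by omega) (by omega)).trans (by simpa using h4)
    have v7 : s₃.var 7 = s₁.var 7 := (fr 7 (by omega) (by omega)).trans (by simp)
    have v8 : s₃.var 8 = c k := (fr 8 (by omega) (by omega)).trans (by simp)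
    have v9 : s₃.var 9 = c (k + 1) := (fr 9 (by omega) (by omega)).trans (by simp)
    have v10 : s₃.var 10 = I.rank (c k) (walkPred c m k) :=
      (fr 10 (by omega) (by omega)).trans (by simp)
    have v17 : s₃.var 17 = s₁.var 17 := (fr 17 (by omega) (by omega)).trans (by simp)
    have t3 : s₃.tab n 3 = s₁.tab n 3 := by funext x; simp [fa 3 (by omega)]
    have t5 : s₃.tab n 5 = s.tab n 5 := by rw [← h5]; funext x; simp [fa 5 (by omega)]
    have hw₃ : HasWalk I c m s₃ := hw.congr hr₃ v17 (fa 1 (by omega))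
    simp only [State.tab_setVar] at hU₃
    clear fr fa v₃ a₃
    have e8 : Evals B s₃ (.var 8) (c k) := Evals.var v8 (by omega)
    have er := hr₃.evals_rank hB e8 (Evals.var v9 (by omega))
    refine Reaches.seq (Reaches.ite (Evals.lt (Evals.var v10 (by omega)) er (by omega))
      (fun hlt => ?_) (fun hlt => ?_))
    · refine Reaches.assign (Evals.lit (by omega)) ?_
      refine Reaches.assign (v := c k) (Evals.var (by simpa using v8) (by omega)) ?_
      refine ⟨by simp only [Expr.cost, rankE]; omega, by simpa using v4, by simp,
        hw₃.congr (((hr₃.setVar _ (by omega)).setVar _ (by omega)).setVar _ (by omega))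
          (by simp) rfl, by simp [walkPred], t5,
        Or.inr ⟨by simp, Instance.OfferInv.eq_empty hc hk hlt⟩, ?_⟩
      simp only [State.tab_setVar, t3, hU₃]
      exact hI.step_of_lt hc hk hlt
    · refine Reaches.store e8 er ?_
      refine Reaches.assign (v := c k) (Evals.var (by simpa using v8) (by omega)) ?_
      refine ⟨by simp only [Expr.cost, rankE]; omega, by simpa using v4, by simp,
        hw₃.congr (((hr₃.setArr _ _ (by omega) (by omega)).setVar _ (by omega)).setVar _
          (by omega)) (by simp) (by funext j; simp), by simp [walkPred], ?_,
        by simpa [v7] using h7, ?_⟩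
      · rw [← t5, State.tab_setVar, State.tab_setVar, State.tab_setArr_of_ne _ _ _ _ (by omega)]
      · simp only [State.tab_setVar, State.tab_setArr_self, State.tab_setArr_of_ne, ne_eq,
          Nat.reduceEqDiff, not_false_eq_true, t3, hU₃]
        exact hI.step hc hk (not_lt.1 hlt)
  · rintro s' t ⟨-, h1, -, h2, h3, h4⟩ ht
    refine ⟨ht.trans ?_, h1, h2, h3, h4⟩
    simp only [Expr.cost]
    exact Nat.mul_le_mul (by omega) (by omega)

/-- Sets variable `7` unless the walk follows the first choices and visits its first agent only at
both ends. -/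
def checkCmd : Cmd :=
  .for 4 (.var 17) <| .seq (.assign 8 (.get 1 (.var 4))) <|
  .seq (.assign 9 (.get 1 (.bin .add (.var 4) (.lit 1)))) <|
  .ite (.bin .eq (.get 3 (.var 8)) (rankE (.var 8) (.var 9)))
    (.ite (.bin .lt (.lit 0) (.var 4))
      (.ite (.bin .eq (.var 8) (.get 1 (.lit 0))) (.assign 7 (.lit 1)) .skip) .skip)
    (.assign 7 (.lit 1))

theorem reaches_checkCmd {I : Instance n} {c : ℕ → Fin n} {m : ℕ} {s : State} {B : ℕ}
    (hB : n * n + 4 * n + 4 ≤ B) (hm : m ≤ 2 * n) (hs : HasWalk I c m s) (h7 : s.var 7 = 0)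
    (hF : ∀ x, s.tab n 3 x ≤ n) :
    Reaches B checkCmd s fun s' t => t ≤ (2 * n + 1) * 60 ∧
      (s'.var 7 = 0 ∧ (∀ i < m, s.tab n 3 (c i) = I.rank (c i) (c (i + 1)) ∧
        (0 < i → c i ≠ c 0)) ∨
      s'.var 7 = 1 ∧ ∃ i < m, ¬ (s.tab n 3 (c i) = I.rank (c i) (c (i + 1)) ∧
        (0 < i → c i ≠ c 0))) := by
  set p : ℕ → Prop := fun i => s.tab n 3 (c i) = I.rank (c i) (c (i + 1)) ∧ (0 < i → c i ≠ c 0)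
    with hp
  refine Reaches.for (m := m) (T := 50) (Inv := fun k s' => s'.var 4 = k ∧
    HasWalk I c m s' ∧ s'.tab n 3 = s.tab n 3 ∧
      (s'.var 7 = 0 ∧ (∀ i < k, p i) ∨ s'.var 7 = 1 ∧ ∃ i < m, ¬ p i)) (by omega) ?_ ?_ ?_ ?_
  · exact ⟨by simp, hs.congr (hs.setVar _ (by omega)) (by simp) rfl, rfl,
      Or.inl ⟨by simpa using h7, fun i hi => by omega⟩⟩
  · rintro k s' hk ⟨h1, h2, -⟩
    exact ⟨h1, Evals.var h2.length (by omega)⟩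
  · clear h7
    rintro k s₁ hk ⟨h4, hw, h3, h7⟩
    have hxn := (c k).2
    have hyn := (c (k + 1)).2
    have h0n := (c 0).2
    have hFx := hF (c k)
    refine Reaches.seq (Reaches.assign (Evals.get (Evals.var h4 (by omega)) (hw.walk k hk.le)
      (by omega)) ?_)
    refine Reaches.seq (Reaches.assign (v := c (k + 1)) (Evals.get (v := k + 1) (Evals.add
      (Evals.var (by simpa using h4) (by omega)) (Evals.lit (by omega)) (by omega))
      (by simpa using hw.walk (k + 1) hk) (by omega)) ?_)
    have hr₂ := (hw.setVar (x := 8) (c k) (by omega)).setVar (x := 9) (c (k + 1)) (by omega)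
    have hw₂ : HasWalk I c m ((s₁.setVar 8 (c k)).setVar 9 (c (k + 1))) :=
      hw.congr hr₂ (by simp) rfl
    generalize hs₂ : (s₁.setVar 8 (c k)).setVar 9 (c (k + 1)) = s₂ at hw₂ hr₂
    have v4 : s₂.var 4 = k := by rw [← hs₂]; simpa using h4
    have v8 : s₂.var 8 = c k := by rw [← hs₂]; simp
    have v9 : s₂.var 9 = c (k + 1) := by rw [← hs₂]; simp
    have t3 : s₂.tab n 3 = s.tab n 3 := by rw [← h3, ← hs₂]; simp
    have v7 : s₂.var 7 = s₁.var 7 := by rw [← hs₂]; simp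
    have e8 : Evals B s₂ (.var 8) (c k) := Evals.var v8 (by omega)
    have eF : Evals B s₂ (.get 3 (.var 8)) (s.tab n 3 (c k)) :=
      Evals.get e8 (congrFun t3 (c k)) (by omega)
    have hset : HasWalk I c m (s₂.setVar 4 (k + 1)) :=
      hw₂.congr (hr₂.setVar _ (by omega)) (by simp) rfl
    have hset' : HasWalk I c m ((s₂.setVar 7 1).setVar 4 (k + 1)) :=
      hw₂.congr ((hr₂.setVar _ (by omega)).setVar _ (by omega)) (by simp) rfl
    have hgood : p k → s₂.var 7 = 0 ∧ (∀ i < k + 1, p i) ∨ s₂.var 7 = 1 ∧ ∃ i < m, ¬ p i := by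
      intro hpk
      rw [v7]
      refine h7.imp_left fun h => ⟨h.1, fun i hi => ?_⟩
      rcases Nat.lt_succ_iff_lt_or_eq.1 hi with hi | rfl
      · exact h.2 i hi
      · exact hpk
    refine Reaches.ite (Evals.eq eF (hr₂.evals_rank hB e8 (Evals.var v9 (by omega))) (by omega))
      (fun h1 => ?_) (fun h1 => ?_)
    · refine Reaches.ite (Evals.lt (Evals.lit (by omega)) (Evals.var v4 (by omega)) (by omega))
        (fun h2 => ?_) (fun h2 => ?_)
      · refine Reaches.ite (Evals.eq e8 (Evals.get (Evals.lit (by omega))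
          (hw₂.walk 0 (Nat.zero_le _)) (by omega)) (by omega)) (fun h3 => ?_) (fun h3 => ?_)
        · refine Reaches.assign (Evals.lit (by omega)) ⟨by simp [Expr.cost, rankE],
            by simpa using v4, by simp, hset', t3, Or.inr ⟨by simp, k, hk, ?_⟩⟩
          exact fun h => h.2 h2 (Fin.ext h3)
        · exact Reaches.skip ⟨by simp [Expr.cost, rankE], v4, by simp, hset, t3,
            by simpa using hgood ⟨h1, fun _ e => h3 (by rw [e])⟩⟩
      · exact Reaches.skip ⟨by simp [Expr.cost, rankE], v4, by simp, hset, t3,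
            by simpa using hgood ⟨h1, fun h => absurd h h2⟩⟩
    · exact Reaches.assign (Evals.lit (by omega)) ⟨by simp [Expr.cost, rankE],
        by simpa using v4, by simp, hset', t3, Or.inr ⟨by simp, k, hk, fun h => h1 h.1⟩⟩
  · rintro s' t ⟨-, -, -, h⟩ ht
    refine ⟨ht.trans ?_, h⟩
    simp only [Expr.cost]
    exact Nat.mul_le_mul (by omega) (by omega)

/-- Decides whether the walk in array `1` is a cycle of a stable partition, and if it is, sets the
length of the output to the length of the walk. -/
def verifyCmd : Cmd :=
  .seq resetCmd <| .seq (.assign 7 (.lit 0)) <|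
  .seq (.assign 18 (.get 1 (.bin .sub (.var 17) (.lit 1)))) <| .seq offersCmd <|
  .seq proposeCmd <|
  .seq (.ite (.bin .eq (.var 7) (.lit 0)) checkCmd .skip) <|
  .ite (.bin .eq (.var 7) (.lit 0))
    (.ite (.bin .lt (.lit 2) (.var 17)) (.assign 3 (.var 17)) .skip) .skip

theorem reaches_verifyCmd {I : Instance n} {c : ℕ → Fin n} {m : ℕ} {s : State} {B : ℕ}
    (hB : n * n + 4 * n + 4 ≤ B) (hm0 : 0 < m) (hm : m ≤ 2 * n) (hc : c m = c 0)
    (hs : HasWalk I c m s) (h3 : s.var 3 = 0) :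
    Reaches B verifyCmd s fun s' t => t ≤ 1000 * ((n + 1) * (n + 1)) ∧ s'.arr 1 = s.arr 1 ∧
      (s'.var 3 = m ∧ 2 < m ∧ (I.Through c m).Nonempty ∧ (∀ i < m, 0 < i → c i ≠ c 0) ∨
        s'.var 3 = 0 ∧ ¬ (2 < m ∧ (I.Through c m).Nonempty ∧ ∀ i < m, 0 < i → c i ≠ c 0)) := by
  have hpn := (c (m - 1)).2
  suffices h : Reaches B verifyCmd s fun s' t => t ≤ 1000 * ((n + 1) * (n + 1)) ∧
      (s'.var 3 = m ∧ 2 < m ∧ (I.Through c m).Nonempty ∧ (∀ i < m, 0 < i → c i ≠ c 0) ∨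
        s'.var 3 = 0 ∧ ¬ (2 < m ∧ (I.Through c m).Nonempty ∧ ∀ i < m, 0 < i → c i ≠ c 0)) by
    refine h.frame.mono fun s' t h => ⟨h.1.1, h.2.2 1 ?_, h.1.2⟩
    simp [verifyCmd, resetCmd, offersCmd, offerCmd, proposeCmd, checkCmd, Cmd.for, Cmd.WritesArr]
  refine Reaches.seq ((reaches_resetCmd hB hs.toHasRank).frame.mono ?_)
  rintro s₁ t₁ ⟨⟨ht₁, hr₁, hF₁, hU₁, hH₁⟩, v₁, a₁⟩
  have hw₁ : HasWalk I c m s₁ := hs.congr hr₁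
    (v₁ 17 (by simp [resetCmd, Cmd.for, Cmd.WritesVar]))
    (a₁ 1 (by simp [resetCmd, Cmd.for, Cmd.WritesArr]))
  have h3₁ : s₁.var 3 = 0 := (v₁ 3 (by simp [resetCmd, Cmd.for, Cmd.WritesVar])).trans h3
  clear v₁ a₁
  refine Reaches.seq (Reaches.assign (Evals.lit (by omega)) ?_)
  refine Reaches.seq (Reaches.assign (v := c (m - 1)) (Evals.get (v := m - 1) (Evals.sub
    (Evals.var (by simpa using hw₁.length) (by omega)) (Evals.lit (by omega)) (by omega))
    (hw₁.walk (m - 1) (by omega)) (by omega)) ?_)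
  have hw₂ : HasWalk I c m ((s₁.setVar 7 0).setVar 18 (c (m - 1))) :=
    hw₁.congr ((hr₁.setVar _ (by omega)).setVar _ (by omega)) (by simp) rfl
  refine Reaches.seq ((reaches_offersCmd hB hm hc hw₂ (by simp [walkPred]) (by simp) ?_).frame.mono
    ?_)
  · simp only [State.tab_setVar, hF₁, hU₁]
    exact ⟨fun _ => Nat.zero_le _, fun _ => le_rfl, fun _ _ h => by omega, fun _ h => by omega,
      fun P _ x => ⟨Nat.zero_le _, I.rank_lt _ _⟩, fun _ _ _ h => by omega⟩
  rintro s₃ t₃ ⟨⟨ht₃, hw₃, hH₃, h7₃, hI₃⟩, v₃, -⟩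
  have h3₃ : s₃.var 3 = 0 := (v₃ 3 (by simp [offersCmd, offerCmd, Cmd.for, Cmd.WritesVar])).trans
    (by simpa using h3₁)
  clear v₃
  refine Reaches.seq ((reaches_proposeCmd (S := I.Through c m) (fun P hP => hP.1) hB
    hw₃.toHasRank (hH₃.trans (by simpa using hH₁)) hI₃.first_le hI₃.bound_le hI₃.rejected
    hI₃.sound).frame.mono ?_)
  rintro s₄ t₄ ⟨⟨hr₄, ht₄, h₄⟩, v₄, a₄⟩
  have hw₄ : HasWalk I c m s₄ := hw₃.congr hr₄ (v₄ 17 (by simp [proposeCmd, Cmd.WritesVar]))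
    (a₄ 1 (by simp [proposeCmd, Cmd.WritesArr]))
  have h3₄ : s₄.var 3 = 0 := (v₄ 3 (by simp [proposeCmd, Cmd.WritesVar])).trans h3₃
  clear v₄ a₄
  have htime : ∀ t, t ≤ (2 * n + 1) * 60 →
      t₁ + t₃ + t₄ + t + 60 ≤ 1000 * ((n + 1) * (n + 1)) := by
    intro t ht
    nlinarith
  have hcase : s₄.var 7 = 1 ∧ I.Through c m = ∅ ∨ s₄.var 7 = 0 ∧
      I.ProposeInv (I.Through c m) (s₃.tab n 3) (s₃.tab n 4) n 0 (s₄.tab n 3) (s₄.tab n 4)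
        (s₄.tab n 5) := by
    rcases h₄ with h | ⟨h, hI⟩
    · exact Or.inl h
    · rcases h7₃ with h7 | ⟨h7, hS⟩
      · exact Or.inr ⟨h.trans h7, hI⟩
      · exact Or.inl ⟨h.trans h7, hS⟩
  rcases hcase with ⟨h7, hS⟩ | ⟨h7, hI⟩
  · refine Reaches.seq (Reaches.ite (Evals.eq (Evals.var h7 (by omega)) (Evals.lit (by omega))
      (by omega)) (by omega) (fun _ => Reaches.skip ?_))
    refine Reaches.ite (Evals.eq (Evals.var h7 (by omega)) (Evals.lit (by omega))
      (by omega)) (by omega) (fun _ => Reaches.skip ⟨?_, Or.inr ⟨h3₄, fun h => ?_⟩⟩)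
    · have := htime 0 (Nat.zero_le _)
      simp only [Expr.cost]
      linarith
    · rw [hS] at h
      exact Set.not_nonempty_empty h.2.1
  refine Reaches.seq (Reaches.ite (Evals.eq (Evals.var h7 (by omega)) (Evals.lit (by omega))
    (by omega)) (fun _ => ?_) (by omega))
  refine ((reaches_checkCmd hB hm hw₄ h7 hI.first_le).frame.mono ?_)
  rintro s₅ t₅ ⟨⟨ht₅, h₅⟩, v₅, -⟩
  have h3₅ : s₅.var 3 = 0 := (v₅ 3 (by simp [checkCmd, Cmd.for, Cmd.WritesVar])).trans h3₄
  have h17₅ : s₅.var 17 = m :=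
    (v₅ 17 (by simp [checkCmd, Cmd.for, Cmd.WritesVar])).trans hw₄.length
  have := htime t₅ ht₅
  rcases h₅ with ⟨h7₅, hgood⟩ | ⟨h7₅, i, hi, hbad⟩
  · refine Reaches.ite (Evals.eq (Evals.var h7₅ (by omega)) (Evals.lit (by omega))
      (by omega)) (fun _ => ?_) (by omega)
    refine Reaches.ite (Evals.lt (Evals.lit (by omega)) (Evals.var h17₅ (by omega)) (by omega))
      (fun h2 => ?_) (fun h2 => ?_)
    · refine Reaches.assign (Evals.var h17₅ (by omega)) ⟨?_, Or.inl ⟨by simp, h2, ?_,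
        fun i hi => (hgood i hi).2⟩⟩
      · simp only [Expr.cost]
        linarith
      · exact hI₃.nonempty hc hI fun i hi => (hgood i hi).1
    · refine Reaches.skip ⟨?_, Or.inr ⟨h3₅, fun h => h2 h.1⟩⟩
      simp only [Expr.cost]
      linarith
  · refine Reaches.ite (Evals.eq (Evals.var h7₅ (by omega)) (Evals.lit (by omega))
      (by omega)) (by omega) (fun _ => Reaches.skip ⟨?_, Or.inr ⟨h3₅, ?_⟩⟩)
    · simp only [Expr.cost]
      linarith
    · rintro ⟨-, ⟨P, hP⟩, hne⟩
      -- the partition bounds the position of the first choice from both sides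
      refine hbad ⟨?_, hne i hi⟩
      have h1 := hI₃.first_ge P hP i hi
      have h2 := hI.first_ge (c i)
      have h3 := (hI.sound P hP (c i)).1
      rw [hP.2 i hi] at h1 h3
      omega

/-! ### The algorithm -/

theorem hasPref_input (I : Instance n) (a b : Fin n) : HasPref I (I.input a b) := by
  refine ⟨rfl, fun x k => ?_⟩
  have h := index_lt x.2 k.2
  have hn : 0 < n := x.pos
  have h1 : ((x : ℕ) * n + k) / n = x := by
    rw [Nat.add_comm, Nat.add_mul_div_right _ _ hn, Nat.div_eq_of_lt k.2, Nat.zero_add]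
  have h2 : ((x : ℕ) * n + k) % n = k := by
    rw [Nat.add_comm, Nat.add_mul_mod_self_right, Nat.mod_eq_of_lt k.2]
  simp only [Instance.input]
  rw [dif_pos ⟨trivial, h⟩]
  simp only [h1, h2]

/-- At most one sequence completes `a, b` to a stable even cycle, since a run of `findCmd`, within
any sufficient bound, leaves at most one candidate. -/
theorem Instance.IsEvenCompletion.unique {I : Instance n} {a b : Fin n} {r r' : List (Fin n)}
    (h : I.IsEvenCompletion a b r) (h' : I.IsEvenCompletion a b r') : r = r' := by
  obtain ⟨s, t, -, -, -, h1⟩ := reaches_findCmd (B := n * n + 4 * n + 4) le_rfl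
    (hasPref_input I a b) rfl rfl rfl rfl
  rcases h1 with ⟨-, h1⟩ | ⟨-, l, hl⟩
  · obtain ⟨P, hP, -⟩ := h.exists_completing
    rw [h1] at hP
    exact absurd hP (Set.notMem_empty P)
  · obtain ⟨f, hf⟩ := hl.1.inv.matched.exists_perm
    have := (hl.eq_map_candidate (fun x => (hf x).1) h).trans
      (hl.eq_map_candidate (fun x => (hf x).1) h').symm
    simpa using this

/-- Outputs the completion of the given pair to a stable even cycle, or nothing if there is none. -/
def completionCmd : Cmd :=
  .seq findCmd <| .ite (.bin .eq (.var 16) (.lit 1))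
    (.seq buildCmd <| .ite (.bin .eq (.get 1 (.lit 1)) (.var 2)) verifyCmd .skip) .skip

theorem findCmd_frame {y : ℕ} (h : y = 2 ∨ y = 3) : ¬ findCmd.WritesVar y := by
  rcases h with rfl | rfl <;>
  simp [findCmd, rankCmd, resetCmd, offerCmd, proposeCmd, initSearchCmd, searchCmd, eliminateCmd,
    popCmd, Cmd.for, Cmd.WritesVar]

theorem reaches_completionCmd (I : Instance n) (a b : Fin n) {B : ℕ}
    (hB : n * n + 4 * n + 4 ≤ B) :
    Reaches B completionCmd (I.input a b) fun s t => t ≤ 4000 * ((n + 1) * (n + 1)) ∧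
      ((∃ r, I.IsEvenCompletion a b r ∧ s.output = (a :: b :: r).map Fin.val) ∨
        ((¬ ∃ r, I.IsEvenCompletion a b r) ∧ s.output = [])) := by
  have hbn := b.2
  refine Reaches.seq ((reaches_findCmd hB (hasPref_input I a b) rfl rfl rfl rfl).frame.mono ?_)
  rintro s₁ t₁ ⟨⟨ht₁, hr₁, h₁⟩, v₁, -⟩
  have h3₁ : s₁.var 3 = 0 := v₁ 3 (findCmd_frame (Or.inr rfl))
  have h2₁ : s₁.var 2 = b := v₁ 2 (findCmd_frame (Or.inl rfl))
  have hnil : ∀ s : State, s.var 3 = 0 → s.output = [] := fun s h => by simp [State.output, h]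
  have hn : 60 * (n + 1) ≤ 60 * ((n + 1) * (n + 1)) := by nlinarith
  have hn1 : 1 ≤ (n + 1) * (n + 1) := Nat.mul_pos (Nat.succ_pos n) (Nat.succ_pos n)
  rcases h₁ with ⟨h16, hempty⟩ | ⟨h16, l, hl⟩
  · refine Reaches.ite (Evals.eq (Evals.var h16 (by omega)) (Evals.lit (by omega))
      (by omega)) (by omega) (fun _ => Reaches.skip ⟨?_, Or.inr ⟨?_, hnil _ h3₁⟩⟩)
    · simp only [Expr.cost]
      linarith
    · rintro ⟨r, hr⟩
      obtain ⟨P, hP, -⟩ := hr.exists_completing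
      rw [hempty] at hP
      exact Set.notMem_empty P hP
  refine Reaches.ite (Evals.eq (Evals.var h16 (by omega)) (Evals.lit (by omega))
    (by omega)) (fun _ => ?_) (by omega)
  obtain ⟨f, hf⟩ := hl.1.inv.matched.exists_perm
  have hf : ∀ x, I.rank x (f x) = s₁.tab n 3 x := fun x => (hf x).1
  have hlen := hl.1.length_le
  have hl0 : 0 < l.length := List.length_pos_of_mem hl.1.inv.mem_last
  refine Reaches.seq ((hl.reaches_buildCmd hB hf).frame.mono ?_)
  rintro s₂ t₂ ⟨⟨ht₂, h17, harr⟩, v₂, a₂⟩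
  have h3₂ : s₂.var 3 = 0 := (v₂ 3 (by simp [buildCmd, Cmd.for, Cmd.WritesVar])).trans h3₁
  have h2₂ : s₂.var 2 = b := (v₂ 2 (by simp [buildCmd, Cmd.for, Cmd.WritesVar])).trans h2₁
  have hr₂ : HasRank I s₂ := hr₁.congr (v₂ 0 (by simp [buildCmd, Cmd.for, Cmd.WritesVar]))
    (a₂ 0 (by simp [buildCmd, Cmd.for, Cmd.WritesArr]))
    (a₂ 2 (by simp [buildCmd, Cmd.for, Cmd.WritesArr]))
  have huniq : ∀ r, I.IsEvenCompletion a b r → _ := fun r hr => hl.eq_map_candidate hf hr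
  have hc0 : candidate f a l 0 = a := rfl
  have hcm : candidate f a l (2 * l.length) = candidate f a l 0 := by
    have hlast := hl.1.inv.last
    obtain ⟨m, hm⟩ : ∃ m, l.length = m + 1 := ⟨l.length - 1, by omega⟩
    rw [List.getLast?_eq_getElem?] at hlast
    have h5 : l.length - 1 = m := by omega
    rw [h5] at hlast
    unfold candidate
    rw [if_pos (by omega), Nat.mul_div_cancel_left _ (by omega), hm, List.getD_cons_succ]
    simp [hlast]
  generalize candidate f a l = c at *
  generalize hm : 2 * l.length = m at *
  have hc1n := (c 1).2
  refine Reaches.ite (Evals.eq (Evals.get (Evals.lit (by omega)) (harr 1 (by omega)) (by omega))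
    (Evals.var h2₂ (by omega)) (by omega)) (fun h1 => ?_) (fun h1 => ?_)
  · have hc1 : c 1 = b := Fin.ext h1
    have hw : HasWalk I c m s₂ := ⟨hr₂, h17, harr⟩
    refine (reaches_verifyCmd hB (by omega) (by omega) hcm hw h3₂).mono ?_
    rintro s₃ t₃ ⟨ht₃, ha₃, h₃⟩
    refine ⟨?_, ?_⟩
    · simp only [Expr.cost]
      linarith
    rcases h₃ with ⟨h3, hm2, ⟨P, hP⟩, hne⟩ | ⟨h3, hno⟩
    · obtain ⟨k, rfl⟩ : ∃ k, m = k + 2 := ⟨m - 2, by omega⟩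
      have hcyc := isCycleOf_map_range (by omega) hP.2 hcm hne
      have hlist : (List.range (k + 2)).map c =
          a :: b :: (List.range k).map fun i => c (i + 2) := by
        rw [List.range_succ_eq_map, List.range_succ_eq_map]
        simp [hc0, hc1, Function.comp_def]
      refine Or.inl ⟨(List.range k).map fun i => c (i + 2), ?_, ?_⟩
      · unfold Instance.IsEvenCompletion
        rw [← hlist]
        exact ⟨⟨P, hP.1, hcyc⟩, by simp [← hm], by simpa using hm2⟩
      · rw [← hlist, State.output, h3, List.map_map, ha₃]
        refine List.map_congr_left fun i hi => ?_
        rw [List.mem_range] at hi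
        exact harr i (by omega)
    · refine Or.inr ⟨?_, hnil _ h3⟩
      rintro ⟨r, hr⟩
      obtain ⟨P, hP, hcyc⟩ := hr.exists_completing
      have hlen2 := hr.2.2
      have hget := hcyc.getElem_eq (by simp)
      have hit := hcyc.iterate_length (by simp)
      have hnd := hcyc.2.1
      have hr' := huniq r hr
      rw [List.getElem_cons_zero] at hit
      simp only [List.getElem_cons_zero] at hget
      have hlenm : (a :: b :: r).length = m := by rw [hr']; simp
      rw [hlenm] at hlen2 hit
      have hci : ∀ i < m, c i = P^[i] a := fun i hi => by
        rw [← hget i (by omega)]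
        simp only [hr', List.getElem_map, List.getElem_range]
      have hci' : ∀ i ≤ m, c i = P^[i] a := fun i hi => by
        rcases hi.lt_or_eq with h | rfl
        · exact hci i h
        · rw [hit, hcm, hc0]
      refine hno ⟨hlen2, ⟨P, hP.1, fun i hi => ?_⟩, fun i hi hi0 e => ?_⟩
      · rw [hci i hi, hci' (i + 1) hi, Function.iterate_succ_apply']
      · rw [hr'] at hnd
        have := List.inj_on_of_nodup_map hnd (List.mem_range.2 hi)
          (List.mem_range.2 (by omega : 0 < m)) e
        omega
  · refine Reaches.skip ⟨?_, Or.inr ⟨?_, hnil _ h3₂⟩⟩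
    · simp only [Expr.cost]
      linarith
    · rintro ⟨r, hr⟩
      have hr' := huniq r hr
      have hlenm : (a :: b :: r).length = m := by rw [hr']; simp
      have h5 : (a :: b :: r)[1] = c 1 := by
        simp only [hr', List.getElem_map, List.getElem_range]
      exact h1 (by rw [← h5]; rfl)

end StableRoommates

theorem mainTheorem2 :
    (∀ (n : ℕ), Even n → ∀ (I : StableRoommates.Instance n) (a b : Fin n), a ≠ b →
      ∀ r r' : List (Fin n), I.IsEvenCompletion a b r → I.IsEvenCompletion a b r' → r = r') ∧
    (∃ (p : RAM.Cmd) (K : ℕ),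
      ∀ (n : ℕ), Even n → ∀ (I : StableRoommates.Instance n) (a b : Fin n), a ≠ b →
        ∃ (s : RAM.State) (t : ℕ),
          RAM.Exec (K * n ^ 2) p (I.input a b) s t ∧ t ≤ K * n ^ 2 ∧
          ((∃ r, I.IsEvenCompletion a b r ∧ s.output = (a :: b :: r).map Fin.val) ∨
            ((¬ ∃ r, I.IsEvenCompletion a b r) ∧ s.output = []))) := by
  refine ⟨fun n _ I a b _ r r' h h' => h.unique h',
    StableRoommates.completionCmd, 16000, fun n _ I a b _ => ?_⟩
  -- as `1 ≤ n`, the time `4000 * (n + 1) ^ 2` is at most `16000 * n ^ 2`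
  have hn : 1 ≤ n := a.pos
  obtain ⟨s, t, hx, ht, h⟩ := StableRoommates.reaches_completionCmd I a b
    (B := 16000 * n ^ 2) (by nlinarith)
  exact ⟨s, t, hx, by nlinarith, h⟩
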